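/- **Setting.** Let $a<b$, $c<d$ and $n_0,n_1,n_2\in\mathbb N$; write $L_2^n$, $L_2^n[x]$, $L_2^n[y]$ for the real square-integrable $\mathbb R^n$-valued functions on $[a,b]\times[c,d]$, $[a,b]$, $[c,d]$, and $H_k=\{u\in L_2:\partial_x^i\partial_y^j u\in L_2,\ 0\le i,j\le k\}$ (weak derivatives) with norm $\sum_{i,j\le k}\|\partial_x^i\partial_y^ju\|_{L_2}$. States are $u=(u_0,u_1,u_2)\in Y:=L_2^{n_0}\times H_1^{n_1}\times H_2^{n_2}$. Let $\Lambda_{\rm bf}u\in\mathbb R^{4n_1+16n_2}\times L_2^{2n_1+4n_2}[x]\times L_2^{2n_1+4n_2}[y]$ list the values of $u_1$ and of $u_2,\partial_xu_2,\partial_yu_2,\partial_x\partial_yu_2$ at the corners $(a,c),(b,c),(a,d),(b,d)$, the traces of $\partial_xu_1,\partial_x^2u_2,\partial_x^2\partial_yu_2$ on $y=c$ and $y=d$, and the traces of $\partial_yu_1,\partial_y^2u_2,\partial_x\partial_y^2u_2$ on $x=a$ and $x=b$. A 1D-PI operator on $[s,t]$ with parameters $\{N_0,N_1,N_2\}$ is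 $N_0(x)u(x)+\int_s^xN_1(x,\theta)u(\theta)d\theta+\int_x^tN_2(x,\theta)u(\theta)d\theta$; it is separable if $N_1=N_2$. A 011-PI operator $\mathcal P[Q]$, acting between spaces $\mathbb R^{m_0}\times L_2^{m_1}[x]\times L_2^{m_1}[y]$, is $$\mathcal P[Q]\begin{bmatrix}w_0\\w_1\\w_2\end{bmatrix}=\begin{bmatrix}Q_{00}w_0+\int_a^bQ_{01}(x)w_1(x)dx+\int_c^dQ_{02}(y)w_2(y)dy\\ Q_{10}(x)w_0+(\mathcal P[Q_{11}]w_1)(x)+\int_c^dQ_{12}(x,y)w_2(y)dy\\ Q_{20}(y)w_0+\int_a^bQ_{21}(x,y)w_1(x)dx+(\mathcal P[Q_{22}]w_2)(y)\end{bmatrix},$$ with $Q_{11},Q_{22}$ 1D-PI parameters, all entries square integrable and the multipliers $Q_{11}^0,Q_{22}^0$ essentially bounded; $Q$ is called separable if $Q_{11},Q_{22}$ are. Let $\mathcal B=\mathcal P[B]$ be a separable 011-PI operator from $\mathbb R^{4n_1+16n_2}\times L_2^{2n_1+4n_2}[x]\times L_2^{2n_1+4n_2}[y]$ to $\mathbb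 R^{n_1+4n_2}\times L_2^{n_1+2n_2}[x]\times L_2^{n_1+2n_2}[y]$, and $X(\mathcal B)=\{u\in Y:\mathcal B\Lambda_{\rm bf}u=0\}$. **The map $\mathcal T$.** For $w=(w_0,w_1,w_2)\in\mathbb R^{n_1+4n_2}\times L_2^{n_1+2n_2}[x]\times L_2^{n_1+2n_2}[y]$ and $v\in L_2^{n_0+n_1+n_2}$ put $$(\mathcal K_1w)(x,y)=K_{30}(x,y)w_0+\int_a^xK_{31}(x,y,\theta)w_1(\theta)d\theta+\int_c^yK_{32}(x,y,\nu)w_2(\nu)d\nu,$$ $$(\mathcal K_2v)(x,y)=T_{00}v(x,y)+\int_a^x\!\int_c^yK_{33}(x,y,\theta,\nu)v(\theta,\nu)d\nu d\theta,$$ where $$K_{30}=\begin{bmatrix}0&0&0&0&0\\I&0&0&0&0\\0&I&(x-a)I&(y-c)I&(y-c)(x-a)I\end{bmatrix},\quad K_{31}=\begin{bmatrix}0&0&0\\I&0&0\\0&(x-\theta)I&(y-c)(x-\theta)I\end{bmatrix},\quad K_{32}=\begin{bmatrix}0&0&0\\I&0&0\\0&(y-\nu)I&(x-a)(y-\nu)I\end{bmatrix},$$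 $T_{00}={\rm diag}(I,0,0)$ and $K_{33}={\rm diag}(0,I,(x-\theta)(y-\nu)I)$. Let $\mathcal H_1=\Lambda_{\rm bf}\mathcal K_1$, a 011-PI operator with parameters $H_{00}$, $H_{01}(x)$, $H_{02}(y)$, $\{H_{11},0,0\}$, $\{H_{22},0,0\}$ (other entries $0$), and $\mathcal H_2=\Lambda_{\rm bf}\mathcal K_2$, that is $\mathcal H_2v=\big(\int_a^b\!\int_c^dH_{03}(x,y)v(x,y)dydx,\ \int_c^dH_{13}(y)v(x,y)dy,\ \int_a^bH_{23}(x)v(x,y)dx\big)$. Suppose the boundary conditions are well-posed: $\mathcal B\mathcal H_1$ is invertible, with $(\mathcal B\mathcal H_1)^{-1}=\mathcal P[\hat E]$ for some separable 011-PI parameters $\hat E$. Let $F$ be given by $$F_0(x,y)=B_{00}H_{03}(x,y)+B_{01}(x)H_{13}(y)+B_{02}(y)H_{23}(x),\quad F_1^0(x,y)=B_{11}^0(x)H_{13}(y),\quad F_2^0(x,y)=B_{22}^0(y)H_{23}(x),$$ $$F_1^1(x,y,\theta)=B_{10}(x)H_{03}(\theta,y)+B_{11}^1(x,\theta)H_{13}(y)+B_{12}(x,y)H_{23}(\theta),$$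 $$F_2^1(x,y,\nu)=B_{20}(y)H_{03}(x,\nu)+B_{22}^1(y,\nu)H_{23}(x)+B_{21}(x,y)H_{13}(\nu),$$ let $G$ be given by $$G_0(x,y)=\hat E_{00}F_0(x,y)+\hat E_{01}(x)F_1^0(x,y)+\int_a^b\hat E_{01}(\theta)F_1^1(\theta,y,x)d\theta+\hat E_{02}(y)F_2^0(x,y)+\int_c^d\hat E_{02}(\nu)F_2^1(x,\nu,y)d\nu,$$ $$G_1^0(x,y)=\hat E_{11}^0(x)F_1^0(x,y),\qquad G_2^0(x,y)=\hat E_{22}^0(y)F_2^0(x,y),$$ $$G_1^1(x,y,\theta)=\hat E_{10}(x)F_0(\theta,y)+\hat E_{11}^0(x)F_1^1(x,y,\theta)+\hat E_{11}^1(x,\theta)F_1^0(\theta,y)+\int_a^b\hat E_{11}^1(x,\eta)F_1^1(\eta,y,\theta)d\eta+\hat E_{12}(x,y)F_2^0(\theta,y)+\int_c^d\hat E_{12}(x,\nu)F_2^1(\theta,\nu,y)d\nu,$$ $$G_2^1(x,y,\nu)=\hat E_{20}(y)F_0(x,\nu)+\hat E_{22}^0(y)F_2^1(x,y,\nu)+\hat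 E_{22}^1(y,\nu)F_2^0(x,\nu)+\int_c^d\hat E_{22}^1(y,\mu)F_2^1(x,\mu,\nu)d\mu+\hat E_{21}(x,y)F_1^0(x,\nu)+\int_a^b\hat E_{21}(\theta,y)F_1^1(\theta,\nu,x)d\theta,$$ and let $$T_{22}(x,y,\theta,\nu)=-K_{30}(x,y)G_0(\theta,\nu)-\int_a^xK_{31}(x,y,\eta)G_1^1(\eta,\nu,\theta)d\eta-\int_c^yK_{32}(x,y,\mu)G_2^1(\theta,\mu,\nu)d\mu,$$ $$T_{12}=-K_{31}(x,y,\theta)G_1^0(\theta,\nu)+T_{22},\qquad T_{21}=-K_{32}(x,y,\nu)G_2^0(\theta,\nu)+T_{22},\qquad T_{11}=K_{33}+T_{21}+T_{12}-T_{22}.$$ The operator $\mathcal T$, which is $\mathcal K_2-\mathcal K_1(\mathcal B\mathcal H_1)^{-1}\mathcal B\mathcal H_2$ and does not depend on the choice of $\hat E$, is $$(\mathcal Tv)(x,y)=T_{00}v(x,y)+\int_a^x\!\Big(\int_c^yT_{11}v\,d\nu+\int_y^dT_{12}v\,d\nu\Big)d\theta+\int_x^b\!\Big(\int_c^yT_{21}v\,d\nu+\int_y^dT_{22}v\,d\nu\Big)d\theta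 .$$ **The equations.** Let $N_0=I_{n_0+n_1+n_2}$, and let $N_1,N_2$ select the components $(u_1,u_2)$, respectively $u_2$; let $A_{ij}$ ($0\le i,j\le2$) be real matrices with $n_0+n_1+n_2$ rows and as many columns as $N_{\max\{i,j\}}$ has rows, and put $$\mathcal A=\sum_{i,j=0}^2A_{ij}\big(\partial_x^i\partial_y^j[N_{\max\{i,j\}}\mathcal T]\big).$$ A function $\hat u:[0,\infty)\to L_2^{n_0+n_1+n_2}$ solves the PIE with initial condition $\hat u_I$ if it is Fréchet differentiable, $\hat u(0)=\hat u_I$ and $\mathcal T\dot{\hat u}(t)=\mathcal A\hat u(t)$ for all $t\ge0$. A function $u:[0,\infty)\to X(\mathcal B)$ solves the PDE $\{A_{ij},\mathcal B\}$ with initial condition $u_I\in X(\mathcal B)$ if it is Fréchet differentiable as a $Y$-valued function, $u(0)=u_I$ and $\dot u(t)=\sum_{i,j=0}^2A_{ij}\,\partial_x^i\partial_y^j(N_{\max\{i,j\}}u(t))$ for all $t\ge0$. **Claim.** $\mathcal T$ maps $L_2^{n_0+n_1+n_2}$ into $X(\mathcal B)$ (so $\mathcal A$ is defined on all of $L_2^{n_0+n_1+n_2}$),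 and for all $\hat u_I\in L_2^{n_0+n_1+n_2}$ and $\hat u:[0,\infty)\to L_2^{n_0+n_1+n_2}$: $\hat u$ solves the PIE with initial condition $\hat u_I$ if and only if $u=\mathcal T\hat u$ solves the PDE $\{A_{ij},\mathcal B\}$ with initial condition $u_I=\mathcal T\hat u_I$. The same equivalence holds when time derivatives are taken in the weaker sense in which $u$ is only required to be differentiable as an $L_2$-valued function and the PIE is read as $\frac{d}{dt}(\mathcal T\hat u)(t)=\mathcal A\hat u(t)$ in $L_2$. -/

import Mathlib

open MeasureTheory Set

noncomputable section

namespace PIE2D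

/-! ### The domain, square-integrable functions, weak derivatives, Sobolev spaces -/

/-- A nondegenerate rectangle `[a,b] × [c,d]`. -/
structure Rect where
  a : ℝ
  b : ℝ
  c : ℝ
  d : ℝ
  hab : a < b
  hcd : c < d

namespace Rect

/-- Lebesgue measure on `[a,b]`. -/
abbrev μx (R : Rect) : Measure ℝ := volume.restrict (Icc R.a R.b)

/-- Lebesgue measure on `[c,d]`. -/
abbrev μy (R : Rect) : Measure ℝ := volume.restrict (Icc R.c R.d)

/-- Lebesgue measure on `[a,b] × [c,d]`. -/
abbrev μ (R : Rect) : Measure (ℝ × ℝ) := volume.restrict (Icc R.a R.b ×ˢ Icc R.c R.d)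

end Rect

/-- The scalar space `L₂[x,y]`. -/
abbrev L2 (R : Rect) : Type := Lp ℝ 2 R.μ

/-- Classical partial derivative in `x`. -/
def pdx (φ : ℝ × ℝ → ℝ) : ℝ × ℝ → ℝ := fun z => fderiv ℝ φ z (1, 0)

/-- Classical partial derivative in `y`. -/
def pdy (φ : ℝ × ℝ → ℝ) : ℝ × ℝ → ℝ := fun z => fderiv ℝ φ z (0, 1)

/-- Test functions: smooth, with compact support inside the open rectangle. -/
structure IsTest (R : Rect) (φ : ℝ × ℝ → ℝ) : Prop where
  smooth : ContDiff ℝ ((⊤ : ℕ∞) : WithTop ℕ∞) φ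
  compact : HasCompactSupport φ
  supp : tsupport φ ⊆ Ioo R.a R.b ×ˢ Ioo R.c R.d

/-- `g` is the weak derivative `∂ₓⁱ ∂ᵧʲ f` on the rectangle. -/
def IsWeakDeriv (R : Rect) (i j : ℕ) (f g : L2 R) : Prop :=
  ∀ φ : ℝ × ℝ → ℝ, IsTest R φ →
    ∫ z, f z * (pdx^[i] (pdy^[j] φ)) z ∂(R.μ) = (-1) ^ (i + j) * ∫ z, g z * φ z ∂(R.μ)

theorem smooth_pdx {φ : ℝ × ℝ → ℝ} (h : ContDiff ℝ ((⊤ : ℕ∞) : WithTop ℕ∞) φ) :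
    ContDiff ℝ ((⊤ : ℕ∞) : WithTop ℕ∞) (pdx φ) :=
  (h.fderiv_right (m := ((⊤ : ℕ∞) : WithTop ℕ∞)) (by simp)).clm_apply contDiff_const

theorem smooth_pdy {φ : ℝ × ℝ → ℝ} (h : ContDiff ℝ ((⊤ : ℕ∞) : WithTop ℕ∞) φ) :
    ContDiff ℝ ((⊤ : ℕ∞) : WithTop ℕ∞) (pdy φ) :=
  (h.fderiv_right (m := ((⊤ : ℕ∞) : WithTop ℕ∞)) (by simp)).clm_apply contDiff_const

theorem smooth_iter {φ : ℝ × ℝ → ℝ} (h : ContDiff ℝ ((⊤ : ℕ∞) : WithTop ℕ∞) φ) (i j : ℕ) :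
    ContDiff ℝ ((⊤ : ℕ∞) : WithTop ℕ∞) (pdx^[i] (pdy^[j] φ)) := by
  have h1 : ContDiff ℝ ((⊤ : ℕ∞) : WithTop ℕ∞) (pdy^[j] φ) := by
    induction j with
    | zero => exact h
    | succ n ih => rw [Function.iterate_succ_apply']; exact smooth_pdy ih
  induction i with
  | zero => exact h1
  | succ n ih => rw [Function.iterate_succ_apply']; exact smooth_pdx ih

theorem integrable_mul_cont (R : Rect) (f : L2 R) {ψ : ℝ × ℝ → ℝ} (hψ : Continuous ψ) :
    Integrable (fun z => f z * ψ z) R.μ := by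
  have hK : IsCompact (Icc R.a R.b ×ˢ Icc R.c R.d) := isCompact_Icc.prod isCompact_Icc
  obtain ⟨C, hC⟩ := hK.exists_bound_of_continuousOn hψ.continuousOn
  have : IsFiniteMeasure R.μ := ⟨by simpa using hK.measure_lt_top⟩
  have hb : ∀ᵐ z ∂(R.μ), ‖ψ z‖ ≤ C :=
    (ae_restrict_iff' hK.measurableSet).2 (Filter.Eventually.of_forall hC)
  have hm : MemLp ψ 2 R.μ := MemLp.of_bound hψ.aestronglyMeasurable C hb
  exact (Lp.memLp f).integrable_mul hm

theorem IsWeakDeriv.add {R : Rect} {i j : ℕ} {f g f' g' : L2 R}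
    (h : IsWeakDeriv R i j f g) (h' : IsWeakDeriv R i j f' g') :
    IsWeakDeriv R i j (f + f') (g + g') := by
  intro φ hφ
  have e1 := h φ hφ
  have e2 := h' φ hφ
  have c1 := (smooth_iter hφ.smooth i j).continuous
  have c2 := hφ.smooth.continuous
  have a1 : ∫ z, (f + f' : L2 R) z * (pdx^[i] (pdy^[j] φ)) z ∂(R.μ)
      = ∫ z, (f z * (pdx^[i] (pdy^[j] φ)) z + f' z * (pdx^[i] (pdy^[j] φ)) z) ∂(R.μ) := by
    apply integral_congr_ae
    filter_upwards [Lp.coeFn_add f f'] with z hz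
    rw [hz, Pi.add_apply, add_mul]
  have a2 : ∫ z, (g + g' : L2 R) z * φ z ∂(R.μ) = ∫ z, (g z * φ z + g' z * φ z) ∂(R.μ) := by
    apply integral_congr_ae
    filter_upwards [Lp.coeFn_add g g'] with z hz
    rw [hz, Pi.add_apply, add_mul]
  rw [a1, a2, integral_add (integrable_mul_cont R f c1) (integrable_mul_cont R f' c1),
    integral_add (integrable_mul_cont R g c2) (integrable_mul_cont R g' c2), e1, e2, mul_add]

theorem IsWeakDeriv.smul {R : Rect} {i j : ℕ} {f g : L2 R} (r : ℝ)
    (h : IsWeakDeriv R i j f g) : IsWeakDeriv R i j (r • f) (r • g) := by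
  intro φ hφ
  have e1 := h φ hφ
  have a1 : ∫ z, (r • f : L2 R) z * (pdx^[i] (pdy^[j] φ)) z ∂(R.μ)
      = ∫ z, r * (f z * (pdx^[i] (pdy^[j] φ)) z) ∂(R.μ) := by
    apply integral_congr_ae
    filter_upwards [Lp.coeFn_smul r f] with z hz
    rw [hz, Pi.smul_apply, smul_eq_mul, mul_assoc]
  have a2 : ∫ z, (r • g : L2 R) z * φ z ∂(R.μ) = ∫ z, r * (g z * φ z) ∂(R.μ) := by
    apply integral_congr_ae
    filter_upwards [Lp.coeFn_smul r g] with z hz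
    rw [hz, Pi.smul_apply, smul_eq_mul, mul_assoc]
  rw [a1, a2, integral_const_mul, integral_const_mul, e1]
  ring

theorem IsWeakDeriv.zero (R : Rect) (i j : ℕ) : IsWeakDeriv R i j (0 : L2 R) 0 := by
  have h : ∀ ψ : ℝ × ℝ → ℝ, ∫ z, (0 : L2 R) z * ψ z ∂(R.μ) = 0 := by
    intro ψ
    rw [← integral_zero (ℝ × ℝ) ℝ (μ := R.μ)]
    apply integral_congr_ae
    have hz := Lp.coeFn_zero ℝ 2 R.μ
    refine hz.mono fun z hz => ?_
    have e : ((0 : L2 R) : ℝ × ℝ → ℝ) z = 0 := hz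
    change ((0 : L2 R) : ℝ × ℝ → ℝ) z * ψ z = 0
    rw [e, zero_mul]
  intro φ _
  rw [h, h, mul_zero]

/-- The Sobolev space `H_k[x,y]` of those `u ∈ L₂` with `∂ₓⁱ ∂ᵧʲ u ∈ L₂` for all `i, j ≤ k`. An
element is stored as the family of its weak derivatives, which `u`, the member of index `(0,0)`,
determines; so the norm is `∑_{i,j ≤ k} ‖∂ₓⁱ ∂ᵧʲ u‖_{L₂}`. -/
def Sob (R : Rect) (k : ℕ) :
    Submodule ℝ (PiLp 1 (fun _ : Fin (k + 1) × Fin (k + 1) => L2 R)) where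
  carrier := {v | ∀ α : Fin (k + 1) × Fin (k + 1), IsWeakDeriv R α.1 α.2 (v (0, 0)) (v α)}
  add_mem' := fun {_ _} hu hv α => IsWeakDeriv.add (i := α.1) (j := α.2) (hu α) (hv α)
  zero_mem' := fun α => IsWeakDeriv.zero R α.1 α.2
  smul_mem' := fun r _ hu α => IsWeakDeriv.smul (i := α.1) (j := α.2) r (hu α)

/-- The weak derivative `∂ₓⁱ ∂ᵧʲ u` of `u ∈ H_k`, for `i, j ≤ k`. -/
def Dv {R : Rect} {k : ℕ} (u : Sob R k) (i j : Fin (k + 1)) : L2 R := u.1 (i, j)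

/-! ### Index types -/

/-- Components of the state `u = (u₀, u₁, u₂)`. -/
abbrev St (n₀ n₁ n₂ : ℕ) : Type := Fin n₀ ⊕ (Fin n₁ ⊕ Fin n₂)

/-- The order of differentiability of each component. -/
def reg {n₀ n₁ n₂ : ℕ} : St n₀ n₁ n₂ → ℕ
  | .inl _ => 0
  | .inr (.inl _) => 1
  | .inr (.inr _) => 2

/-- `4 n₁ + 16 n₂` corner values: `(corner, component)` for `u₁`, and
`(derivative, corner, component)` for `u₂`. Corners are listed as `(a,c), (b,c), (a,d), (b,d)` and
derivatives as `1, ∂ₓ, ∂ᵧ, ∂ₓ∂ᵧ`. -/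
abbrev BF0 (n₁ n₂ : ℕ) : Type := (Fin 4 × Fin n₁) ⊕ (Fin 4 × Fin 4 × Fin n₂)

/-- `2 n₁ + 4 n₂` edge values: `(edge, component)` for `u₁`, and
`(derivative, edge, component)` for `u₂`. -/
abbrev BF1 (n₁ n₂ : ℕ) : Type := (Fin 2 × Fin n₁) ⊕ (Fin 2 × Fin 2 × Fin n₂)

/-- `n₁ + 4 n₂` core corner values, at `(a,c)`: `u₁`, and `u₂, ∂ₓu₂, ∂ᵧu₂, ∂ₓ∂ᵧu₂`. -/
abbrev BC0 (n₁ n₂ : ℕ) : Type := Fin n₁ ⊕ (Fin 4 × Fin n₂)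

/-- `n₁ + 2 n₂` core edge values: `∂ₓu₁, ∂ₓ²u₂, ∂ₓ²∂ᵧu₂` at `y = c`
(respectively `∂ᵧu₁, ∂ᵧ²u₂, ∂ₓ∂ᵧ²u₂` at `x = a`). -/
abbrev BC1 (n₁ n₂ : ℕ) : Type := Fin n₁ ⊕ (Fin 2 × Fin n₂)

/-- The space `L₂^{n₀+n₁+n₂}[x,y]`. -/
abbrev L2St (R : Rect) (n₀ n₁ n₂ : ℕ) : Type := St n₀ n₁ n₂ → L2 R

/-- The space `L₂^{n₀} × H₁^{n₁} × H₂^{n₂}` (note that `H₀ = L₂`). -/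
abbrev SobSt (R : Rect) (n₀ n₁ n₂ : ℕ) : Type := (q : St n₀ n₁ n₂) → Sob R (reg q)

/-! ### Partial integral operators -/

section PI

variable {p q p₀ q₀ p₁ q₁ : Type} [Fintype q] [Fintype q₀] [Fintype q₁]

/-- Integral of a vector-valued function, componentwise. -/
def vint (s t : ℝ) (f : ℝ → p → ℝ) : p → ℝ := fun i => ∫ η in s..t, f η i

/-- Integral of a matrix-valued function, entrywise. -/
def mint {r : Type} (s t : ℝ) (f : ℝ → Matrix p r ℝ) : Matrix p r ℝ :=
  Matrix.of fun i j => ∫ η in s..t, f η i j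

/-- Parameters `{N₀, N₁, N₂}` of a 1D-PI operator. -/
structure N1D (p q : Type) where
  n0 : ℝ → Matrix p q ℝ
  n1 : ℝ → ℝ → Matrix p q ℝ
  n2 : ℝ → ℝ → Matrix p q ℝ

/-- Regularity of the parameters of an operator `L₂ → L₂` over the interval with Lebesgue measure
`m`: square-integrable kernels, and an essentially bounded multiplier. -/
structure N1D.Mem (N : N1D p q) (m : Measure ℝ) : Prop where
  n0 : ∀ i j, MemLp (fun x => N.n0 x i j) ⊤ m
  n1 : ∀ i j, MemLp (fun z : ℝ × ℝ => N.n1 z.1 z.2 i j) 2 (m.prod m)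
  n2 : ∀ i j, MemLp (fun z : ℝ × ℝ => N.n2 z.1 z.2 i j) 2 (m.prod m)

/-- The 1D-PI operator
`(P[N]u)(x) = N₀(x) u(x) + ∫ₛˣ N₁(x,θ) u(θ) dθ + ∫ₓᵗ N₂(x,θ) u(θ) dθ` on `[s,t]`. -/
def N1D.op (N : N1D p q) (s t : ℝ) (u : ℝ → q → ℝ) : ℝ → p → ℝ := fun x =>
  (N.n0 x).mulVec (u x) + vint s x (fun θ => (N.n1 x θ).mulVec (u θ))
    + vint x t (fun θ => (N.n2 x θ).mulVec (u θ))

/-- Parameters of a 011-PI operator. Functions of both variables take `x` first. -/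
structure N011 (p₀ q₀ p₁ q₁ : Type) where
  b00 : Matrix p₀ q₀ ℝ
  b01 : ℝ → Matrix p₀ q₁ ℝ
  b02 : ℝ → Matrix p₀ q₁ ℝ
  b10 : ℝ → Matrix p₁ q₀ ℝ
  b11 : N1D p₁ q₁
  b12 : ℝ → ℝ → Matrix p₁ q₁ ℝ
  b20 : ℝ → Matrix p₁ q₀ ℝ
  b21 : ℝ → ℝ → Matrix p₁ q₁ ℝ
  b22 : N1D p₁ q₁

/-- Regularity of the parameters in `𝒩₀₁₁` on the rectangle. -/
structure N011.Mem (B : N011 p₀ q₀ p₁ q₁) (R : Rect) : Prop where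
  b01 : ∀ i j, MemLp (fun x => B.b01 x i j) 2 R.μx
  b02 : ∀ i j, MemLp (fun y => B.b02 y i j) 2 R.μy
  b10 : ∀ i j, MemLp (fun x => B.b10 x i j) 2 R.μx
  b11 : B.b11.Mem R.μx
  b12 : ∀ i j, MemLp (fun z : ℝ × ℝ => B.b12 z.1 z.2 i j) 2 R.μ
  b20 : ∀ i j, MemLp (fun y => B.b20 y i j) 2 R.μy
  b21 : ∀ i j, MemLp (fun z : ℝ × ℝ => B.b21 z.1 z.2 i j) 2 R.μ
  b22 : B.b22.Mem R.μy

/-- The two 1D-PI blocks are separable: `N₁ = N₂`. -/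
def N011.Separable (B : N011 p₀ q₀ p₁ q₁) : Prop :=
  B.b11.n1 = B.b11.n2 ∧ B.b22.n1 = B.b22.n2

/-- Triples (vector, function of `x`, function of `y`). -/
abbrev RL (q₀ q₁ : Type) : Type := (q₀ → ℝ) × (ℝ → q₁ → ℝ) × (ℝ → q₁ → ℝ)

/-- Membership in `ℝ^{q₀} × L₂^{q₁}[x] × L₂^{q₁}[y]`. -/
def RL.Mem (R : Rect) (w : RL q₀ q₁) : Prop :=
  (∀ i, MemLp (fun x => w.2.1 x i) 2 R.μx) ∧ (∀ i, MemLp (fun y => w.2.2 y i) 2 R.μy)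

/-- Equality in `ℝ^{q₀} × L₂^{q₁}[x] × L₂^{q₁}[y]`: functions agree almost everywhere. -/
def RL.Eqv (R : Rect) (w w' : RL q₀ q₁) : Prop :=
  w.1 = w'.1 ∧ (∀ᵐ x ∂(R.μx), w.2.1 x = w'.2.1 x) ∧ (∀ᵐ y ∂(R.μy), w.2.2 y = w'.2.2 y)

/-- The 011-PI operator `P[B]`. -/
def N011.op (R : Rect) (B : N011 p₀ q₀ p₁ q₁) (w : RL q₀ q₁) : RL p₀ p₁ :=
  (B.b00.mulVec w.1 + vint R.a R.b (fun x => (B.b01 x).mulVec (w.2.1 x))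
      + vint R.c R.d (fun y => (B.b02 y).mulVec (w.2.2 y)),
    fun x => (B.b10 x).mulVec w.1 + B.b11.op R.a R.b w.2.1 x
      + vint R.c R.d (fun y => (B.b12 x y).mulVec (w.2.2 y)),
    fun y => (B.b20 y).mulVec w.1 + vint R.a R.b (fun x => (B.b21 x y).mulVec (w.2.1 x))
      + B.b22.op R.c R.d w.2.2 y)

/-- Parameters of a 2D-PI operator: `n01, n02` have arguments `x y ν`, `n10, n20` have arguments
`x y θ`, and the four kernels of full type have arguments `x y θ ν`. -/
structure N2D (p q : Type) where
  n00 : ℝ → ℝ → Matrix p q ℝ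
  n01 : ℝ → ℝ → ℝ → Matrix p q ℝ
  n02 : ℝ → ℝ → ℝ → Matrix p q ℝ
  n10 : ℝ → ℝ → ℝ → Matrix p q ℝ
  n11 : ℝ → ℝ → ℝ → ℝ → Matrix p q ℝ
  n12 : ℝ → ℝ → ℝ → ℝ → Matrix p q ℝ
  n20 : ℝ → ℝ → ℝ → Matrix p q ℝ
  n21 : ℝ → ℝ → ℝ → ℝ → Matrix p q ℝ
  n22 : ℝ → ℝ → ℝ → ℝ → Matrix p q ℝ

/-- The 2D-PI operator `P[N]`. -/
def N2D.op (R : Rect) (N : N2D p q) (u : ℝ × ℝ → q → ℝ) : ℝ × ℝ → p → ℝ := fun z =>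
  let x := z.1
  let y := z.2
  (N.n00 x y).mulVec (u (x, y))
    + vint R.a x (fun θ => (N.n10 x y θ).mulVec (u (θ, y)))
    + vint x R.b (fun θ => (N.n20 x y θ).mulVec (u (θ, y)))
    + vint R.c y (fun ν => (N.n01 x y ν).mulVec (u (x, ν)))
    + vint y R.d (fun ν => (N.n02 x y ν).mulVec (u (x, ν)))
    + vint R.a x (fun θ => vint R.c y (fun ν => (N.n11 x y θ ν).mulVec (u (θ, ν))))
    + vint x R.b (fun θ => vint R.c y (fun ν => (N.n21 x y θ ν).mulVec (u (θ, ν))))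
    + vint R.a x (fun θ => vint y R.d (fun ν => (N.n12 x y θ ν).mulVec (u (θ, ν))))
    + vint x R.b (fun θ => vint y R.d (fun ν => (N.n22 x y θ ν).mulVec (u (θ, ν))))

end PI

/-! ### Boundary values and the set `X(𝓑)` -/

/-- The value at `z₀` of the continuous representative of `g` is `r`. -/
def HasValue (R : Rect) (g : L2 R) (z₀ : ℝ × ℝ) (r : ℝ) : Prop :=
  ∃ g' : ℝ × ℝ → ℝ, (g' =ᵐ[R.μ] g) ∧ ContinuousOn g' (Icc R.a R.b ×ˢ Icc R.c R.d) ∧ g' z₀ = r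

/-- `w(x) = g(x, s)`, evaluated on a representative of `g` that is continuous in `y` for almost
every `x`. -/
def HasTraceY (R : Rect) (g : L2 R) (s : ℝ) (w : ℝ → ℝ) : Prop :=
  ∃ g' : ℝ × ℝ → ℝ, (g' =ᵐ[R.μ] g) ∧
    ∀ᵐ x ∂(R.μx), ContinuousOn (fun y => g' (x, y)) (Icc R.c R.d) ∧ g' (x, s) = w x

/-- `w(y) = g(s, y)`, evaluated on a representative of `g` that is continuous in `x` for almost
every `y`. -/
def HasTraceX (R : Rect) (g : L2 R) (s : ℝ) (w : ℝ → ℝ) : Prop :=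
  ∃ g' : ℝ × ℝ → ℝ, (g' =ᵐ[R.μ] g) ∧
    ∀ᵐ y ∂(R.μy), ContinuousOn (fun x => g' (x, y)) (Icc R.a R.b) ∧ g' (s, y) = w y

section State

variable {R : Rect} {n₀ n₁ n₂ : ℕ}

/-- The component `(u₁)_k ∈ H₁`. -/
def SobSt.one (u : SobSt R n₀ n₁ n₂) (k : Fin n₁) : Sob R 1 := u (.inr (.inl k))

/-- The component `(u₂)_k ∈ H₂`. -/
def SobSt.two (u : SobSt R n₀ n₁ n₂) (k : Fin n₂) : Sob R 2 := u (.inr (.inr k))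

/-- The corners `(a,c), (b,c), (a,d), (b,d)`. -/
def corner (R : Rect) : Fin 4 → ℝ × ℝ :=
  ![(R.a, R.c), (R.b, R.c), (R.a, R.d), (R.b, R.d)]

/-- `w = Λ_bf u`: the list of all boundary values of `u`. -/
structure IsBoundary (u : SobSt R n₀ n₁ n₂) (w : RL (BF0 n₁ n₂) (BF1 n₁ n₂)) : Prop where
  corner_one : ∀ κ k, HasValue R (Dv (SobSt.one u k) 0 0) (corner R κ) (w.1 (.inl (κ, k)))
  corner_two : ∀ κ k,
    HasValue R (Dv (SobSt.two u k) 0 0) (corner R κ) (w.1 (.inr (0, κ, k))) ∧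
    HasValue R (Dv (SobSt.two u k) 1 0) (corner R κ) (w.1 (.inr (1, κ, k))) ∧
    HasValue R (Dv (SobSt.two u k) 0 1) (corner R κ) (w.1 (.inr (2, κ, k))) ∧
    HasValue R (Dv (SobSt.two u k) 1 1) (corner R κ) (w.1 (.inr (3, κ, k)))
  x_one : ∀ (e : Fin 2) k,
    HasTraceY R (Dv (SobSt.one u k) 1 0) (![R.c, R.d] e) (fun x => w.2.1 x (.inl (e, k)))
  x_two : ∀ (e : Fin 2) k,
    HasTraceY R (Dv (SobSt.two u k) 2 0) (![R.c, R.d] e) (fun x => w.2.1 x (.inr (0, e, k))) ∧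
    HasTraceY R (Dv (SobSt.two u k) 2 1) (![R.c, R.d] e) (fun x => w.2.1 x (.inr (1, e, k)))
  y_one : ∀ (e : Fin 2) k,
    HasTraceX R (Dv (SobSt.one u k) 0 1) (![R.a, R.b] e) (fun y => w.2.2 y (.inl (e, k)))
  y_two : ∀ (e : Fin 2) k,
    HasTraceX R (Dv (SobSt.two u k) 0 2) (![R.a, R.b] e) (fun y => w.2.2 y (.inr (0, e, k))) ∧
    HasTraceX R (Dv (SobSt.two u k) 1 2) (![R.a, R.b] e) (fun y => w.2.2 y (.inr (1, e, k)))

/-- Parameters of the boundary operator `𝓑`. -/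
abbrev BParam (n₁ n₂ : ℕ) : Type :=
  N011 (Fin (n₁ + 4 * n₂)) (BF0 n₁ n₂) (Fin (n₁ + 2 * n₂)) (BF1 n₁ n₂)

/-- Parameters of the type of `(𝓑 𝓗₁)⁻¹`. -/
abbrev EParam (n₁ n₂ : ℕ) : Type :=
  N011 (BC0 n₁ n₂) (Fin (n₁ + 4 * n₂)) (BC1 n₁ n₂) (Fin (n₁ + 2 * n₂))

/-- `X(𝓑) = {u ∈ L₂^{n₀} × H₁^{n₁} × H₂^{n₂} | 𝓑 Λ_bf u = 0}`. The boundary values exist and are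
unique up to null sets for every such `u`. -/
def X (R : Rect) (n₀ : ℕ) {n₁ n₂ : ℕ} (B : BParam n₁ n₂) : Set (SobSt R n₀ n₁ n₂) :=
  {u | ∃ w, IsBoundary u w ∧ RL.Eqv R (B.op R w) 0}

end State

/-! ### The operators `𝓚₁, 𝓚₂, 𝓗₁, 𝓗₂`

`I` stands for an identity block of size `n`; the four functions below put scalar multiples of it
into a matrix. -/

section Blocks

variable {k l m : ℕ} (n : ℕ)

/-- The block column `(vᵢ I)ᵢ`. -/
def bcol (v : Fin k → ℝ) : Matrix (Fin k × Fin n) (Fin n) ℝ :=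
  Matrix.of fun i j => v i.1 * (1 : Matrix (Fin n) (Fin n) ℝ) i.2 j

/-- The block row `(vᵢ I)ᵢ`. -/
def brow (v : Fin k → ℝ) : Matrix (Fin n) (Fin k × Fin n) ℝ :=
  Matrix.of fun i j => v j.1 * (1 : Matrix (Fin n) (Fin n) ℝ) i j.2

/-- `k` groups of `l` block rows with `m` block columns: blocks `(M g) i j I`. -/
def bgrid (M : Fin k → Matrix (Fin l) (Fin m) ℝ) :
    Matrix (Fin k × Fin l × Fin n) (Fin m × Fin n) ℝ :=
  Matrix.of fun i j => M i.1 i.2.1 j.1 * (1 : Matrix (Fin n) (Fin n) ℝ) i.2.2 j.2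

/-- `k` groups of `l` block rows with one block column. -/
def bgcol (v : Fin k → Fin l → ℝ) : Matrix (Fin k × Fin l × Fin n) (Fin n) ℝ :=
  Matrix.of fun i j => v i.1 i.2.1 * (1 : Matrix (Fin n) (Fin n) ℝ) i.2.2 j

end Blocks

section KH

open Matrix

variable (R : Rect) (n₀ n₁ n₂ : ℕ)

def K30 (x y : ℝ) : Matrix (St n₀ n₁ n₂) (BC0 n₁ n₂) ℝ :=
  fromRows 0 (fromBlocks 1 0 0
    (brow n₂ ![1, x - R.a, y - R.c, (y - R.c) * (x - R.a)]))

def K31 (x y θ : ℝ) : Matrix (St n₀ n₁ n₂) (BC1 n₁ n₂) ℝ :=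
  fromRows 0 (fromBlocks 1 0 0 (brow n₂ ![x - θ, (y - R.c) * (x - θ)]))

def K32 (x y ν : ℝ) : Matrix (St n₀ n₁ n₂) (BC1 n₁ n₂) ℝ :=
  fromRows 0 (fromBlocks 1 0 0 (brow n₂ ![y - ν, (x - R.a) * (y - ν)]))

def K33 (x y θ ν : ℝ) : Matrix (St n₀ n₁ n₂) (St n₀ n₁ n₂) ℝ :=
  fromBlocks 0 0 0 (fromBlocks 1 0 0 (((x - θ) * (y - ν)) • 1))

def T00 : Matrix (St n₀ n₁ n₂) (St n₀ n₁ n₂) ℝ := fromBlocks 1 0 0 0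

def H00 : Matrix (BF0 n₁ n₂) (BC0 n₁ n₂) ℝ :=
  fromBlocks (bcol n₁ ![1, 1, 1, 1]) 0 0 (bgrid n₂ ![
    !![1, 0, 0, 0;
       1, R.b - R.a, 0, 0;
       1, 0, R.d - R.c, 0;
       1, R.b - R.a, R.d - R.c, (R.d - R.c) * (R.b - R.a)],
    !![0, 1, 0, 0;
       0, 1, 0, 0;
       0, 1, 0, R.d - R.c;
       0, 1, 0, R.d - R.c],
    !![0, 0, 1, 0;
       0, 0, 1, R.b - R.a;
       0, 0, 1, 0;
       0, 0, 1, R.b - R.a],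
    !![0, 0, 0, 1;
       0, 0, 0, 1;
       0, 0, 0, 1;
       0, 0, 0, 1]])

def H01 (x : ℝ) : Matrix (BF0 n₁ n₂) (BC1 n₁ n₂) ℝ :=
  fromBlocks (bcol n₁ ![0, 1, 0, 1]) 0 0 (bgrid n₂ ![
    !![0, 0; R.b - x, 0; 0, 0; R.b - x, (R.d - R.c) * (R.b - x)],
    !![0, 0; 1, 0; 0, 0; 1, R.d - R.c],
    !![0, 0; 0, R.b - x; 0, 0; 0, R.b - x],
    !![0, 0; 0, 1; 0, 0; 0, 1]])

def H02 (y : ℝ) : Matrix (BF0 n₁ n₂) (BC1 n₁ n₂) ℝ :=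
  fromBlocks (bcol n₁ ![0, 0, 1, 1]) 0 0 (bgrid n₂ ![
    !![0, 0; 0, 0; R.d - y, 0; R.d - y, (R.b - R.a) * (R.d - y)],
    !![0, 0; 0, 0; 0, R.d - y; 0, R.d - y],
    !![0, 0; 0, 0; 1, 0; 1, R.b - R.a],
    !![0, 0; 0, 0; 0, 1; 0, 1]])

def H11 : Matrix (BF1 n₁ n₂) (BC1 n₁ n₂) ℝ :=
  fromBlocks (bcol n₁ ![1, 1]) 0 0 (bgrid n₂ ![
    !![1, 0; 1, R.d - R.c],
    !![0, 1; 0, 1]])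

def H22 : Matrix (BF1 n₁ n₂) (BC1 n₁ n₂) ℝ :=
  fromBlocks (bcol n₁ ![1, 1]) 0 0 (bgrid n₂ ![
    !![1, 0; 1, R.b - R.a],
    !![0, 1; 0, 1]])

def H03 (x y : ℝ) : Matrix (BF0 n₁ n₂) (St n₀ n₁ n₂) ℝ :=
  fromCols 0 (fromBlocks (bcol n₁ ![0, 0, 0, 1]) 0 0 (bgcol n₂ ![
    ![0, 0, 0, (R.d - y) * (R.b - x)],
    ![0, 0, 0, R.d - y],
    ![0, 0, 0, R.b - x],
    ![0, 0, 0, 1]]))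

def H13 (y : ℝ) : Matrix (BF1 n₁ n₂) (St n₀ n₁ n₂) ℝ :=
  fromCols 0 (fromBlocks (bcol n₁ ![0, 1]) 0 0 (bgcol n₂ ![![0, R.d - y], ![0, 1]]))

def H23 (x : ℝ) : Matrix (BF1 n₁ n₂) (St n₀ n₁ n₂) ℝ :=
  fromCols 0 (fromBlocks (bcol n₁ ![0, 1]) 0 0 (bgcol n₂ ![![0, R.b - x], ![0, 1]]))

/-- The parameters `H₁` of the operator from core to full boundary values. -/
def H1 : N011 (BF0 n₁ n₂) (BC0 n₁ n₂) (BF1 n₁ n₂) (BC1 n₁ n₂) where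
  b00 := H00 R n₁ n₂
  b01 := H01 R n₁ n₂
  b02 := H02 R n₁ n₂
  b10 := 0
  b11 := ⟨fun _ => H11 R n₁ n₂, 0, 0⟩
  b12 := 0
  b20 := 0
  b21 := 0
  b22 := ⟨fun _ => H22 R n₁ n₂, 0, 0⟩

end KH

/-! ### Well-posed boundary conditions and the operator `𝓣` -/

section T

open Matrix

variable (R : Rect) (n₀ : ℕ) {n₁ n₂ : ℕ} (B : BParam n₁ n₂) (E : EParam n₁ n₂)

/-- `E ∈ 𝒩₀₁₁` are (separable) parameters with `P[E] = (𝓑 𝓗₁)⁻¹`. The boundary conditions are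
well-posed if such parameters exist. Only the values of `N₁(x,θ)` for `θ < x` and of `N₂(x,θ)` for
`θ > x` enter a 1D-PI operator, so separability does not restrict the operator `P[E]`. -/
structure IsInverse : Prop where
  mem : E.Mem R
  separable : E.Separable
  left_inv : ∀ w : RL (BC0 n₁ n₂) (BC1 n₁ n₂), w.Mem R →
    RL.Eqv R (E.op R (B.op R ((H1 R n₁ n₂).op R w))) w
  right_inv : ∀ w : RL (Fin (n₁ + 4 * n₂)) (Fin (n₁ + 2 * n₂)), w.Mem R →
    RL.Eqv R (B.op R ((H1 R n₁ n₂).op R (E.op R w))) w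

/-! The parameters `F` of `𝓑 𝓗₂`. -/

def F0 (x y : ℝ) : Matrix (Fin (n₁ + 4 * n₂)) (St n₀ n₁ n₂) ℝ :=
  B.b00 * H03 R n₀ n₁ n₂ x y + B.b01 x * H13 R n₀ n₁ n₂ y + B.b02 y * H23 R n₀ n₁ n₂ x

def F10 (x y : ℝ) : Matrix (Fin (n₁ + 2 * n₂)) (St n₀ n₁ n₂) ℝ :=
  B.b11.n0 x * H13 R n₀ n₁ n₂ y

def F11 (x y θ : ℝ) : Matrix (Fin (n₁ + 2 * n₂)) (St n₀ n₁ n₂) ℝ :=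
  B.b10 x * H03 R n₀ n₁ n₂ θ y + B.b11.n1 x θ * H13 R n₀ n₁ n₂ y
    + B.b12 x y * H23 R n₀ n₁ n₂ θ

def F20 (x y : ℝ) : Matrix (Fin (n₁ + 2 * n₂)) (St n₀ n₁ n₂) ℝ :=
  B.b22.n0 y * H23 R n₀ n₁ n₂ x

def F21 (x y ν : ℝ) : Matrix (Fin (n₁ + 2 * n₂)) (St n₀ n₁ n₂) ℝ :=
  B.b20 y * H03 R n₀ n₁ n₂ x ν + B.b22.n1 y ν * H23 R n₀ n₁ n₂ x
    + B.b21 x y * H13 R n₀ n₁ n₂ ν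

/-! The parameters `G` of `(𝓑 𝓗₁)⁻¹ 𝓑 𝓗₂`. -/

def G0 (x y : ℝ) : Matrix (BC0 n₁ n₂) (St n₀ n₁ n₂) ℝ :=
  E.b00 * F0 R n₀ B x y + E.b01 x * F10 R n₀ B x y
    + mint R.a R.b (fun θ => E.b01 θ * F11 R n₀ B θ y x)
    + E.b02 y * F20 R n₀ B x y
    + mint R.c R.d (fun ν => E.b02 ν * F21 R n₀ B x ν y)

def G10 (x y : ℝ) : Matrix (BC1 n₁ n₂) (St n₀ n₁ n₂) ℝ :=
  E.b11.n0 x * F10 R n₀ B x y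

def G11 (x y θ : ℝ) : Matrix (BC1 n₁ n₂) (St n₀ n₁ n₂) ℝ :=
  E.b10 x * F0 R n₀ B θ y + E.b11.n0 x * F11 R n₀ B x y θ
    + E.b11.n1 x θ * F10 R n₀ B θ y
    + mint R.a R.b (fun η => E.b11.n1 x η * F11 R n₀ B η y θ)
    + E.b12 x y * F20 R n₀ B θ y
    + mint R.c R.d (fun ν => E.b12 x ν * F21 R n₀ B θ ν y)

def G20 (x y : ℝ) : Matrix (BC1 n₁ n₂) (St n₀ n₁ n₂) ℝ :=
  E.b22.n0 y * F20 R n₀ B x y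

def G21 (x y ν : ℝ) : Matrix (BC1 n₁ n₂) (St n₀ n₁ n₂) ℝ :=
  E.b20 y * F0 R n₀ B x ν + E.b22.n0 y * F21 R n₀ B x y ν
    + E.b22.n1 y ν * F20 R n₀ B x ν
    + mint R.c R.d (fun μ => E.b22.n1 y μ * F21 R n₀ B x μ ν)
    + E.b21 x y * F10 R n₀ B x ν
    + mint R.a R.b (fun θ => E.b21 θ y * F11 R n₀ B θ ν x)

/-! The parameters `T`. -/

def T22 (x y θ ν : ℝ) : Matrix (St n₀ n₁ n₂) (St n₀ n₁ n₂) ℝ :=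
  - (K30 R n₀ n₁ n₂ x y * G0 R n₀ B E θ ν)
    - mint R.a x (fun η => K31 R n₀ n₁ n₂ x y η * G11 R n₀ B E η ν θ)
    - mint R.c y (fun μ => K32 R n₀ n₁ n₂ x y μ * G21 R n₀ B E θ μ ν)

def T12 (x y θ ν : ℝ) : Matrix (St n₀ n₁ n₂) (St n₀ n₁ n₂) ℝ :=
  - (K31 R n₀ n₁ n₂ x y θ * G10 R n₀ B E θ ν) + T22 R n₀ B E x y θ ν

def T21 (x y θ ν : ℝ) : Matrix (St n₀ n₁ n₂) (St n₀ n₁ n₂) ℝ :=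
  - (K32 R n₀ n₁ n₂ x y ν * G20 R n₀ B E θ ν) + T22 R n₀ B E x y θ ν

def T11 (x y θ ν : ℝ) : Matrix (St n₀ n₁ n₂) (St n₀ n₁ n₂) ℝ :=
  K33 n₀ n₁ n₂ x y θ ν + T21 R n₀ B E x y θ ν + T12 R n₀ B E x y θ ν - T22 R n₀ B E x y θ ν

/-- The parameters `T ∈ 𝒩_2D` of the map from the fundamental state to the PDE state. -/
def Tparam : N2D (St n₀ n₁ n₂) (St n₀ n₁ n₂) where
  n00 := fun _ _ => T00 n₀ n₁ n₂
  n01 := 0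
  n02 := 0
  n10 := 0
  n20 := 0
  n11 := T11 R n₀ B E
  n12 := T12 R n₀ B E
  n21 := T21 R n₀ B E
  n22 := T22 R n₀ B E

/-- The function `𝓣 v = P[T] v` for `v ∈ L₂^{n₀+n₁+n₂}[x,y]`. -/
def Tmap (v : L2St R n₀ n₁ n₂) : ℝ × ℝ → St n₀ n₁ n₂ → ℝ :=
  (Tparam R n₀ B E).op R (fun z q => v q z)

end T

/-! ### Solutions of the PDE and of the PIE -/

section Solutions

variable {R : Rect} {n₀ n₁ n₂ : ℕ}

/-- The coefficient matrices `A_ij`, `0 ≤ i, j ≤ 2`. The columns of `A_ij` are indexed by the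
components that `N_{max{i,j}}` selects, namely those of differentiability at least `max{i,j}`. -/
abbrev Coeff (n₀ n₁ n₂ : ℕ) : Type :=
  (i j : Fin 3) → Matrix (St n₀ n₁ n₂) {q : St n₀ n₁ n₂ // max i.1 j.1 ≤ reg q} ℝ

/-- `∑_{i,j} A_ij ∂ₓⁱ ∂ᵧʲ (N_{max{i,j}} u)` for `u ∈ L₂^{n₀} × H₁^{n₁} × H₂^{n₂}`. -/
def diffOp (A : Coeff n₀ n₁ n₂) (u : SobSt R n₀ n₁ n₂) : L2St R n₀ n₁ n₂ := fun p =>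
  ∑ i : Fin 3, ∑ j : Fin 3, ∑ q : {q : St n₀ n₁ n₂ // max i.1 j.1 ≤ reg q},
    A i j p q • Dv (u q.1)
      ⟨i.1, Nat.lt_succ_of_le ((le_max_left i.1 j.1).trans q.2)⟩
      ⟨j.1, Nat.lt_succ_of_le ((le_max_right i.1 j.1).trans q.2)⟩

/-- The inclusion `L₂^{n₀} × H₁^{n₁} × H₂^{n₂} → L₂^{n₀+n₁+n₂}`. -/
def toL2 (u : SobSt R n₀ n₁ n₂) : L2St R n₀ n₁ n₂ := fun q => Dv (u q) 0 0

/-- The function `f` is (a representative of) `v ∈ L₂^{n₀+n₁+n₂}`. -/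
def Rep (v : L2St R n₀ n₁ n₂) (f : ℝ × ℝ → St n₀ n₁ n₂ → ℝ) : Prop :=
  ∀ q, v q =ᵐ[R.μ] fun z => f z q

/-- `r = 𝓐 v`, where `𝓐 = ∑_{i,j} A_ij (∂ₓⁱ ∂ᵧʲ [N_{max{i,j}} 𝓣])` is the composition of the
differential operator with `𝓣`. -/
def IsAmap (A : Coeff n₀ n₁ n₂) (B : BParam n₁ n₂) (E : EParam n₁ n₂)
    (v r : L2St R n₀ n₁ n₂) : Prop :=
  ∃ w : SobSt R n₀ n₁ n₂, Rep (toL2 w) (Tmap R n₀ B E v) ∧ r = diffOp A w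

/-- `u` satisfies the PDE defined by `{A_ij, 𝓑}` with initial condition `uI`: `u(0) = uI`,
`u(t) ∈ X(𝓑)`, `u` is Fréchet differentiable on `[0,∞)` as a function with values in
`L₂^{n₀} × H₁^{n₁} × H₂^{n₂}`, and the equation holds for all `t ≥ 0`. -/
def SolvesPDE (A : Coeff n₀ n₁ n₂) (B : BParam n₁ n₂)
    (uI : ℝ × ℝ → St n₀ n₁ n₂ → ℝ) (u : ℝ → ℝ × ℝ → St n₀ n₁ n₂ → ℝ) : Prop :=
  ∃ U : ℝ → SobSt R n₀ n₁ n₂,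
    (∀ t, 0 ≤ t → Rep (toL2 (U t)) (u t)) ∧ Rep (toL2 (U 0)) uI ∧
    ∀ t, 0 ≤ t → U t ∈ X R n₀ B ∧
      ∃ U' : SobSt R n₀ n₁ n₂, HasDerivWithinAt U U' (Ici 0) t ∧ toL2 U' = diffOp A (U t)

/-- `v` solves the PIE `𝓣 v̇ = 𝓐 v` with initial condition `vI`: `v(0) = vI`, `v` is Fréchet
differentiable on `[0,∞)` as a function with values in `L₂`, and the equation holds for all
`t ≥ 0`. -/
def SolvesPIE (A : Coeff n₀ n₁ n₂) (B : BParam n₁ n₂) (E : EParam n₁ n₂)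
    (vI : L2St R n₀ n₁ n₂) (v : ℝ → L2St R n₀ n₁ n₂) : Prop :=
  v 0 = vI ∧ ∀ t, 0 ≤ t →
    ∃ v' r : L2St R n₀ n₁ n₂, HasDerivWithinAt v v' (Ici 0) t ∧
      IsAmap A B E (v t) r ∧ Rep r (Tmap R n₀ B E v')

/-- As `SolvesPDE`, with `u` only differentiable in time with respect to the `L₂` norm. -/
def SolvesPDEinL2 (A : Coeff n₀ n₁ n₂) (B : BParam n₁ n₂)
    (uI : ℝ × ℝ → St n₀ n₁ n₂ → ℝ) (u : ℝ → ℝ × ℝ → St n₀ n₁ n₂ → ℝ) : Prop :=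
  ∃ U : ℝ → SobSt R n₀ n₁ n₂,
    (∀ t, 0 ≤ t → Rep (toL2 (U t)) (u t)) ∧ Rep (toL2 (U 0)) uI ∧
    ∀ t, 0 ≤ t → U t ∈ X R n₀ B ∧
      HasDerivWithinAt (fun s => toL2 (U s)) (diffOp A (U t)) (Ici 0) t

/-- As `SolvesPIE`, with `𝓣 v̇` read as the derivative of `𝓣 v` in `L₂`. -/
def SolvesPIEinL2 (A : Coeff n₀ n₁ n₂) (B : BParam n₁ n₂) (E : EParam n₁ n₂)
    (vI : L2St R n₀ n₁ n₂) (v : ℝ → L2St R n₀ n₁ n₂) : Prop :=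
  v 0 = vI ∧ ∃ V : ℝ → L2St R n₀ n₁ n₂,
    (∀ t, 0 ≤ t → Rep (V t) (Tmap R n₀ B E (v t))) ∧
    ∀ t, 0 ≤ t → ∃ r : L2St R n₀ n₁ n₂,
      IsAmap A B E (v t) r ∧ HasDerivWithinAt V r (Ici 0) t

end Solutions

end PIE2D

end

noncomputable section

namespace PIE2D

/-! ### Square-integrable kernels -/

section Kernels

variable {α β γ : Type*} [MeasurableSpace α] [MeasurableSpace β] [MeasurableSpace γ]
  {μ : Measure α} {ν : Measure β} {τ : Measure γ}

/-! The operator `𝓣 = 𝓚₂ - 𝓚₁ P[G]`, with `P[G] = (𝓑 𝓗₁)⁻¹ 𝓑 𝓗₂`, lifts to a bounded linear map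
`Tstate` from L₂ into L₂ × H₁ × H₂ whose values satisfy the boundary conditions and which has the
bounded left inverse `topDeriv`, u ↦ (u₀, ∂ₓ∂ᵧu₁, ∂ₓ²∂ᵧ²u₂). Once this is known, the equivalence is
formal. A PIE solution is carried to a PDE solution because bounded maps preserve derivatives in
time. Conversely, if u = 𝓣v is differentiable in the Sobolev norm, then v = `topDeriv` u is
differentiable in L₂, and uniqueness of derivatives gives u̇ = 𝓣v̇. In the weaker sense nothing has
to be transferred: both sides speak of the L₂ derivative of 𝓣v.

The lift rests on iterated fundamental theorems of calculus. An H₁ function is the sum of its corner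
value, primitives of its two edge derivatives and a double primitive of ∂ₓ∂ᵧu; applying the same
expansion to ∂ₓ∂ᵧu and integrating once more in each variable gives H₂. Taking the core data to be
-P[G]v and the highest derivative to be v defines `stateMap`. Its weak derivatives
(`isWeakDeriv_derivOne`, `isWeakDeriv_derivTwo`) come from the commutation `Iy_Ix`: the same sum can
be written as a function of y alone plus an x-primitive, or with the roles exchanged. Continuous
representatives and traces of the same sums show that the full boundary data are 𝓗₂v - 𝓗₁P[G]v
(`isBoundary_stateMap`). Applying 𝓑 yields 𝓑𝓗₂v - 𝓑𝓗₁(𝓑𝓗₁)⁻¹𝓑𝓗₂v = 0, which is `stateMap_mem_X`.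

It remains to see that the explicit kernels describe this map. `N021.op_comp` composes a separable
011-PI operator with an operator from functions on the rectangle to boundary data; separability
turns the two Volterra halves into one integral over the whole interval, and Fubini does the rest.
Using it once for 𝓑 and once for `E` produces F and G. `Tmap_eq` then recombines the four quadrant
kernels, and `rep_stateMap` identifies the result with the function underlying `stateMap`.
Uniqueness of weak derivatives (`Sob.ext_of_Dv`) makes the Sobolev lift of a given function unique,
so every statement about representatives becomes an equation for `Tstate`. -/

/-- Cauchy–Schwarz in extended form. No integrability is needed: the integral of a non-integrable
product is zero, and the right side may be infinite. -/
theorem enorm_integral_mul_sq_le {f g : β → ℝ} (hf : AEStronglyMeasurable f ν)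
    (hg : AEStronglyMeasurable g ν) :
    ‖∫ y, f y * g y ∂ν‖ₑ ^ 2 ≤ (∫⁻ y, ‖f y‖ₑ ^ 2 ∂ν) * ∫⁻ y, ‖g y‖ₑ ^ 2 ∂ν := by
  have h1 : ‖∫ y, f y * g y ∂ν‖ₑ ≤ ∫⁻ y, ((fun y => ‖f y‖ₑ) * fun y => ‖g y‖ₑ) y ∂ν := by
    refine (enorm_integral_le_lintegral_enorm _).trans_eq ?_
    simp [enorm_mul]
  have h2 := h1.trans (ENNReal.lintegral_mul_le_Lp_mul_Lq ν Real.HolderConjugate.two_two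
    hf.enorm hg.enorm)
  calc ‖∫ y, f y * g y ∂ν‖ₑ ^ 2 ≤ _ := pow_le_pow_left' h2 2
    _ = _ := by
      rw [mul_pow, ← ENNReal.rpow_natCast, ← ENNReal.rpow_natCast, ← ENNReal.rpow_mul,
        ← ENNReal.rpow_mul]
      norm_num

theorem eLpNorm_two_sq (f : α → ℝ) : eLpNorm f 2 μ ^ 2 = ∫⁻ x, ‖f x‖ₑ ^ 2 ∂μ := by
  rw [eLpNorm_eq_lintegral_rpow_enorm_toReal (by norm_num) (by norm_num),
    ← ENNReal.rpow_natCast, ← ENNReal.rpow_mul]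
  norm_num

theorem lintegral_enorm_sq_lt_top {f : α → ℝ} (hf : MemLp f 2 μ) :
    ∫⁻ x, ‖f x‖ₑ ^ 2 ∂μ < ⊤ := by
  rw [← eLpNorm_two_sq]
  exact ENNReal.pow_lt_top hf.2

theorem memLp_two_of_lintegral {f : α → ℝ} (hm : AEStronglyMeasurable f μ)
    (h : ∫⁻ x, ‖f x‖ₑ ^ 2 ∂μ < ⊤) : MemLp f 2 μ := by
  refine ⟨hm, ?_⟩
  rw [← eLpNorm_two_sq] at h
  by_contra h'
  rw [not_lt, top_le_iff] at h'
  simp [h'] at h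

theorem eLpNorm_le_mul_of_sq {f : α → ℝ} {g : β → ℝ} {C : ENNReal}
    (h : ∫⁻ x, ‖f x‖ₑ ^ 2 ∂μ ≤ C ^ 2 * ∫⁻ x, ‖g x‖ₑ ^ 2 ∂ν) :
    eLpNorm f 2 μ ≤ C * eLpNorm g 2 ν := by
  rw [← eLpNorm_two_sq, ← eLpNorm_two_sq, ← mul_pow] at h
  exact (ENNReal.pow_le_pow_left_iff (by norm_num)).1 h

theorem MemLp.tensor {f : α → ℝ} {g : β → ℝ} [SFinite μ] [SFinite ν] (hf : MemLp f 2 μ)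
    (hg : MemLp g 2 ν) : MemLp (fun z : α × β => f z.1 * g z.2) 2 (μ.prod ν) := by
  refine (memLp_two_iff_integrable_sq (hf.1.comp_fst.mul hg.1.comp_snd)).2 ?_
  simp only [Pi.mul_apply, mul_pow]
  exact hf.integrable_sq.mul_prod hg.integrable_sq

theorem MemLp.slice {f : α × β → ℝ} [SFinite μ] [SFinite ν] (hf : MemLp f 2 (μ.prod ν)) :
    ∀ᵐ x ∂μ, MemLp (fun y => f (x, y)) 2 ν := by
  have h1 := hf.1.prodMk_left
  have h2 := hf.integrable_sq.prod_right_ae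
  filter_upwards [h1, h2] with x hx hx'
  exact (memLp_two_iff_integrable_sq hx).2 hx'

theorem lintegral_enorm_integral_mul_sq_le [SFinite μ] [SFinite ν] {F G : α × β → ℝ}
    (hF : AEStronglyMeasurable F (μ.prod ν)) (hG : AEStronglyMeasurable G (μ.prod ν)) :
    ∫⁻ x, ‖∫ y, F (x, y) * G (x, y) ∂ν‖ₑ ^ 2 ∂μ ≤
      ∫⁻ x, (∫⁻ y, ‖F (x, y)‖ₑ ^ 2 ∂ν) * ∫⁻ y, ‖G (x, y)‖ₑ ^ 2 ∂ν ∂μ := by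
  apply lintegral_mono_ae
  filter_upwards [hF.prodMk_left, hG.prodMk_left] with x h1 h2
  exact enorm_integral_mul_sq_le h1 h2

/-- Hilbert–Schmidt kernels compose: Cauchy–Schwarz in the middle variable bounds the squared norm
by the product of the two squared norms. -/
theorem memLp_kernel_comp [SFinite μ] [SFinite ν] [SFinite τ] {k : α × β → ℝ} {l : β × γ → ℝ}
    (hk : MemLp k 2 (μ.prod ν)) (hl : MemLp l 2 (ν.prod τ)) :
    MemLp (fun z : α × γ => ∫ y, k (z.1, y) * l (y, z.2) ∂ν) 2 (μ.prod τ) := by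
  have q1 : Measure.QuasiMeasurePreserving (fun w : (α × γ) × β => (w.1.1, w.2))
      ((μ.prod τ).prod ν) (μ.prod ν) :=
    MeasureTheory.QuasiMeasurePreserving.prodMap Measure.quasiMeasurePreserving_fst (Measure.QuasiMeasurePreserving.id ν)
  have q2 : Measure.QuasiMeasurePreserving (fun w : (α × γ) × β => (w.2, w.1.2))
      ((μ.prod τ).prod ν) (ν.prod τ) :=
    Measure.measurePreserving_swap.quasiMeasurePreserving.comp
      (MeasureTheory.QuasiMeasurePreserving.prodMap Measure.quasiMeasurePreserving_snd (Measure.QuasiMeasurePreserving.id ν))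
  have m1 := hk.1.comp_quasiMeasurePreserving q1
  have m2 := hl.1.comp_quasiMeasurePreserving q2
  refine memLp_two_of_lintegral (m1.mul m2).integral_prod_right' ?_
  refine (lintegral_enorm_integral_mul_sq_le m1 m2).trans_lt ?_
  simp only [Function.comp_apply]
  have hl' : AEMeasurable (fun w : β × γ => ‖l w‖ₑ ^ 2) (ν.prod τ) := hl.1.enorm.pow_const 2
  -- After Cauchy–Schwarz one factor depends only on the first outer variable and the other only on
  -- the second, so the double integral factors.
  rw [lintegral_prod_mul (f := fun x => ∫⁻ y, ‖k (x, y)‖ₑ ^ 2 ∂ν)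
    (g := fun z => ∫⁻ y, ‖l (y, z)‖ₑ ^ 2 ∂ν) (hk.1.enorm.pow_const 2).lintegral_prod_right'
    hl'.prod_swap.lintegral_prod_right',
    ← lintegral_prod _ (hk.1.enorm.pow_const 2), ← lintegral_prod_symm _ hl']
  exact ENNReal.mul_lt_top (lintegral_enorm_sq_lt_top hk) (lintegral_enorm_sq_lt_top hl)

end Kernels

/-! ### Bounded operators on `L₂` given by formulas on functions -/

section BddOp

variable {α β γ : Type*} [MeasurableSpace α] [MeasurableSpace β] [MeasurableSpace γ]

/-- A formula `T` on functions that defines a bounded linear operator `L₂(ν) → L₂(μ)`. -/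
structure IsBddOp (T : (β → ℝ) → α → ℝ) (ν : Measure β) (μ : Measure α) : Prop where
  meas : ∀ f, MemLp f 2 ν → AEStronglyMeasurable (T f) μ
  congr : ∀ f g, MemLp f 2 ν → f =ᵐ[ν] g → T f =ᵐ[μ] T g
  add : ∀ f g, MemLp f 2 ν → MemLp g 2 ν → T (f + g) =ᵐ[μ] T f + T g
  smul : ∀ (r : ℝ) f, MemLp f 2 ν → T (r • f) =ᵐ[μ] r • T f
  bound : ∃ C : NNReal, ∀ f, MemLp f 2 ν → eLpNorm (T f) 2 μ ≤ C * eLpNorm f 2 ν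

namespace IsBddOp

variable {μ : Measure α} {ν : Measure β} {τ : Measure γ} {T : (β → ℝ) → α → ℝ}

theorem memLp (h : IsBddOp T ν μ) {f : β → ℝ} (hf : MemLp f 2 ν) : MemLp (T f) 2 μ := by
  obtain ⟨C, hC⟩ := h.bound
  exact ⟨h.meas f hf, (hC f hf).trans_lt (ENNReal.mul_lt_top ENNReal.coe_lt_top hf.2)⟩

theorem comp {S : (γ → ℝ) → β → ℝ} (h : IsBddOp T ν μ) (h' : IsBddOp S τ ν) :
    IsBddOp (fun f => T (S f)) τ μ where
  meas f hf := h.meas _ (h'.memLp hf)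
  congr f g hf hfg := h.congr _ _ (h'.memLp hf) (h'.congr f g hf hfg)
  add f g hf hg := (h.congr _ _ (h'.memLp (hf.add hg)) (h'.add f g hf hg)).trans
    (h.add _ _ (h'.memLp hf) (h'.memLp hg))
  smul r f hf := (h.congr _ _ (h'.memLp (hf.const_smul r)) (h'.smul r f hf)).trans
    (h.smul r _ (h'.memLp hf))
  bound := by
    obtain ⟨C, hC⟩ := h.bound
    obtain ⟨D, hD⟩ := h'.bound
    refine ⟨C * D, fun f hf => (hC _ (h'.memLp hf)).trans ?_⟩
    rw [ENNReal.coe_mul, mul_assoc]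
    gcongr
    exact hD f hf

/-- The operator on `L₂` defined by the formula `T`. -/
def clm (h : IsBddOp T ν μ) : Lp ℝ 2 ν →L[ℝ] Lp ℝ 2 μ :=
  LinearMap.mkContinuousOfExistsBound
    { toFun := fun f => (h.memLp (Lp.memLp f)).toLp
      map_add' := fun f g => by
        rw [← MemLp.toLp_add]
        refine (MemLp.toLp_eq_toLp_iff _ _).2 ?_
        exact (h.congr _ _ (Lp.memLp _) (Lp.coeFn_add f g)).trans
          (h.add _ _ (Lp.memLp f) (Lp.memLp g))
      map_smul' := fun r f => by
        rw [RingHom.id_apply, ← MemLp.toLp_const_smul]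
        refine (MemLp.toLp_eq_toLp_iff _ _).2 ?_
        exact (h.congr _ _ (Lp.memLp _) (Lp.coeFn_smul r f)).trans
          (h.smul r _ (Lp.memLp f)) } (by
    obtain ⟨C, hC⟩ := h.bound
    refine ⟨C, fun f => ?_⟩
    simp only [LinearMap.coe_mk, AddHom.coe_mk]
    rw [Lp.norm_toLp, Lp.norm_def]
    have := ENNReal.toReal_mono (ENNReal.mul_ne_top ENNReal.coe_ne_top (Lp.memLp f).2.ne)
      (hC f (Lp.memLp f))
    simpa using this)

theorem coeFn_clm (h : IsBddOp T ν μ) (f : Lp ℝ 2 ν) : h.clm f =ᵐ[μ] T f :=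
  MemLp.coeFn_toLp (h.memLp (Lp.memLp f))

theorem coeFn_clm' (h : IsBddOp T ν μ) {f : Lp ℝ 2 ν} {g : β → ℝ} (hfg : f =ᵐ[ν] g) :
    h.clm f =ᵐ[μ] T g :=
  (h.coeFn_clm f).trans (h.congr _ _ (Lp.memLp f) hfg)

theorem mul {k : α → ℝ} (hk : MemLp k ⊤ μ) : IsBddOp (fun f x => k x * f x) μ μ where
  meas f hf := hk.1.mul hf.1
  congr f g hf hfg := by filter_upwards [hfg] with x hx; rw [hx]
  add f g hf hg := Filter.Eventually.of_forall fun x => by simp [mul_add]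
  smul r f hf := Filter.Eventually.of_forall fun x => by simp [mul_left_comm]
  bound := by
    refine ⟨(eLpNorm k ⊤ μ).toNNReal, fun f hf => ?_⟩
    rw [ENNReal.coe_toNNReal hk.2.ne]
    exact eLpNorm_smul_le_eLpNorm_top_mul_eLpNorm 2 hf.1 k

/-- Comparing image measures gives `‖f ∘ φ‖² ≤ c ‖f‖²`, hence the constant `√c`. This covers
coordinate swaps and the extension of a function of one variable to the rectangle. -/
theorem pullback {φ : α → β} (hφ : Measurable φ) {c : NNReal} (h : μ.map φ ≤ c • ν) :
    IsBddOp (fun f x => f (φ x)) ν μ := by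
  have q : Measure.QuasiMeasurePreserving φ μ ν :=
    ⟨hφ, (Measure.absolutelyContinuous_of_le h).trans (Measure.smul_absolutelyContinuous)⟩
  refine ⟨fun f hf => hf.1.comp_quasiMeasurePreserving q, fun f g hf hfg => q.ae_eq hfg,
    fun f g hf hg => by rfl, fun r f hf => by rfl, ?_⟩
  refine ⟨NNReal.sqrt c, fun f hf => eLpNorm_le_mul_of_sq ?_⟩
  have hm : AEMeasurable (fun y => ‖f y‖ₑ ^ 2) (μ.map φ) :=
    (hf.1.enorm.pow_const 2).mono_ac q.absolutelyContinuous
  rw [← lintegral_map' hm hφ.aemeasurable, ← ENNReal.coe_pow, NNReal.sq_sqrt]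
  refine (lintegral_mono' h le_rfl).trans_eq ?_
  rw [lintegral_smul_measure]
  rfl

/-- The Hilbert–Schmidt bound. Additivity holds only at the almost every `x` whose slice of the
kernel is square integrable. -/
theorem kernel [SFinite μ] [SFinite ν] {k : α × β → ℝ} (hk : MemLp k 2 (μ.prod ν)) :
    IsBddOp (fun f x => ∫ y, k (x, y) * f y ∂ν) ν μ where
  meas f hf := (hk.1.mul hf.1.comp_snd).integral_prod_right'
  congr f g hf hfg := by
    refine Filter.Eventually.of_forall fun x => integral_congr_ae ?_
    filter_upwards [hfg] with y hy
    rw [hy]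
  add f g hf hg := by
    filter_upwards [MemLp.slice hk] with x hx
    simp only [Pi.add_apply, mul_add]
    exact integral_add (hx.integrable_mul hf) (hx.integrable_mul hg)
  smul r f hf := Filter.Eventually.of_forall fun x => by
    simp only [Pi.smul_apply, smul_eq_mul, mul_left_comm _ r]
    exact integral_const_mul r _
  bound := by
    refine ⟨(eLpNorm k 2 (μ.prod ν)).toNNReal, fun f hf => eLpNorm_le_mul_of_sq ?_⟩
    rw [ENNReal.coe_toNNReal hk.2.ne, eLpNorm_two_sq]
    refine (lintegral_enorm_integral_mul_sq_le hk.1 hf.1.comp_snd).trans_eq ?_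
    simp only
    rw [lintegral_mul_const'' _ (hk.1.enorm.pow_const 2).lintegral_prod_right',
      ← lintegral_prod _ (hk.1.enorm.pow_const 2)]

/-- Cauchy–Schwarz against the constant 1, so the squared norm is the mass of the fibre. -/
theorem marginal [SFinite μ] [IsFiniteMeasure ν] :
    IsBddOp (fun f x => ∫ y, f (x, y) ∂ν) (μ.prod ν) μ where
  meas f hf := hf.1.integral_prod_right'
  congr f g hf hfg := by
    filter_upwards [Measure.ae_ae_of_ae_prod hfg] with x hx
    exact integral_congr_ae hx
  add f g hf hg := by
    filter_upwards [MemLp.slice hf, MemLp.slice hg] with x hx hx'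
    exact integral_add (hx.integrable (by norm_num)) (hx'.integrable (by norm_num))
  smul r f hf := Filter.Eventually.of_forall fun x => integral_const_mul r _
  bound := by
    refine ⟨NNReal.sqrt (ν univ).toNNReal, fun f hf => eLpNorm_le_mul_of_sq ?_⟩
    rw [← ENNReal.coe_pow, NNReal.sq_sqrt, ENNReal.coe_toNNReal (measure_ne_top ν _)]
    have := lintegral_enorm_integral_mul_sq_le (μ := μ) (ν := ν) (F := fun _ => 1)
      aestronglyMeasurable_const hf.1
    simp only [one_mul, enorm_one, one_pow, lintegral_one] at this
    refine this.trans_eq ?_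
    rw [lintegral_const_mul'' _ (hf.1.enorm.pow_const 2).lintegral_prod_right',
      ← lintegral_prod _ (hf.1.enorm.pow_const 2)]

end IsBddOp

end BddOp

/-! ### Matrix-valued functions -/

section Matrices

open Matrix

variable {α β : Type*} [MeasurableSpace α] [MeasurableSpace β] {p q r : Type}

/-- A matrix-valued function all of whose entries lie in `L_s`. -/
def MMem (M : α → Matrix p q ℝ) (s : ENNReal) (μ : Measure α) : Prop :=
  ∀ i j, MemLp (fun x => M x i j) s μ

/-- A vector-valued function all of whose components lie in `L_s`. -/
def VMem (f : α → p → ℝ) (s : ENNReal) (μ : Measure α) : Prop :=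
  ∀ i, MemLp (fun x => f x i) s μ

/-- The componentwise integral. -/
def vI (μ : Measure α) (f : α → p → ℝ) : p → ℝ := fun i => ∫ x, f x i ∂μ

/-- The entrywise integral. -/
def mI (μ : Measure α) (M : α → Matrix p q ℝ) : Matrix p q ℝ := Matrix.of fun i j => ∫ x, M x i j ∂μ

variable {μ : Measure α} {ν : Measure β} {s t u : ENNReal}

theorem MMem.mulVec [Fintype q] {M : α → Matrix p q ℝ} {f : α → q → ℝ} (hM : MMem M s μ)
    (hf : VMem f t μ) [s.HolderTriple t u] : VMem (fun x => M x *ᵥ f x) u μ := fun i => by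
  simp only [Matrix.mulVec, dotProduct]
  exact memLp_finsetSum _ fun j _ => (hf j).mul' (hM i j)

theorem MMem.mul [Fintype q] {M : α → Matrix p q ℝ} {N : α → Matrix q r ℝ} (hM : MMem M s μ)
    (hN : MMem N t μ) [s.HolderTriple t u] : MMem (fun x => M x * N x) u μ := fun i k => by
  simp only [Matrix.mul_apply]
  exact memLp_finsetSum _ fun j _ => (hN j k).mul' (hM i j)

theorem MMem.const_mul [Fintype q] {N : α → Matrix q r ℝ} (M : Matrix p q ℝ) (hN : MMem N s μ) :
    MMem (fun x => M * N x) s μ := fun i k => by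
  simp only [Matrix.mul_apply]
  exact memLp_finsetSum _ fun j _ => (hN j k).const_mul (M i j)

theorem MMem.add {M N : α → Matrix p q ℝ} (hM : MMem M s μ) (hN : MMem N s μ) :
    MMem (fun x => M x + N x) s μ := fun i j => (hM i j).add (hN i j)

theorem MMem.sub {M N : α → Matrix p q ℝ} (hM : MMem M s μ) (hN : MMem N s μ) :
    MMem (fun x => M x - N x) s μ := fun i j => (hM i j).sub (hN i j)

theorem MMem.neg {M : α → Matrix p q ℝ} (hM : MMem M s μ) :
    MMem (fun x => - M x) s μ := fun i j => (hM i j).neg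

theorem MMem.smul {c : α → ℝ} {M : α → Matrix p q ℝ} (hc : MemLp c ⊤ μ) (hM : MMem M s μ) :
    MMem (fun x => c x • M x) s μ := fun i j => (hM i j).mul' hc

theorem MMem.mono [IsFiniteMeasure μ] {M : α → Matrix p q ℝ} (hM : MMem M t μ) (h : s ≤ t) :
    MMem M s μ := fun i j => (hM i j).mono_exponent h

theorem VMem.add {f g : α → p → ℝ} (hf : VMem f s μ) (hg : VMem g s μ) :
    VMem (fun x => f x + g x) s μ := fun i => (hf i).add (hg i)

theorem VMem.sub {f g : α → p → ℝ} (hf : VMem f s μ) (hg : VMem g s μ) :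
    VMem (fun x => f x - g x) s μ := fun i => (hf i).sub (hg i)

theorem vI_add {f g : α → p → ℝ} (hf : VMem f 1 μ) (hg : VMem g 1 μ) :
    vI μ (fun x => f x + g x) = vI μ f + vI μ g :=
  funext fun i => integral_add (memLp_one_iff_integrable.1 (hf i))
    (memLp_one_iff_integrable.1 (hg i))

theorem vI_sub {f g : α → p → ℝ} (hf : VMem f 1 μ) (hg : VMem g 1 μ) :
    vI μ (fun x => f x - g x) = vI μ f - vI μ g :=
  funext fun i => integral_sub (memLp_one_iff_integrable.1 (hf i))
    (memLp_one_iff_integrable.1 (hg i))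

theorem vI_congr {f g : α → p → ℝ} (h : ∀ᵐ x ∂μ, f x = g x) : vI μ f = vI μ g :=
  funext fun i => integral_congr_ae (by filter_upwards [h] with x hx; rw [hx])

theorem mulVec_vI [Fintype q] (M : Matrix p q ℝ) {f : α → q → ℝ} (hf : VMem f 1 μ) :
    M *ᵥ vI μ f = vI μ (fun x => M *ᵥ f x) := by
  funext i
  simp only [Matrix.mulVec, dotProduct, vI]
  rw [integral_finsetSum _ fun j _ => (memLp_one_iff_integrable.1 (hf j)).const_mul _]
  simp only [integral_const_mul]

theorem mI_mulVec [Fintype q] {M : α → Matrix p q ℝ} (hM : MMem M 1 μ) (v : q → ℝ) :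
    mI μ M *ᵥ v = vI μ (fun x => M x *ᵥ v) := by
  funext i
  simp only [Matrix.mulVec, dotProduct, vI, mI, Matrix.of_apply]
  rw [integral_finsetSum _ fun j _ => (memLp_one_iff_integrable.1 (hM i j)).mul_const _]
  simp only [integral_mul_const]

theorem vI_prod [SFinite μ] [SFinite ν] {f : α × β → p → ℝ} (hf : VMem f 1 (μ.prod ν)) :
    vI (μ.prod ν) f = vI μ fun x => vI ν fun y => f (x, y) :=
  funext fun i => integral_prod _ (memLp_one_iff_integrable.1 (hf i))

theorem vI_prod_symm [SFinite μ] [SFinite ν] {f : α × β → p → ℝ} (hf : VMem f 1 (μ.prod ν)) :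
    vI (μ.prod ν) f = vI ν fun y => vI μ fun x => f (x, y) :=
  funext fun i => integral_prod_symm _ (memLp_one_iff_integrable.1 (hf i))

theorem VMem.slice_two [SFinite μ] [SFinite ν] [Finite p] {f : α × β → p → ℝ}
    (hf : VMem f 2 (μ.prod ν)) : ∀ᵐ x ∂μ, VMem (fun y => f (x, y)) 2 ν :=
  ae_all_iff.2 fun i => MemLp.slice (hf i)

theorem MMem.slice_two [SFinite μ] [SFinite ν] [Finite p] [Finite q] {M : α × β → Matrix p q ℝ}
    (hM : MMem M 2 (μ.prod ν)) : ∀ᵐ x ∂μ, MMem (fun y => M (x, y)) 2 ν :=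
  ae_all_iff.2 fun i => ae_all_iff.2 fun j => MemLp.slice (hM i j)

theorem MMem.swap [SFinite μ] [SFinite ν] {M : α × β → Matrix p q ℝ}
    (hM : MMem M s (μ.prod ν)) : MMem (fun z : β × α => M z.swap) s (ν.prod μ) := fun i j =>
  (hM i j).comp_measurePreserving Measure.measurePreserving_swap

theorem VMem.swap [SFinite μ] [SFinite ν] {f : α × β → p → ℝ}
    (hM : VMem f s (μ.prod ν)) : VMem (fun z : β × α => f z.swap) s (ν.prod μ) := fun i =>
  (hM i).comp_measurePreserving Measure.measurePreserving_swap

/-- Matrix form of `memLp_kernel_comp`. The integral of a matrix product splits into a sum of scalar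
integrals only where every summand is integrable, which slicing provides for almost every pair of
outer variables. -/
theorem MMem.of_slice_kernel [SFinite μ] [SFinite ν] {γ : Type*} [MeasurableSpace γ]
    {τ : Measure γ} [SFinite τ] [Fintype q] {K : α × β → Matrix p q ℝ} {L : β × γ → Matrix q r ℝ}
    (hK : MMem K 2 (μ.prod ν)) (hL : MMem L 2 (ν.prod τ)) :
    MMem (fun z : α × γ => mI ν fun y => K (z.1, y) * L (y, z.2)) 2 (μ.prod τ) := fun i k => by
  have h : MemLp (fun z : α × γ => ∑ j, ∫ y, K (z.1, y) i j * L (y, z.2) j k ∂ν) 2 (μ.prod τ) :=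
    memLp_finsetSum _ fun j _ => memLp_kernel_comp (hK i j) (hL j k)
  refine h.ae_eq ?_
  have h1 : ∀ᵐ z : α × γ ∂μ.prod τ, ∀ j, Integrable (fun y => K (z.1, y) i j * L (y, z.2) j k) ν := by
    refine ae_all_iff.2 fun j => ?_
    have a1 := Measure.quasiMeasurePreserving_fst (μ := μ) (ν := τ) |>.ae (MemLp.slice (hK i j))
    have a2 := Measure.quasiMeasurePreserving_snd (μ := μ) (ν := τ) |>.ae (MemLp.slice
      ((hL j k).comp_measurePreserving (Measure.measurePreserving_swap (μ := τ) (ν := ν))))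
    filter_upwards [a1, a2] with z h1 h2
    exact h1.integrable_mul h2
  filter_upwards [h1] with z hz
  simp only [mI, Matrix.of_apply, Matrix.mul_apply]
  rw [integral_finsetSum _ fun j _ => hz j]

/-- Integrating a kernel operator against a matrix-valued function. -/
theorem vI_mulVec_kernel [SFinite μ] [SFinite ν] [Fintype p] [Fintype q] [Fintype r]
    {e : α → Matrix p q ℝ} {K : α × β → Matrix q r ℝ} {v : β → r → ℝ}
    (he : MMem e 2 μ) (hK : MMem K 2 (μ.prod ν)) (hv : VMem v 2 ν) :
    vI μ (fun x => e x *ᵥ vI ν fun z => K (x, z) *ᵥ v z)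
      = vI ν (fun z => (mI μ fun x => e x * K (x, z)) *ᵥ v z) := by
  have h1 : ∀ᵐ x ∂μ, e x *ᵥ (vI ν fun z => K (x, z) *ᵥ v z)
      = vI ν fun z => (e x * K (x, z)) *ᵥ v z := by
    filter_upwards [MMem.slice_two hK] with x hx
    rw [mulVec_vI _ (hx.mulVec hv)]
    simp only [Matrix.mulVec_mulVec]
  have h2 : ∀ᵐ z ∂ν, (mI μ fun x => e x * K (x, z)) *ᵥ v z
      = vI μ fun x => (e x * K (x, z)) *ᵥ v z := by
    filter_upwards [MMem.slice_two hK.swap] with z hz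
    exact mI_mulVec (he.mul hz) _
  rw [vI_congr h1, vI_congr h2]
  have hint : VMem (fun w : α × β => (e w.1 * K w) *ᵥ v w.2) 1 (μ.prod ν) := fun i => by
    simp only [Matrix.mulVec, dotProduct, Matrix.mul_apply, Finset.sum_mul]
    refine memLp_finsetSum _ fun j _ => memLp_finsetSum _ fun l _ => ?_
    -- Grouping `e` and `v` into a tensor product leaves a product of two square-integrable
    -- functions of the pair, which is integrable.
    refine (((hK l j).mul' (MemLp.tensor (he i l) (hv j)) :
      MemLp (fun w : α × β => e w.1 i l * v w.2 j * K w l j) 1 _)).ae_eq ?_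
    exact Filter.Eventually.of_forall fun w => by ring
  exact (vI_prod hint).symm.trans (vI_prod_symm hint)

/-- Integrating a fibre integral against a matrix-valued function. -/
theorem vI_mulVec_fibre [SFinite μ] [SFinite ν] [Fintype p] [Fintype q] [Fintype r]
    {e : α → Matrix p q ℝ} {k : α × β → Matrix q r ℝ} {v : α × β → r → ℝ} [IsFiniteMeasure ν]
    (he : MMem e 2 μ) (hk : MMem k ⊤ (μ.prod ν)) (hv : VMem v 2 (μ.prod ν)) :
    vI μ (fun x => e x *ᵥ vI ν fun y => k (x, y) *ᵥ v (x, y))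
      = vI (μ.prod ν) (fun z => (e z.1 * k z) *ᵥ v z) := by
  have hkv : VMem (fun z => k z *ᵥ v z) 2 (μ.prod ν) := hk.mulVec hv
  have h1 : ∀ᵐ x ∂μ, e x *ᵥ (vI ν fun y => k (x, y) *ᵥ v (x, y))
      = vI ν fun y => (e x * k (x, y)) *ᵥ v (x, y) := by
    filter_upwards [VMem.slice_two hkv] with x hx
    rw [mulVec_vI _ fun i => (hx i).mono_exponent (by norm_num)]
    simp only [Matrix.mulVec_mulVec]
  have he' : MMem (fun z : α × β => e z.1) 2 (μ.prod ν) := fun i j => (he i j).comp_fst ν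
  have hint : VMem (fun z => (e z.1 * k z) *ᵥ v z) 1 (μ.prod ν) := by
    simp only [← Matrix.mulVec_mulVec]
    exact he'.mulVec hkv
  rw [vI_congr h1, vI_prod hint]

end Matrices

end PIE2D

end

/-! ### The rectangle as a product measure space, and operators into boundary data -/

noncomputable section

namespace PIE2D

open Matrix

set_option linter.unusedSectionVars false

theorem Rect.μ_eq (R : Rect) : R.μ = R.μx.prod R.μy := by
  rw [Measure.prod_restrict, ← Measure.volume_eq_prod]

instance (R : Rect) : IsFiniteMeasure R.μ := by
  rw [R.μ_eq]
  infer_instance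

theorem vint_eq_vI {p : Type} {s t : ℝ} (h : s ≤ t) (f : ℝ → p → ℝ) :
    vint s t f = vI (volume.restrict (Icc s t)) f :=
  funext fun i => by
    simp only [vint, vI]
    rw [intervalIntegral.integral_of_le h, integral_Icc_eq_integral_Ioc]

theorem mint_eq_mI {p q : Type} {s t : ℝ} (h : s ≤ t) (f : ℝ → Matrix p q ℝ) :
    mint s t f = mI (volume.restrict (Icc s t)) f := by
  ext i j
  simp only [mint, mI, Matrix.of_apply]
  rw [intervalIntegral.integral_of_le h, integral_Icc_eq_integral_Ioc]

theorem MemLp.slice_fst {R : Rect} {f : ℝ × ℝ → ℝ} (hf : MemLp f 2 R.μ) :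
    ∀ᵐ x ∂(R.μx), MemLp (fun y => f (x, y)) 2 R.μy := by
  rw [R.μ_eq] at hf
  exact MemLp.slice hf

theorem MemLp.slice_snd {R : Rect} {f : ℝ × ℝ → ℝ} (hf : MemLp f 2 R.μ) :
    ∀ᵐ y ∂(R.μy), MemLp (fun x => f (x, y)) 2 R.μx := by
  rw [R.μ_eq] at hf
  exact MemLp.slice (hf.comp_measurePreserving Measure.measurePreserving_swap)

theorem memLp_pullback_snd {α : Type*} [MeasurableSpace α] {m : Measure α} [SFinite m] {R : Rect}
    {f : α × ℝ → ℝ} (hf : MemLp f 2 (m.prod R.μy)) :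
    MemLp (fun z : α × ℝ × ℝ => f (z.1, z.2.2)) 2 (m.prod R.μ) := by
  have h := (hf.comp_fst R.μx).comp_measurePreserving (measurePreserving_prodAssoc m R.μy R.μx).symm
  have h2 := h.comp_measurePreserving
    ((MeasurePreserving.id m).prod (Measure.measurePreserving_swap (μ := R.μx) (ν := R.μy)))
  rw [R.μ_eq]
  exact h2

theorem memLp_pullback_fst {α : Type*} [MeasurableSpace α] {m : Measure α} [SFinite m] {R : Rect}
    {f : α × ℝ → ℝ} (hf : MemLp f 2 (m.prod R.μx)) :
    MemLp (fun z : α × ℝ × ℝ => f (z.1, z.2.1)) 2 (m.prod R.μ) := by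
  rw [R.μ_eq]
  exact (hf.comp_fst R.μy).comp_measurePreserving (measurePreserving_prodAssoc _ _ _).symm

theorem MemLp.ae_bound {α : Type*} [MeasurableSpace α] {μ : Measure α} {f : α → ℝ}
    (hf : MemLp f ⊤ μ) : ∃ C, ∀ᵐ x ∂μ, ‖f x‖ ≤ C := ⟨(eLpNorm f ⊤ μ).toReal, by
  filter_upwards [ae_le_eLpNormEssSup (f := f) (μ := μ)] with x hx
  simpa using ENNReal.toReal_mono (by simpa using hf.2.ne) hx⟩

theorem MemLp.comp_snd_top {α β : Type*} [MeasurableSpace α] [MeasurableSpace β] {μ : Measure α}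
    {ν : Measure β} [SFinite ν] {f : β → ℝ} (hf : MemLp f ⊤ ν) :
    MemLp (fun z : α × β => f z.2) ⊤ (μ.prod ν) := by
  obtain ⟨C, hC⟩ := MemLp.ae_bound hf
  exact memLp_top_of_bound hf.1.comp_snd C (Measure.quasiMeasurePreserving_snd.ae hC)

theorem MemLp.comp_fst_top {α β : Type*} [MeasurableSpace α] [MeasurableSpace β] {μ : Measure α}
    {ν : Measure β} [SFinite ν] {f : α → ℝ} (hf : MemLp f ⊤ μ) :
    MemLp (fun z : α × β => f z.1) ⊤ (μ.prod ν) := by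
  obtain ⟨C, hC⟩ := MemLp.ae_bound hf
  exact memLp_top_of_bound hf.1.comp_fst C (Measure.quasiMeasurePreserving_fst.ae hC)

/-! ### Operators from functions on the rectangle to core boundary data -/

/-- Parameters of an operator from functions on the rectangle to triples
(vector, function of `x`, function of `y`). -/
structure N021 (p₀ p₁ q : Type) where
  k0 : ℝ × ℝ → Matrix p₀ q ℝ
  k10 : ℝ × ℝ → Matrix p₁ q ℝ
  k11 : ℝ × ℝ × ℝ → Matrix p₁ q ℝ
  k20 : ℝ × ℝ → Matrix p₁ q ℝ
  k21 : ℝ × ℝ × ℝ → Matrix p₁ q ℝ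

variable {p₀ p₁ q₀ q₁ q : Type} [Fintype q₀] [Fintype q₁] [Fintype q]

/-- Regularity of the parameters. -/
structure N021.Mem (k : N021 p₀ p₁ q) (R : Rect) : Prop where
  k0 : MMem k.k0 2 R.μ
  k10 : MMem k.k10 ⊤ R.μ
  k11 : MMem k.k11 2 (R.μx.prod R.μ)
  k20 : MMem k.k20 ⊤ R.μ
  k21 : MMem k.k21 2 (R.μy.prod R.μ)

/-- The operator with parameters `k`. -/
def N021.op (R : Rect) (k : N021 p₀ p₁ q) (v : ℝ × ℝ → q → ℝ) : RL p₀ p₁ :=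
  (vI R.μ fun z => k.k0 z *ᵥ v z,
    fun x => (vI R.μy fun y => k.k10 (x, y) *ᵥ v (x, y)) + vI R.μ fun z => k.k11 (x, z) *ᵥ v z,
    fun y => (vI R.μx fun x => k.k20 (x, y) *ᵥ v (x, y)) + vI R.μ fun z => k.k21 (y, z) *ᵥ v z)

/-- The kernel of the pairing of `e` with the second component of `k.op`. -/
def N021.pairX (R : Rect) (k : N021 p₀ q₁ q) (e : ℝ → Matrix p₁ q₁ ℝ) (z : ℝ × ℝ) :
    Matrix p₁ q ℝ :=
  e z.1 * k.k10 z + mI R.μx fun θ => e θ * k.k11 (θ, z)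

/-- The kernel of the pairing of `e` with the third component of `k.op`. -/
def N021.pairY (R : Rect) (k : N021 p₀ q₁ q) (e : ℝ → Matrix p₁ q₁ ℝ) (z : ℝ × ℝ) :
    Matrix p₁ q ℝ :=
  e z.2 * k.k20 z + mI R.μy fun ν => e ν * k.k21 (ν, z)

/-- The parameters of the composition of `P[E]` and the operator with parameters `k`. -/
def N021.comp (R : Rect) (E : N011 p₀ q₀ p₁ q₁) (k : N021 q₀ q₁ q) : N021 p₀ p₁ q where
  k0 z := E.b00 * k.k0 z + k.pairX R E.b01 z + k.pairY R E.b02 z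
  k10 z := E.b11.n0 z.1 * k.k10 z
  k11 w := E.b10 w.1 * k.k0 w.2 + E.b11.n0 w.1 * k.k11 w + k.pairX R (E.b11.n1 w.1) w.2
    + k.pairY R (E.b12 w.1) w.2
  k20 z := E.b22.n0 z.2 * k.k20 z
  k21 w := E.b20 w.1 * k.k0 w.2 + E.b22.n0 w.1 * k.k21 w + k.pairY R (E.b22.n1 w.1) w.2
    + k.pairX R (fun x => E.b21 x w.1) w.2

namespace N021

variable {R : Rect} {k : N021 q₀ q₁ q} {v : ℝ × ℝ → q → ℝ}

/-- The parameter in `α` is the free output variable of a composed kernel: `comp_mem` applies this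
with rows of the kernel of a 1D-PI block or of a mixed block in the role of `e`. -/
theorem mMem_pairX_param {α : Type*} [MeasurableSpace α] {m : Measure α} [IsFiniteMeasure m]
    (hk : k.Mem R) {e : α → ℝ → Matrix p₁ q₁ ℝ}
    (he : MMem (fun w : α × ℝ => e w.1 w.2) 2 (m.prod R.μx)) :
    MMem (fun w : α × ℝ × ℝ => k.pairX R (e w.1) w.2) 2 (m.prod R.μ) := by
  refine MMem.add (M := fun w : α × ℝ × ℝ => e w.1 w.2.1 * k.k10 w.2) ?_
    (he.of_slice_kernel hk.k11)
  have h1 : MMem (fun w : α × ℝ × ℝ => e w.1 w.2.1) 2 (m.prod R.μ) := fun i j =>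
    memLp_pullback_fst (he i j)
  have h2 : MMem (fun w : α × ℝ × ℝ => k.k10 w.2) ⊤ (m.prod R.μ) := fun i j =>
    MemLp.comp_snd_top (hk.k10 i j)
  exact h1.mul h2

theorem mMem_pairY_param {α : Type*} [MeasurableSpace α] {m : Measure α} [IsFiniteMeasure m]
    (hk : k.Mem R) {e : α → ℝ → Matrix p₁ q₁ ℝ}
    (he : MMem (fun w : α × ℝ => e w.1 w.2) 2 (m.prod R.μy)) :
    MMem (fun w : α × ℝ × ℝ => k.pairY R (e w.1) w.2) 2 (m.prod R.μ) := by
  refine MMem.add (M := fun w : α × ℝ × ℝ => e w.1 w.2.2 * k.k20 w.2) ?_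
    (he.of_slice_kernel hk.k21)
  have h1 : MMem (fun w : α × ℝ × ℝ => e w.1 w.2.2) 2 (m.prod R.μ) := fun i j =>
    memLp_pullback_snd (he i j)
  have h2 : MMem (fun w : α × ℝ × ℝ => k.k20 w.2) ⊤ (m.prod R.μ) := fun i j =>
    MemLp.comp_snd_top (hk.k20 i j)
  exact h1.mul h2

/-- A function is a kernel whose first variable ranges over a one-point space, so integrals without
a free output variable are covered by the composition of kernels. -/
theorem mMem_of_unit {γ : Type*} [MeasurableSpace γ] {τ : Measure γ} [SFinite τ]
    {M : γ → Matrix p₁ q₁ ℝ}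
    (h : MMem (fun w : Unit × γ => M w.2) 2 ((Measure.dirac ()).prod τ)) : MMem M 2 τ :=
  fun i j => by simpa [ae_dirac_eq] using MemLp.slice (h i j)

theorem mMem_mI_fst (hk : k.Mem R) {e : ℝ → Matrix p₁ q₁ ℝ} (he : MMem e 2 R.μx) :
    MMem (fun z => mI R.μx fun θ => e θ * k.k11 (θ, z)) 2 R.μ :=
  mMem_of_unit (MMem.of_slice_kernel (K := fun w : Unit × ℝ => e w.2)
    (fun i j => (he i j).comp_snd (Measure.dirac ())) hk.k11)

theorem mMem_mI_snd (hk : k.Mem R) {e : ℝ → Matrix p₁ q₁ ℝ} (he : MMem e 2 R.μy) :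
    MMem (fun z => mI R.μy fun ν => e ν * k.k21 (ν, z)) 2 R.μ :=
  mMem_of_unit (MMem.of_slice_kernel (K := fun w : Unit × ℝ => e w.2)
    (fun i j => (he i j).comp_snd (Measure.dirac ())) hk.k21)

theorem mMem_mul_fst (hk : k.Mem R) {e : ℝ → Matrix p₁ q₁ ℝ} (he : MMem e 2 R.μx) :
    MMem (fun z => e z.1 * k.k10 z) 2 R.μ := by
  have he' : MMem (fun z : ℝ × ℝ => e z.1) 2 R.μ := by
    rw [R.μ_eq]
    exact fun i j => (he i j).comp_fst R.μy
  exact he'.mul hk.k10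

theorem mMem_mul_snd (hk : k.Mem R) {e : ℝ → Matrix p₁ q₁ ℝ} (he : MMem e 2 R.μy) :
    MMem (fun z => e z.2 * k.k20 z) 2 R.μ := by
  have he' : MMem (fun z : ℝ × ℝ => e z.2) 2 R.μ := by
    rw [R.μ_eq]
    exact fun i j => (he i j).comp_snd R.μx
  exact he'.mul hk.k20

theorem mMem_pairX (hk : k.Mem R) {e : ℝ → Matrix p₁ q₁ ℝ} (he : MMem e 2 R.μx) :
    MMem (k.pairX R e) 2 R.μ :=
  (mMem_mul_fst hk he).add (mMem_mI_fst hk he)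

theorem mMem_pairY (hk : k.Mem R) {e : ℝ → Matrix p₁ q₁ ℝ} (he : MMem e 2 R.μy) :
    MMem (k.pairY R e) 2 R.μ :=
  (mMem_mul_snd hk he).add (mMem_mI_snd hk he)

/-- The operator `v ↦ ∫ k(·, y) v(·, y) dy + ∫∫ l(·, z) v(z) dz`. -/
theorem isBddOp_fst {k : ℝ × ℝ → ℝ} {l : ℝ × ℝ × ℝ → ℝ} (hk : MemLp k ⊤ R.μ)
    (hl : MemLp l 2 (R.μx.prod R.μ)) : IsBddOp (fun f x => ∫ y, k (x, y) * f (x, y) ∂(R.μy)) R.μ R.μx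
    ∧ IsBddOp (fun f x => ∫ z, l (x, z) * f z ∂(R.μ)) R.μ R.μx := by
  refine ⟨?_, IsBddOp.kernel hl⟩
  rw [R.μ_eq] at *
  exact IsBddOp.marginal.comp (IsBddOp.mul hk)

theorem isBddOp_marginal_snd :
    IsBddOp (fun (f : ℝ × ℝ → ℝ) y => ∫ x, f (x, y) ∂(R.μx)) R.μ R.μy := by
  rw [R.μ_eq]
  refine (IsBddOp.marginal (μ := R.μy) (ν := R.μx)).comp (S := fun f z => f z.swap)
    (IsBddOp.pullback measurable_swap (c := 1) ?_)
  rw [Measure.measurePreserving_swap.map_eq, one_smul]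

theorem isBddOp_snd {k : ℝ × ℝ → ℝ} {l : ℝ × ℝ × ℝ → ℝ} (hk : MemLp k ⊤ R.μ)
    (hl : MemLp l 2 (R.μy.prod R.μ)) : IsBddOp (fun f y => ∫ x, k (x, y) * f (x, y) ∂(R.μx)) R.μ R.μy
    ∧ IsBddOp (fun f y => ∫ z, l (y, z) * f z ∂(R.μ)) R.μ R.μy :=
  ⟨isBddOp_marginal_snd.comp (IsBddOp.mul hk), IsBddOp.kernel hl⟩

/-- The components of the second entry of `k.op` as bounded operators. -/
def clm1 (hk : k.Mem R) (i : q₁) : (q → L2 R) →L[ℝ] Lp ℝ 2 R.μx :=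
  ∑ j, ((isBddOp_fst (hk.k10 i j) (hk.k11 i j)).1.clm
    + (isBddOp_fst (hk.k10 i j) (hk.k11 i j)).2.clm) ∘L ContinuousLinearMap.proj j

/-- The components of the third entry of `k.op` as bounded operators. -/
def clm2 (hk : k.Mem R) (i : q₁) : (q → L2 R) →L[ℝ] Lp ℝ 2 R.μy :=
  ∑ j, ((isBddOp_snd (hk.k20 i j) (hk.k21 i j)).1.clm
    + (isBddOp_snd (hk.k20 i j) (hk.k21 i j)).2.clm) ∘L ContinuousLinearMap.proj j

/-- The components of the first entry of `k.op` as bounded functionals. -/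
def clm0 (hk : k.Mem R) (i : q₀) : (q → L2 R) →L[ℝ] ℝ :=
  ∑ j, innerSL ℝ ((hk.k0 i j).toLp) ∘L ContinuousLinearMap.proj j

theorem vMem_coe {α : Type*} [MeasurableSpace α] {m : Measure α} (v : q → Lp ℝ 2 m) :
    VMem (fun z i => v i z) 2 m := fun i => Lp.memLp (v i)

theorem coeFn_sum {α ι : Type*} [MeasurableSpace α] {m : Measure α} (s : Finset ι)
    (f : ι → Lp ℝ 2 m) : (∑ i ∈ s, f i : Lp ℝ 2 m) =ᵐ[m] fun x => ∑ i ∈ s, f i x := by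
  classical
  induction s using Finset.induction_on with
  | empty =>
    simp only [Finset.sum_empty]
    exact Lp.coeFn_zero ℝ 2 m
  | insert a s ha ih =>
    simp only [Finset.sum_insert ha]
    filter_upwards [Lp.coeFn_add (f a) (∑ i ∈ s, f i), ih] with x h1 h2
    rw [h1, Pi.add_apply, h2]

/-- Links the abstract bounded operator to the concrete formula. The identity is almost everywhere
because the integral of the matrix-vector product splits into its summands only where all slices are
integrable. -/
theorem coeFn_clm1 (hk : k.Mem R) (i : q₁) (v : q → L2 R) :
    clm1 hk i v =ᵐ[R.μx] fun x => (k.op R fun z j => v j z).2.1 x i := by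
  simp only [clm1, _root_.sum_apply, ContinuousLinearMap.comp_apply,
    _root_.add_apply, ContinuousLinearMap.proj_apply]
  have h1 := coeFn_sum (m := R.μx) Finset.univ fun j =>
    (isBddOp_fst (hk.k10 i j) (hk.k11 i j)).1.clm (v j)
    + (isBddOp_fst (hk.k10 i j) (hk.k11 i j)).2.clm (v j)
  have h2 : ∀ᵐ x ∂(R.μx), ∀ j, ((isBddOp_fst (hk.k10 i j) (hk.k11 i j)).1.clm (v j)
    + (isBddOp_fst (hk.k10 i j) (hk.k11 i j)).2.clm (v j) : Lp ℝ 2 R.μx) x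
      = (∫ y, k.k10 (x, y) i j * v j (x, y) ∂(R.μy)) + ∫ z, k.k11 (x, z) i j * v j z ∂(R.μ) := by
    refine ae_all_iff.2 fun j => ?_
    filter_upwards [Lp.coeFn_add ((isBddOp_fst (hk.k10 i j) (hk.k11 i j)).1.clm (v j))
      ((isBddOp_fst (hk.k10 i j) (hk.k11 i j)).2.clm (v j)),
      (isBddOp_fst (hk.k10 i j) (hk.k11 i j)).1.coeFn_clm (v j),
      (isBddOp_fst (hk.k10 i j) (hk.k11 i j)).2.coeFn_clm (v j)] with x h1 h2 h3
    rw [h1, Pi.add_apply, h2, h3]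
  have h3 : ∀ᵐ x ∂(R.μx), ∀ j, Integrable (fun y => k.k10 (x, y) i j * v j (x, y)) R.μy := by
    refine ae_all_iff.2 fun j => ?_
    have h : MemLp (fun z => k.k10 z i j * v j z) 2 R.μ := (Lp.memLp (v j)).mul' (hk.k10 i j)
    filter_upwards [MemLp.slice_fst h] with x hx
    exact hx.integrable (by norm_num)
  have h4 : ∀ᵐ x ∂(R.μx), ∀ j, Integrable (fun z => k.k11 (x, z) i j * v j z) R.μ := by
    refine ae_all_iff.2 fun j => ?_
    filter_upwards [MemLp.slice (hk.k11 i j)] with x hx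
    exact hx.integrable_mul (Lp.memLp (v j))
  filter_upwards [h1, h2, h3, h4] with x h1 h2 h3 h4
  rw [h1]
  simp only [h2, N021.op, vI, Pi.add_apply, Matrix.mulVec, dotProduct]
  rw [integral_finsetSum _ fun j _ => h3 j, integral_finsetSum _ fun j _ => h4 j,
    Finset.sum_add_distrib]

theorem coeFn_clm2 (hk : k.Mem R) (i : q₁) (v : q → L2 R) :
    clm2 hk i v =ᵐ[R.μy] fun x => (k.op R fun z j => v j z).2.2 x i := by
  simp only [clm2, _root_.sum_apply, ContinuousLinearMap.comp_apply,
    _root_.add_apply, ContinuousLinearMap.proj_apply]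
  have h1 := coeFn_sum (m := R.μy) Finset.univ fun j =>
    (isBddOp_snd (hk.k20 i j) (hk.k21 i j)).1.clm (v j)
    + (isBddOp_snd (hk.k20 i j) (hk.k21 i j)).2.clm (v j)
  have h2 : ∀ᵐ y ∂(R.μy), ∀ j, ((isBddOp_snd (hk.k20 i j) (hk.k21 i j)).1.clm (v j)
    + (isBddOp_snd (hk.k20 i j) (hk.k21 i j)).2.clm (v j) : Lp ℝ 2 R.μy) y
      = (∫ x, k.k20 (x, y) i j * v j (x, y) ∂(R.μx)) + ∫ z, k.k21 (y, z) i j * v j z ∂(R.μ) := by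
    refine ae_all_iff.2 fun j => ?_
    filter_upwards [Lp.coeFn_add ((isBddOp_snd (hk.k20 i j) (hk.k21 i j)).1.clm (v j))
      ((isBddOp_snd (hk.k20 i j) (hk.k21 i j)).2.clm (v j)),
      (isBddOp_snd (hk.k20 i j) (hk.k21 i j)).1.coeFn_clm (v j),
      (isBddOp_snd (hk.k20 i j) (hk.k21 i j)).2.coeFn_clm (v j)] with x h1 h2 h3
    rw [h1, Pi.add_apply, h2, h3]
  have h3 : ∀ᵐ y ∂(R.μy), ∀ j, Integrable (fun x => k.k20 (x, y) i j * v j (x, y)) R.μx := by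
    refine ae_all_iff.2 fun j => ?_
    have h : MemLp (fun z => k.k20 z i j * v j z) 2 R.μ := (Lp.memLp (v j)).mul' (hk.k20 i j)
    filter_upwards [MemLp.slice_snd h] with y hy
    exact hy.integrable (by norm_num)
  have h4 : ∀ᵐ y ∂(R.μy), ∀ j, Integrable (fun z => k.k21 (y, z) i j * v j z) R.μ := by
    refine ae_all_iff.2 fun j => ?_
    filter_upwards [MemLp.slice (hk.k21 i j)] with x hx
    exact hx.integrable_mul (Lp.memLp (v j))
  filter_upwards [h1, h2, h3, h4] with x h1 h2 h3 h4
  rw [h1]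
  simp only [h2, N021.op, vI, Pi.add_apply, Matrix.mulVec, dotProduct]
  rw [integral_finsetSum _ fun j _ => h3 j, integral_finsetSum _ fun j _ => h4 j,
    Finset.sum_add_distrib]

/-- The first entry is finite dimensional and each component is an inner product with a
square-integrable row, so equality is exact. -/
theorem clm0_apply (hk : k.Mem R) (i : q₀) (v : q → L2 R) :
    clm0 hk i v = (k.op R fun z j => v j z).1 i := by
  simp only [clm0, _root_.sum_apply, ContinuousLinearMap.comp_apply,
    ContinuousLinearMap.proj_apply, innerSL_apply_apply, L2.inner_def, N021.op, vI, Matrix.mulVec,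
    dotProduct]
  have h : ∀ j, Integrable (fun z => k.k0 z i j * v j z) R.μ := fun j =>
    (hk.k0 i j).integrable_mul (Lp.memLp (v j))
  rw [integral_finsetSum _ fun j _ => h j]
  refine Finset.sum_congr rfl fun j _ => integral_congr_ae ?_
  filter_upwards [(hk.k0 i j).coeFn_toLp] with z hz
  simp [hz, mul_comm]

theorem op_congr {v' : ℝ × ℝ → q → ℝ} (h : ∀ᵐ z ∂(R.μ), v z = v' z) :
    RL.Eqv R (k.op R v) (k.op R v') := by
  have e0 : ∀ {p : Type} (K : ℝ × ℝ → Matrix p q ℝ),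
      (vI R.μ fun z => K z *ᵥ v z) = vI R.μ fun z => K z *ᵥ v' z := fun K => vI_congr (by
    filter_upwards [h] with z hz
    rw [hz])
  rw [R.μ_eq] at h
  refine ⟨e0 _, ?_, ?_⟩
  · filter_upwards [Measure.ae_ae_of_ae_prod h] with x hx
    simp only [N021.op, e0 (fun z => k.k11 (x, z))]
    congr 1
    exact vI_congr (by filter_upwards [hx] with y hy; rw [hy])
  · have h' := Measure.ae_ae_of_ae_prod (Measure.measurePreserving_swap.quasiMeasurePreserving.ae h)
    filter_upwards [h'] with y hy
    simp only [N021.op, e0 (fun z => k.k21 (y, z))]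
    congr 1
    exact vI_congr (by filter_upwards [hy] with x hx; simp only [Prod.swap] at hx; rw [hx])

/-- Passing to L₂ classes changes the output only on null sets, and on classes the output is given
by the bounded operators `clm1` and `clm2`. -/
theorem op_mem (hk : k.Mem R) (hv : VMem v 2 R.μ) : (k.op R v).Mem R := by
  let V : q → L2 R := fun j => (hv j).toLp
  have h : ∀ᵐ z ∂(R.μ), (fun j => V j z) = v z := by
    filter_upwards [ae_all_iff.2 fun j => (hv j).coeFn_toLp] with z hz
    exact funext hz
  obtain ⟨-, h1, h2⟩ := op_congr (k := k) h
  refine ⟨fun i => (Lp.memLp (clm1 hk i V)).ae_eq ?_, fun i => (Lp.memLp (clm2 hk i V)).ae_eq ?_⟩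
  · filter_upwards [coeFn_clm1 hk i V, h1] with x hx hx'
    rw [hx, hx']
  · filter_upwards [coeFn_clm2 hk i V, h2] with x hx hx'
    rw [hx, hx']

variable [Fintype p₁]

/-- Fubini for an outer operator acting on the `x` component: the fibre integral contributes `e *
k10` and the full kernel contributes its integral against `e`, together one kernel on the rectangle.
-/
theorem vI_pairX (hk : k.Mem R) (hv : VMem v 2 R.μ) {e : ℝ → Matrix p₁ q₁ ℝ}
    (he : MMem e 2 R.μx) :
    (vI R.μx fun x => e x *ᵥ (k.op R v).2.1 x) = vI R.μ fun z => k.pairX R e z *ᵥ v z := by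
  have hkv : VMem (fun z => k.k10 z *ᵥ v z) 2 R.μ := hk.k10.mulVec hv
  have hkl := mMem_mI_fst hk he
  have hek := mMem_mul_fst hk he
  have h1 : VMem (fun x => vI R.μy fun y => k.k10 (x, y) *ᵥ v (x, y)) 2 R.μx := fun i => by
    rw [R.μ_eq] at hkv
    exact IsBddOp.marginal.memLp (hkv i)
  -- The sum of both terms is square integrable by `op_mem` and the first term is as well, so the
  -- second follows by subtraction.
  have h2 : VMem (fun x => vI R.μ fun z => k.k11 (x, z) *ᵥ v z) 2 R.μx := by
    have := VMem.sub (fun i => (op_mem hk hv).1 i) h1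
    simpa [N021.op] using this
  simp only [N021.op, Matrix.mulVec_add, pairX, Matrix.add_mulVec]
  rw [vI_add (he.mulVec h1) (he.mulVec h2), vI_add (hek.mulVec hv) (hkl.mulVec hv),
    vI_mulVec_kernel he hk.k11 hv]
  congr 1
  have hk10 := hk.k10
  rw [R.μ_eq] at hv hk10 ⊢
  exact vI_mulVec_fibre he hk10 hv

theorem vI_pairY (hk : k.Mem R) (hv : VMem v 2 R.μ) {e : ℝ → Matrix p₁ q₁ ℝ}
    (he : MMem e 2 R.μy) :
    (vI R.μy fun y => e y *ᵥ (k.op R v).2.2 y) = vI R.μ fun z => k.pairY R e z *ᵥ v z := by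
  have hkv : VMem (fun z => k.k20 z *ᵥ v z) 2 R.μ := hk.k20.mulVec hv
  have hkl := mMem_mI_snd hk he
  have hek := mMem_mul_snd hk he
  have h1 : VMem (fun y => vI R.μx fun x => k.k20 (x, y) *ᵥ v (x, y)) 2 R.μy := fun i =>
    isBddOp_marginal_snd.memLp (hkv i)
  have h2 : VMem (fun x => vI R.μ fun z => k.k21 (x, z) *ᵥ v z) 2 R.μy := by
    have := VMem.sub (fun i => (op_mem hk hv).2 i) h1
    simpa [N021.op] using this
  simp only [N021.op, Matrix.mulVec_add, pairY, Matrix.add_mulVec]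
  rw [vI_add (he.mulVec h1) (he.mulVec h2), vI_add (hek.mulVec hv) (hkl.mulVec hv),
    vI_mulVec_kernel he hk.k21 hv]
  congr 1
  have hk20 := hk.k20
  rw [R.μ_eq] at hv hk20 ⊢
  have h3 := vI_mulVec_fibre (μ := R.μy) (ν := R.μx) he hk20.swap hv.swap
  simp only [Prod.swap] at h3
  rw [h3]
  funext i
  exact integral_prod_swap (μ := R.μx) (ν := R.μy) fun z => ((e z.2 * k.k20 z) *ᵥ v z) i

end N021

end PIE2D

end

/-! ### Composition of a separable 011-PI operator with an operator from the rectangle -/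

noncomputable section

namespace PIE2D

open Matrix

set_option linter.unusedSectionVars false

/-- This is where separability acts: with equal kernels on both sides of the diagonal, the two
Volterra integrals form one integral over the whole interval. -/
theorem vint_add_adjacent {p : Type} {s t x : ℝ} (hx : x ∈ Icc s t) {f : ℝ → p → ℝ}
    (hf : VMem f 1 (volume.restrict (Icc s t))) :
    vint s x f + vint x t f = vI (volume.restrict (Icc s t)) f := by
  rw [← vint_eq_vI (hx.1.trans hx.2)]
  funext i
  have h : IntervalIntegrable (fun η => f η i) volume s t := by
    rw [intervalIntegrable_iff_integrableOn_Icc_of_le (hx.1.trans hx.2)]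
    exact memLp_one_iff_integrable.1 (hf i)
  refine intervalIntegral.integral_add_adjacent_intervals (h.mono_set ?_) (h.mono_set ?_)
  · rw [uIcc_of_le hx.1, uIcc_of_le (hx.1.trans hx.2)]
    exact Icc_subset_Icc_right hx.2
  · rw [uIcc_of_le hx.2, uIcc_of_le (hx.1.trans hx.2)]
    exact Icc_subset_Icc_left hx.1

namespace N021

variable {p₀ p₁ q₀ q₁ q : Type} [Fintype q₀] [Fintype q₁] [Fintype q] [Fintype p₀] [Fintype p₁]
  {R : Rect} {k : N021 q₀ q₁ q} {v : ℝ × ℝ → q → ℝ} {E : N011 p₀ q₀ p₁ q₁}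

theorem mMem_tensor {α : Type*} [MeasurableSpace α] {m : Measure α} [IsFiniteMeasure m]
    {γ : Type*} [MeasurableSpace γ] {τ : Measure γ} [SFinite τ]
    {e : α → Matrix p₁ q₁ ℝ} {K : γ → Matrix q₁ q ℝ} (he : MMem e 2 m) (hK : MMem K 2 τ) :
    MMem (fun w : α × γ => e w.1 * K w.2) 2 (m.prod τ) := fun i j => by
  simp only [Matrix.mul_apply]
  exact memLp_finsetSum _ fun l _ => MemLp.tensor (he i l) (hK l j)

theorem mMem_fst_top {α : Type*} [MeasurableSpace α] {m : Measure α} [IsFiniteMeasure m]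
    {γ : Type*} [MeasurableSpace γ] {τ : Measure γ} [SFinite τ]
    {e : α → Matrix p₁ q₁ ℝ} {K : α × γ → Matrix q₁ q ℝ} {s : ENNReal} (he : MMem e ⊤ m)
    (hK : MMem K s (m.prod τ)) :
    MMem (fun w : α × γ => e w.1 * K w) s (m.prod τ) := by
  have he' : MMem (fun w : α × γ => e w.1) ⊤ (m.prod τ) := fun i j => MemLp.comp_fst_top (he i j)
  exact he'.mul hK

theorem comp_mem (hE : E.Mem R) (hk : k.Mem R) : (comp R E k).Mem R where
  k0 := (hk.k0.const_mul _).add (mMem_pairX hk hE.b01) |>.add (mMem_pairY hk hE.b02)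
  k10 := by
    have := hk.k10
    rw [R.μ_eq] at *
    exact mMem_fst_top hE.b11.n0 this
  k20 := by
    have he : MMem (fun z : ℝ × ℝ => E.b22.n0 z.2) ⊤ R.μ := by
      rw [R.μ_eq]
      exact fun i j => MemLp.comp_snd_top (hE.b22.n0 i j)
    exact he.mul hk.k20
  k11 := by
    refine (((mMem_tensor hE.b10 hk.k0).add (mMem_fst_top hE.b11.n0 hk.k11)).add
      (mMem_pairX_param hk hE.b11.n1)).add (mMem_pairY_param hk (fun i j => ?_))
    have := hE.b12 i j
    rwa [R.μ_eq] at this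
  k21 := by
    refine (((mMem_tensor hE.b20 hk.k0).add (mMem_fst_top hE.b22.n0 hk.k21)).add
      (mMem_pairY_param hk hE.b22.n1)).add
        (mMem_pairX_param (e := fun y x => E.b21 x y) hk (fun i j => ?_))
    have := hE.b21 i j
    rw [R.μ_eq] at this
    exact this.comp_measurePreserving Measure.measurePreserving_swap

/-- Each block of `E` acting on an edge function is, thanks to separability, a pairing with a row
that does not break at the output point, so `vI_pairX` and `vI_pairY` turn it into one rectangle
kernel. The multiplier block keeps its fibre integral and thus feeds both the fibre part and the
full-kernel part. Used for `𝓑` applied to `𝓗₂` and for `E` applied to `𝓑 𝓗₂`. -/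
theorem op_comp (hE : E.Mem R) (hsep : E.Separable) (hk : k.Mem R) (hv : VMem v 2 R.μ) :
    RL.Eqv R (E.op R (k.op R v)) ((comp R E k).op R v) := by
  have hw := op_mem hk hv
  have hkv0 : VMem (fun z => k.k0 z *ᵥ v z) 1 R.μ := hk.k0.mulVec hv
  have mv : ∀ {K : ℝ × ℝ → Matrix p₁ q ℝ}, MMem K 2 R.μ → VMem (fun z => K z *ᵥ v z) 1 R.μ :=
    fun hK => hK.mulVec hv
  refine ⟨?_, ?_, ?_⟩
  · have c0 := hk.k0.const_mul E.b00
    have c1 := mMem_pairX hk hE.b01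
    have c2 := mMem_pairY hk hE.b02
    have m : ∀ {K : ℝ × ℝ → Matrix p₀ q ℝ}, MMem K 2 R.μ → VMem (fun z => K z *ᵥ v z) 1 R.μ :=
      fun hK => hK.mulVec hv
    simp only [N011.op, vint_eq_vI R.hab.le, vint_eq_vI R.hcd.le]
    rw [vI_pairX hk hv hE.b01, vI_pairY hk hv hE.b02]
    simp only [N021.op, comp, Matrix.add_mulVec]
    rw [vI_add ((m c0).add (m c1)) (m c2), vI_add (m c0) (m c1), mulVec_vI _ hkv0]
    simp only [Matrix.mulVec_mulVec]
  · have h12 := hE.b12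
    have hkv1 : VMem (fun z => k.k10 z *ᵥ v z) 2 R.μ := hk.k10.mulVec hv
    rw [R.μ_eq] at h12 hkv1
    -- For fixed `x`, the rows of all kernels and the fibre of `k10 v` are square integrable outside
    -- a null set, which is what the splitting of integrals needs.
    filter_upwards [ae_restrict_mem measurableSet_Icc, MMem.slice_two hE.b11.n1,
      MMem.slice_two h12, MMem.slice_two hk.k11, VMem.slice_two hkv1] with x hx s1 s2 s3 s4
    have hsum := vint_add_adjacent hx (f := fun θ => E.b11.n1 x θ *ᵥ (k.op R v).2.1 θ)
      (MMem.mulVec (t := 2) s1 fun i => hw.1 i)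
    have c0 := hk.k0.const_mul (E.b10 x)
    have c1 := s3.const_mul (E.b11.n0 x)
    have c2 := mMem_pairX hk s1
    have c3 := mMem_pairY hk s2
    simp only [N011.op, N1D.op, vint_eq_vI R.hcd.le, ← hsep.1]
    rw [add_assoc (E.b11.n0 x *ᵥ _), hsum, vI_pairX hk hv s1, vI_pairY hk hv s2]
    simp only [N021.op, comp, Matrix.add_mulVec]
    rw [vI_add (((mv c0).add (mv c1)).add (mv c2)) (mv c3), vI_add ((mv c0).add (mv c1)) (mv c2),
      vI_add (mv c0) (mv c1), mulVec_vI _ hkv0, Matrix.mulVec_add,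
      mulVec_vI _ (s3.mulVec (t := 2) (u := 1) hv),
      mulVec_vI _ fun i => (s4 i).mono_exponent (by norm_num)]
    simp only [Matrix.mulVec_mulVec]
    abel
  · have h21 := hE.b21
    have hkv2 : VMem (fun z => k.k20 z *ᵥ v z) 2 R.μ := hk.k20.mulVec hv
    rw [R.μ_eq] at h21 hkv2
    filter_upwards [ae_restrict_mem measurableSet_Icc, MMem.slice_two hE.b22.n1,
      MMem.slice_two (MMem.swap (M := fun z : ℝ × ℝ => E.b21 z.1 z.2) h21),
      MMem.slice_two hk.k21, VMem.slice_two hkv2.swap] with y hy s1 s2 s3 s4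
    simp only [Prod.swap_prod_mk] at s2 s4
    have hsum := vint_add_adjacent hy (f := fun θ => E.b22.n1 y θ *ᵥ (k.op R v).2.2 θ)
      (MMem.mulVec (t := 2) s1 fun i => hw.2 i)
    have c0 := hk.k0.const_mul (E.b20 y)
    have c1 := s3.const_mul (E.b22.n0 y)
    have c2 := mMem_pairY hk s1
    have c3 := mMem_pairX (e := fun x => E.b21 x y) hk s2
    simp only [N011.op, N1D.op, vint_eq_vI R.hab.le, ← hsep.2]
    rw [add_assoc (E.b22.n0 y *ᵥ _), hsum, vI_pairY hk hv s1,
      vI_pairX (e := fun x => E.b21 x y) hk hv s2]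
    simp only [N021.op, comp, Matrix.add_mulVec]
    rw [vI_add (((mv c0).add (mv c1)).add (mv c2)) (mv c3), vI_add ((mv c0).add (mv c1)) (mv c2),
      vI_add (mv c0) (mv c1), mulVec_vI _ hkv0, Matrix.mulVec_add,
      mulVec_vI _ (s3.mulVec (t := 2) (u := 1) hv),
      mulVec_vI _ fun i => (s4 i).mono_exponent (by norm_num)]
    simp only [Matrix.mulVec_mulVec]
    abel

end N021

end PIE2D

end

noncomputable section

namespace PIE2D

open Matrix

set_option linter.unusedSectionVars false

/-! ### Weights of the sub-intervals -/

/-- The indicator of `θ ≤ x`. -/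
def chi (x θ : ℝ) : ℝ := if θ ≤ x then 1 else 0

theorem measurable_chi (x : ℝ) : Measurable (chi x) :=
  Measurable.ite measurableSet_Iic measurable_const measurable_const

theorem abs_chi_le (x θ : ℝ) : |chi x θ| ≤ 1 := by
  unfold chi
  split_ifs <;> simp

theorem abs_one_sub_chi_le (x θ : ℝ) : |1 - chi x θ| ≤ 1 := by
  unfold chi
  split_ifs <;> simp

theorem memLp_chi (x : ℝ) (m : Measure ℝ) : MemLp (chi x) ⊤ m :=
  memLp_top_of_bound (measurable_chi x).aestronglyMeasurable 1
    (Filter.Eventually.of_forall (abs_chi_le x))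

/-- Replacing a variable endpoint by the weight `chi` puts all integrals over the same fixed
interval, where they can be added under one integral sign. -/
theorem integral_left_eq_chi {s t x : ℝ} (hx : x ∈ Icc s t) (f : ℝ → ℝ) :
    ∫ η in s..x, f η = ∫ η in Icc s t, chi x η * f η := by
  have h : (fun η => chi x η * f η) = (Iic x).indicator f := by
    funext η
    simp [chi, indicator_apply]
  rw [intervalIntegral.integral_of_le hx.1, h, integral_indicator measurableSet_Iic,
    Measure.restrict_restrict measurableSet_Iic, ← integral_Icc_eq_integral_Ioc]
  congr 2
  ext η
  simp only [mem_Icc, mem_inter_iff, mem_Iic]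
  exact ⟨fun h => ⟨h.2, h.1, h.2.trans hx.2⟩, fun h => ⟨h.2.1, h.1⟩⟩

theorem integral_right_eq_chi {s t x : ℝ} (hx : x ∈ Icc s t) (f : ℝ → ℝ) :
    ∫ η in x..t, f η = ∫ η in Icc s t, (1 - chi x η) * f η := by
  have h : (fun η => (1 - chi x η) * f η) = (Ioi x).indicator f := by
    funext η
    by_cases h : η ≤ x <;> simp [chi, h, not_le.1, not_lt.2]
  rw [intervalIntegral.integral_of_le hx.2, h, integral_indicator measurableSet_Ioi,
    Measure.restrict_restrict measurableSet_Ioi]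
  congr 2
  ext η
  simp only [mem_Icc, mem_inter_iff, mem_Ioi, mem_Ioc]
  exact ⟨fun h => ⟨h.1, hx.1.trans h.1.le, h.2⟩, fun h => ⟨h.1, h.2.2⟩⟩

/-- The weights `g`, `h` are abstract so that one statement serves all four quadrants, with `chi` or
`1 - chi` in each variable. -/
theorem vint_vint_eq {R : Rect} {p : Type} {s t s' t' : ℝ} {f : ℝ × ℝ → p → ℝ} {g h : ℝ → ℝ}
    (hf : VMem f 1 R.μ) (hg : ∀ f : ℝ → ℝ, ∫ η in s..t, f η = ∫ η, g η * f η ∂(R.μx))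
    (hh : ∀ f : ℝ → ℝ, ∫ η in s'..t', f η = ∫ η, h η * f η ∂(R.μy))
    (mg : Measurable g) (mh : Measurable h) (bg : ∀ x, |g x| ≤ 1) (bh : ∀ x, |h x| ≤ 1) :
    (vint s t fun θ => vint s' t' fun ν => f (θ, ν)) = vI R.μ fun w => (g w.1 * h w.2) • f w := by
  funext i
  simp only [vint, vI, hg, hh, ← integral_const_mul, Pi.smul_apply, smul_eq_mul]
  have hi : Integrable (fun w => (g w.1 * h w.2) * f w i) R.μ := by
    refine (memLp_one_iff_integrable.1 (hf i)).bdd_mul (c := 1)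
      ((mg.comp measurable_fst).mul (mh.comp measurable_snd)).aestronglyMeasurable ?_
    refine Filter.Eventually.of_forall fun w => ?_
    rw [Real.norm_eq_abs, abs_mul]
    exact mul_le_one₀ (bg _) (abs_nonneg _) (bh _)
  rw [R.μ_eq] at hi ⊢
  rw [integral_prod _ hi]
  simp only [mul_assoc]

/-! ### The operators `𝓑 𝓗₂` and `(𝓑 𝓗₁)⁻¹ 𝓑 𝓗₂` -/

section Params

variable (R : Rect) (n₀ n₁ n₂ : ℕ)

/-- The parameters of `𝓗₂`. -/
def H2 : N021 (BF0 n₁ n₂) (BF1 n₁ n₂) (St n₀ n₁ n₂) where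
  k0 z := H03 R n₀ n₁ n₂ z.1 z.2
  k10 z := H13 R n₀ n₁ n₂ z.2
  k11 := 0
  k20 z := H23 R n₀ n₁ n₂ z.1
  k21 := 0

theorem memLp_top_of_continuous {f : ℝ × ℝ → ℝ} (hf : Continuous f) : MemLp f ⊤ R.μ := by
  have hK : IsCompact (Icc R.a R.b ×ˢ Icc R.c R.d) := isCompact_Icc.prod isCompact_Icc
  obtain ⟨C, hC⟩ := hK.exists_bound_of_continuousOn hf.continuousOn
  exact memLp_top_of_bound hf.aestronglyMeasurable C
    ((ae_restrict_iff' hK.measurableSet).2 (Filter.Eventually.of_forall hC))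

theorem memLp_top_of_continuous_Icc {s t : ℝ} {f : ℝ → ℝ} (hf : Continuous f) :
    MemLp f ⊤ (volume.restrict (Icc s t)) := by
  obtain ⟨C, hC⟩ := isCompact_Icc.exists_bound_of_continuousOn (hf.continuousOn (s := Icc s t))
  exact memLp_top_of_bound hf.aestronglyMeasurable C
    ((ae_restrict_iff' measurableSet_Icc).2 (Filter.Eventually.of_forall hC))

theorem continuous_H03 (i j) : Continuous fun z : ℝ × ℝ => H03 R n₀ n₁ n₂ z.1 z.2 i j := by
  rcases j with j | j | j <;> rcases i with ⟨κ, i⟩ | ⟨e, κ, i⟩ <;>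
    simp only [H03, fromCols_apply_inl, fromCols_apply_inr, fromBlocks_apply₁₁, fromBlocks_apply₁₂,
      fromBlocks_apply₂₁, fromBlocks_apply₂₂, bcol, bgcol, Matrix.of_apply, Matrix.zero_apply] <;>
    try fun_prop

theorem continuous_H13 (i j) : Continuous fun y : ℝ => H13 R n₀ n₁ n₂ y i j := by
  rcases j with j | j | j <;> rcases i with ⟨κ, i⟩ | ⟨e, κ, i⟩ <;>
    simp only [H13, fromCols_apply_inl, fromCols_apply_inr, fromBlocks_apply₁₁, fromBlocks_apply₁₂,
      fromBlocks_apply₂₁, fromBlocks_apply₂₂, bcol, bgcol, Matrix.of_apply, Matrix.zero_apply] <;>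
    try fun_prop

theorem continuous_H23 (i j) : Continuous fun x : ℝ => H23 R n₀ n₁ n₂ x i j := by
  rcases j with j | j | j <;> rcases i with ⟨κ, i⟩ | ⟨e, κ, i⟩ <;>
    simp only [H23, fromCols_apply_inl, fromCols_apply_inr, fromBlocks_apply₁₁, fromBlocks_apply₁₂,
      fromBlocks_apply₂₁, fromBlocks_apply₂₂, bcol, bgcol, Matrix.of_apply, Matrix.zero_apply] <;>
    try fun_prop

theorem continuous_K31 (x y : ℝ) (i j) : Continuous fun θ : ℝ => K31 R n₀ n₁ n₂ x y θ i j := by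
  rcases i with i | i | i <;> rcases j with j | ⟨e, j⟩ <;>
    simp only [K31, fromRows_apply_inl, fromRows_apply_inr, fromBlocks_apply₁₁, fromBlocks_apply₁₂,
      fromBlocks_apply₂₁, fromBlocks_apply₂₂, brow, Matrix.of_apply, Matrix.zero_apply] <;>
    try fun_prop

theorem continuous_K32 (x y : ℝ) (i j) : Continuous fun θ : ℝ => K32 R n₀ n₁ n₂ x y θ i j := by
  rcases i with i | i | i <;> rcases j with j | ⟨e, j⟩ <;>
    simp only [K32, fromRows_apply_inl, fromRows_apply_inr, fromBlocks_apply₁₁, fromBlocks_apply₁₂,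
      fromBlocks_apply₂₁, fromBlocks_apply₂₂, brow, Matrix.of_apply, Matrix.zero_apply] <;>
    try fun_prop

theorem continuous_K33 (x y : ℝ) (i j) :
    Continuous fun z : ℝ × ℝ => K33 n₀ n₁ n₂ x y z.1 z.2 i j := by
  rcases i with i | i | i <;> rcases j with j | j | j <;>
    simp only [K33, fromBlocks_apply₁₁, fromBlocks_apply₁₂, fromBlocks_apply₂₁, fromBlocks_apply₂₂,
      Matrix.smul_apply, smul_eq_mul, Matrix.zero_apply] <;>
    fun_prop

theorem mMem_K31 (x y : ℝ) : MMem (fun θ => chi x θ • K31 R n₀ n₁ n₂ x y θ) 2 R.μx :=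
  (MMem.smul (memLp_chi x R.μx) fun i j =>
    memLp_top_of_continuous_Icc (continuous_K31 R n₀ n₁ n₂ x y i j)).mono le_top

theorem mMem_K32 (x y : ℝ) : MMem (fun ν => chi y ν • K32 R n₀ n₁ n₂ x y ν) 2 R.μy :=
  (MMem.smul (memLp_chi y R.μy) fun i j =>
    memLp_top_of_continuous_Icc (continuous_K32 R n₀ n₁ n₂ x y i j)).mono le_top

theorem mMem_K33 (x y : ℝ) : MMem (fun z => K33 n₀ n₁ n₂ x y z.1 z.2) 2 R.μ :=
  MMem.mono (t := ⊤) (fun i j => memLp_top_of_continuous R (continuous_K33 n₀ n₁ n₂ x y i j)) le_top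

theorem H2_mem : (H2 R n₀ n₁ n₂).Mem R where
  k0 := MMem.mono (t := ⊤) (fun i j => memLp_top_of_continuous R (continuous_H03 R n₀ n₁ n₂ i j))
    le_top
  k10 i j := memLp_top_of_continuous R ((continuous_H13 R n₀ n₁ n₂ i j).comp continuous_snd)
  k20 i j := memLp_top_of_continuous R ((continuous_H23 R n₀ n₁ n₂ i j).comp continuous_fst)
  k11 _ _ := MemLp.zero
  k21 _ _ := MemLp.zero

variable {n₁ n₂} (B : BParam n₁ n₂) (E : EParam n₁ n₂)

/-- The parameters `F` of `𝓑 𝓗₂`. -/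
def Fparam : N021 (Fin (n₁ + 4 * n₂)) (Fin (n₁ + 2 * n₂)) (St n₀ n₁ n₂) :=
  N021.comp R B (H2 R n₀ n₁ n₂)

/-- The parameters `G` of `(𝓑 𝓗₁)⁻¹ 𝓑 𝓗₂`. -/
def Gparam : N021 (BC0 n₁ n₂) (BC1 n₁ n₂) (St n₀ n₁ n₂) :=
  N021.comp R E (Fparam R n₀ B)

theorem mI_zero {α p q : Type} [MeasurableSpace α] (m : Measure α) :
    mI m (fun _ => (0 : Matrix p q ℝ)) = 0 := by
  ext i j
  simp [mI]

theorem Fparam_k0 (z : ℝ × ℝ) : (Fparam R n₀ B).k0 z = F0 R n₀ B z.1 z.2 := by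
  simp [Fparam, N021.comp, N021.pairX, N021.pairY, H2, mI_zero, F0]

theorem Fparam_k10 (z : ℝ × ℝ) : (Fparam R n₀ B).k10 z = F10 R n₀ B z.1 z.2 := rfl

theorem Fparam_k20 (z : ℝ × ℝ) : (Fparam R n₀ B).k20 z = F20 R n₀ B z.1 z.2 := rfl

/-- `k11` takes its output variable first and then the integration point `(θ, y)`, whereas `F11`
takes `x y θ`; this accounts for the exchanged components. -/
theorem Fparam_k11 (w : ℝ × ℝ × ℝ) :
    (Fparam R n₀ B).k11 w = F11 R n₀ B w.1 w.2.2 w.2.1 := by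
  simp [Fparam, N021.comp, N021.pairX, N021.pairY, H2, mI_zero, F11]

theorem Fparam_k21 (w : ℝ × ℝ × ℝ) :
    (Fparam R n₀ B).k21 w = F21 R n₀ B w.2.1 w.1 w.2.2 := by
  simp [Fparam, N021.comp, N021.pairX, N021.pairY, H2, mI_zero, F21]

/-- The explicit formula is the composition rule applied twice, up to the order of summands. -/
theorem Gparam_k0 (z : ℝ × ℝ) : (Gparam R n₀ B E).k0 z = G0 R n₀ B E z.1 z.2 := by
  simp only [Gparam, N021.comp, N021.pairX, N021.pairY, G0, mint_eq_mI R.hab.le,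
    mint_eq_mI R.hcd.le, Fparam_k0, Fparam_k10, Fparam_k20, Fparam_k11, Fparam_k21]
  abel

theorem Gparam_k10 (z : ℝ × ℝ) : (Gparam R n₀ B E).k10 z = G10 R n₀ B E z.1 z.2 := rfl

theorem Gparam_k20 (z : ℝ × ℝ) : (Gparam R n₀ B E).k20 z = G20 R n₀ B E z.1 z.2 := rfl

theorem Gparam_k11 (w : ℝ × ℝ × ℝ) :
    (Gparam R n₀ B E).k11 w = G11 R n₀ B E w.1 w.2.2 w.2.1 := by
  simp only [Gparam, N021.comp, N021.pairX, N021.pairY, G11, mint_eq_mI R.hab.le,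
    mint_eq_mI R.hcd.le, Fparam_k0, Fparam_k10, Fparam_k20, Fparam_k11, Fparam_k21]
  abel

theorem Gparam_k21 (w : ℝ × ℝ × ℝ) :
    (Gparam R n₀ B E).k21 w = G21 R n₀ B E w.2.1 w.1 w.2.2 := by
  simp only [Gparam, N021.comp, N021.pairX, N021.pairY, G21, mint_eq_mI R.hab.le,
    mint_eq_mI R.hcd.le, Fparam_k0, Fparam_k10, Fparam_k20, Fparam_k11, Fparam_k21]
  abel

variable {R B E}

theorem Fparam_mem (hB : B.Mem R) : (Fparam R n₀ B).Mem R :=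
  N021.comp_mem hB (H2_mem R n₀ n₁ n₂)

theorem Gparam_mem (hB : B.Mem R) (hE : E.Mem R) : (Gparam R n₀ B E).Mem R :=
  N021.comp_mem hE (Fparam_mem n₀ hB)

theorem mint_left_eq {p q : Type} {s t x : ℝ} (hx : x ∈ Icc s t) (f : ℝ → Matrix p q ℝ) :
    mint s x f = mI (volume.restrict (Icc s t)) fun η => chi x η • f η := by
  ext i j
  simp only [mint, mI, Matrix.of_apply, integral_left_eq_chi hx]
  rfl

/-- The identity `𝓣 v = 𝓚₂ v - 𝓚₁ (P[G] v)` at each point of the rectangle. With indicator weights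
both sides become one integral over the rectangle, so it suffices to compare kernels at fixed `(x,
y)`. -/
theorem Tmap_eq (hB : B.Mem R) (hE : E.Mem R) (v : L2St R n₀ n₁ n₂) {z : ℝ × ℝ}
    (hz : z ∈ Icc R.a R.b ×ˢ Icc R.c R.d) :
    Tmap R n₀ B E v z = (T00 n₀ n₁ n₂ *ᵥ fun q => v q z)
      + (vI R.μ fun w => (chi z.1 w.1 * chi z.2 w.2) •
          (K33 n₀ n₁ n₂ z.1 z.2 w.1 w.2 *ᵥ fun q => v q w))
      - (K30 R n₀ n₁ n₂ z.1 z.2 *ᵥ ((Gparam R n₀ B E).op R fun z q => v q z).1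
        + (vI R.μx fun θ => (chi z.1 θ • K31 R n₀ n₁ n₂ z.1 z.2 θ) *ᵥ
            ((Gparam R n₀ B E).op R fun z q => v q z).2.1 θ)
        + vI R.μy fun ν => (chi z.2 ν • K32 R n₀ n₁ n₂ z.1 z.2 ν) *ᵥ
            ((Gparam R n₀ B E).op R fun z q => v q z).2.2 ν) := by
  obtain ⟨x, y⟩ := z
  obtain ⟨hx, hy⟩ := hz
  simp only at hx hy ⊢
  have hG := Gparam_mem n₀ hB hE
  have hv : VMem (fun z q => v q z) 2 R.μ := N021.vMem_coe v
  have k1 := mMem_K31 R n₀ n₁ n₂ x y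
  have k2 := mMem_K32 R n₀ n₁ n₂ x y
  have m10 : MMem (fun w : ℝ × ℝ => K31 R n₀ n₁ n₂ x y w.1 * G10 R n₀ B E w.1 w.2) 2 R.μ :=
    N021.mMem_mul_fst (e := fun θ => K31 R n₀ n₁ n₂ x y θ) hG (MMem.mono (t := ⊤) (fun i j =>
      memLp_top_of_continuous_Icc (continuous_K31 R n₀ n₁ n₂ x y i j)) le_top)
  have m20 : MMem (fun w : ℝ × ℝ => K32 R n₀ n₁ n₂ x y w.2 * G20 R n₀ B E w.1 w.2) 2 R.μ :=
    N021.mMem_mul_snd (e := fun θ => K32 R n₀ n₁ n₂ x y θ) hG (MMem.mono (t := ⊤) (fun i j =>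
      memLp_top_of_continuous_Icc (continuous_K32 R n₀ n₁ n₂ x y i j)) le_top)
  have m33 := mMem_K33 R n₀ n₁ n₂ x y
  -- `T22` is the full-kernel part of `-𝓚₁ P[G]`; its partial integrals acquire the weight `chi`,
  -- which makes square integrability a case of the general lemmas.
  have t22 : ∀ w : ℝ × ℝ, T22 R n₀ B E x y w.1 w.2
      = - (K30 R n₀ n₁ n₂ x y * (Gparam R n₀ B E).k0 w)
        - (mI R.μx fun θ => (chi x θ • K31 R n₀ n₁ n₂ x y θ) * (Gparam R n₀ B E).k11 (θ, w))
        - (mI R.μy fun ν => (chi y ν • K32 R n₀ n₁ n₂ x y ν) * (Gparam R n₀ B E).k21 (ν, w)) := by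
    intro w
    simp only [T22, mint_left_eq hx, mint_left_eq hy, Gparam_k0, Gparam_k11, Gparam_k21,
      Matrix.smul_mul]
  have m22 : MMem (fun w : ℝ × ℝ => T22 R n₀ B E x y w.1 w.2) 2 R.μ := by
    simp only [t22]
    exact ((hG.k0.const_mul _).neg.sub (N021.mMem_mI_fst hG k1)).sub (N021.mMem_mI_snd hG k2)
  have m12 : MMem (fun w : ℝ × ℝ => T12 R n₀ B E x y w.1 w.2) 2 R.μ := m10.neg.add m22
  have m21 : MMem (fun w : ℝ × ℝ => T21 R n₀ B E x y w.1 w.2) 2 R.μ := m20.neg.add m22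
  have m11 : MMem (fun w : ℝ × ℝ => T11 R n₀ B E x y w.1 w.2) 2 R.μ :=
    ((m33.add m21).add m12).sub m22
  have hl := measurable_chi
  have hr : ∀ x, Measurable fun θ => 1 - chi x θ := fun x => measurable_const.sub (hl x)
  have q11 := vint_vint_eq (m11.mulVec (u := 1) hv) (integral_left_eq_chi hx)
    (integral_left_eq_chi hy) (hl x) (hl y) (abs_chi_le x) (abs_chi_le y)
  have q21 := vint_vint_eq (m21.mulVec (u := 1) hv) (integral_right_eq_chi hx)
    (integral_left_eq_chi hy) (hr x) (hl y) (abs_one_sub_chi_le x) (abs_chi_le y)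
  have q12 := vint_vint_eq (m12.mulVec (u := 1) hv) (integral_left_eq_chi hx)
    (integral_right_eq_chi hy) (hl x) (hr y) (abs_chi_le x) (abs_one_sub_chi_le y)
  have q22 := vint_vint_eq (m22.mulVec (u := 1) hv) (integral_right_eq_chi hx)
    (integral_right_eq_chi hy) (hr x) (hr y) (abs_one_sub_chi_le x) (abs_one_sub_chi_le y)
  have z1 : ∀ s t : ℝ, vint s t (fun _ => (0 : St n₀ n₁ n₂ → ℝ)) = 0 := fun s t => by
    funext i
    simp [vint]
  rw [N021.vI_pairX hG hv k1, N021.vI_pairY hG hv k2]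
  have hw : ∀ {g h : ℝ → ℝ} {M : ℝ × ℝ → Matrix (St n₀ n₁ n₂) (St n₀ n₁ n₂) ℝ}, Measurable g →
      Measurable h → (∀ x, |g x| ≤ 1) → (∀ x, |h x| ≤ 1) → MMem M 2 R.μ →
      VMem (fun w => (g w.1 * h w.2) • (M w *ᵥ fun q => v q w)) 1 R.μ := by
    intro g h M mg mh bg bh hM
    have hc : MemLp (fun w : ℝ × ℝ => g w.1 * h w.2) ⊤ R.μ := by
      refine memLp_top_of_bound
        ((mg.comp measurable_fst).mul (mh.comp measurable_snd)).aestronglyMeasurable 1 ?_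
      refine Filter.Eventually.of_forall fun w => ?_
      rw [Real.norm_eq_abs, abs_mul]
      exact mul_le_one₀ (bg _) (abs_nonneg _) (bh _)
    have := (MMem.smul hc hM).mulVec (u := 1) hv
    simpa only [Matrix.smul_mulVec] using this
  have w11 := hw (hl x) (hl y) (abs_chi_le x) (abs_chi_le y) m11
  have w21 := hw (hr x) (hl y) (abs_one_sub_chi_le x) (abs_chi_le y) m21
  have w12 := hw (hl x) (hr y) (abs_chi_le x) (abs_one_sub_chi_le y) m12
  have w22 := hw (hr x) (hr y) (abs_one_sub_chi_le x) (abs_one_sub_chi_le y) m22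
  have w33 := hw (hl x) (hl y) (abs_chi_le x) (abs_chi_le y) m33
  have g0 := (hG.k0.const_mul (K30 R n₀ n₁ n₂ x y)).mulVec (u := 1) hv
  have g1 := (N021.mMem_pairX hG k1).mulVec (u := 1) hv
  have g2 := (N021.mMem_pairY hG k2).mulVec (u := 1) hv
  have e0 : K30 R n₀ n₁ n₂ x y *ᵥ ((Gparam R n₀ B E).op R fun z q => v q z).1
      = vI R.μ fun w => (K30 R n₀ n₁ n₂ x y * (Gparam R n₀ B E).k0 w) *ᵥ fun q => v q w := by
    simp only [N021.op]
    rw [mulVec_vI _ (hG.k0.mulVec hv)]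
    simp only [Matrix.mulVec_mulVec]
  rw [e0, ← vI_add g0 g1, ← vI_add (g0.add g1) g2, add_sub_assoc,
    ← vI_sub w33 ((g0.add g1).add g2)]
  simp only [Tmap, N2D.op, Tparam, Pi.zero_apply, Matrix.zero_mulVec, z1, add_zero]
  rw [q11, q21, q12, q22, add_assoc, add_assoc, add_assoc]
  congr 1
  rw [← vI_add w12 w22, ← vI_add w21 (w12.add w22), ← vI_add w11 (w21.add (w12.add w22))]
  congr 1
  funext w
  simp only [← Matrix.smul_mulVec, ← Matrix.add_mulVec, ← Matrix.sub_mulVec]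
  congr 1
  -- The four quadrant weights sum to 1, so `T22` enters once in total. The `K31` correction occurs
  -- in `T11` and `T12` and collects weight `chi x`, the `K32` correction collects `chi y`, and
  -- `K33` keeps `chi x * chi y`.
  simp only [T11, T21, T12, t22, N021.pairX, N021.pairY, Gparam_k10, Gparam_k20, Matrix.smul_mul]
  module

end Params

end PIE2D

end

noncomputable section

namespace PIE2D

/-! ### Fibrewise integral operators -/

section Fibre

variable {α β : Type*} [MeasurableSpace α] [MeasurableSpace β] {m : Measure α} {ν : Measure β}
  [IsFiniteMeasure m] [IsFiniteMeasure ν]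

/-- A composition of three bounded operators: view `f` as a function of three variables, multiply by
the bounded `c`, and integrate out the last variable. -/
theorem isBddOp_fibre {c : α × α → ℝ} (hc : MemLp c ⊤ (m.prod m)) :
    IsBddOp (fun f (z : α × β) => ∫ θ, c (z.1, θ) * f (θ, z.2) ∂m) (m.prod ν) (m.prod ν) := by
  have hφ : Measurable fun w : (α × β) × α => (w.2, w.1.2) :=
    measurable_snd.prodMk (measurable_snd.comp measurable_fst)
  have h1 : IsBddOp (fun f (w : (α × β) × α) => f (w.2, w.1.2)) (m.prod ν) ((m.prod ν).prod m) := by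
    refine IsBddOp.pullback hφ (c := (m univ).toNNReal) ?_
    have h : (fun w : (α × β) × α => (w.2, w.1.2)) = Prod.swap ∘ Prod.map Prod.snd id := rfl
    rw [h, ← Measure.map_map measurable_swap (measurable_snd.prodMap measurable_id),
      ← Measure.map_prod_map _ _ measurable_snd measurable_id, Measure.map_snd_prod, Measure.map_id,
      Measure.prod_smul_left, Measure.map_smul, Measure.prod_swap, ENNReal.smul_def,
      ENNReal.coe_toNNReal (measure_ne_top m _)]
  have hk : MemLp (fun w : (α × β) × α => c (w.1.1, w.2)) ⊤ ((m.prod ν).prod m) := by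
    obtain ⟨C, hC⟩ := MemLp.ae_bound hc
    have q : Measure.QuasiMeasurePreserving (fun w : (α × β) × α => (w.1.1, w.2))
        ((m.prod ν).prod m) (m.prod m) :=
      MeasureTheory.QuasiMeasurePreserving.prodMap Measure.quasiMeasurePreserving_fst
        (Measure.QuasiMeasurePreserving.id m)
    exact memLp_top_of_bound (hc.1.comp_quasiMeasurePreserving q) C (q.ae hC)
  exact IsBddOp.marginal.comp ((IsBddOp.mul hk).comp h1)

theorem integral_kernel_swap {c : α × β → ℝ} (hc : MemLp c ⊤ (m.prod ν)) {h : α → ℝ} {g : β → ℝ}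
    (hh : MemLp h 2 m) (hg : MemLp g 2 ν) :
    ∫ σ, h σ * ∫ θ, c (σ, θ) * g θ ∂ν ∂m = ∫ θ, (∫ σ, c (σ, θ) * h σ ∂m) * g θ ∂ν := by
  have hi : Integrable (Function.uncurry fun σ θ => c (σ, θ) * (h σ * g θ)) (m.prod ν) := by
    have h1 : MemLp (fun z : α × β => c z * (h z.1 * g z.2)) 2 (m.prod ν) :=
      (MemLp.tensor hh hg).mul' hc
    exact h1.integrable (by norm_num)
  have e := integral_integral_swap hi
  simp only [← integral_const_mul, ← integral_mul_const]
  refine Eq.trans ?_ (e.trans ?_)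
  · exact integral_congr_ae (Filter.Eventually.of_forall fun σ =>
      integral_congr_ae (Filter.Eventually.of_forall fun θ => by simp only; ring))
  · exact integral_congr_ae (Filter.Eventually.of_forall fun θ =>
      integral_congr_ae (Filter.Eventually.of_forall fun σ => by simp only; ring))

/-- The adjoint of a fibrewise operator has the transposed kernel. It is the source of integration
by parts and of the formulas for iterated primitives. -/
theorem integral_fibre_swap {c : α × α → ℝ} (hc : MemLp c ⊤ (m.prod m)) {h g : α × β → ℝ}
    (hh : MemLp h 2 (m.prod ν)) (hg : MemLp g 2 (m.prod ν)) :
    ∫ z, h z * ∫ θ, c (z.1, θ) * g (θ, z.2) ∂m ∂(m.prod ν)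
      = ∫ z, (∫ σ, c (σ, z.1) * h (σ, z.2) ∂m) * g z ∂(m.prod ν) := by
  have hc' : MemLp (fun z => c z.swap) ⊤ (m.prod m) :=
    hc.comp_measurePreserving Measure.measurePreserving_swap
  refine (integral_prod_symm _ (hh.integrable_mul ((isBddOp_fibre hc).memLp hg))).trans
    (Eq.trans ?_ (integral_prod_symm _ (((isBddOp_fibre hc').memLp hh).integrable_mul hg)).symm)
  refine integral_congr_ae ?_
  have s1 := MemLp.slice (hh.comp_measurePreserving (Measure.measurePreserving_swap (μ := ν)))
  have s2 := MemLp.slice (hg.comp_measurePreserving (Measure.measurePreserving_swap (μ := ν)))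
  filter_upwards [s1, s2] with y h1 h2
  exact integral_kernel_swap hc h1 h2

end Fibre

theorem measurable_chi_uncurry : Measurable fun w : ℝ × ℝ => chi w.1 w.2 :=
  Measurable.ite (measurableSet_le measurable_snd measurable_fst) measurable_const measurable_const

theorem memLp_chi_uncurry (m : Measure (ℝ × ℝ)) : MemLp (fun w : ℝ × ℝ => chi w.1 w.2) ⊤ m :=
  memLp_top_of_bound measurable_chi_uncurry.aestronglyMeasurable 1
    (Filter.Eventually.of_forall fun w => abs_chi_le w.1 w.2)

/-! ### Primitives in one variable -/

section Prim

variable {s t : ℝ}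

/-- The primitive `x ↦ ∫ₛˣ g`, for a measure `m` on an interval starting at `s`. -/
def prim (m : Measure ℝ) (g : ℝ → ℝ) (x : ℝ) : ℝ := ∫ θ, chi x θ * g θ ∂m

/-- The kernel `(x - θ)₊` of the second primitive. -/
def ramp (x θ : ℝ) : ℝ := (x - θ) * chi x θ

theorem continuousAt_chi {x θ : ℝ} (h : θ ≠ x) : ContinuousAt (fun x => chi x θ) x := by
  rcases lt_or_gt_of_ne h with h | h
  · refine (continuousAt_const (y := (1 : ℝ))).congr ?_
    filter_upwards [eventually_gt_nhds h] with y hy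
    simp [chi, le_of_lt hy]
  · refine (continuousAt_const (y := (0 : ℝ))).congr ?_
    filter_upwards [eventually_lt_nhds h] with y hy
    simp [chi, hy]

/-- Dominated convergence: `chi y θ` is continuous in `y` at `x` unless `θ = x`, a null set. -/
theorem continuous_prim {m : Measure ℝ} [NullSingletonClass m] {g : ℝ → ℝ} (hg : Integrable g m) :
    Continuous (prim m g) := by
  refine continuous_iff_continuousAt.2 fun x => ?_
  refine continuousAt_of_dominated (bound := fun θ => |g θ|)
    (Filter.Eventually.of_forall fun y => (measurable_chi y).aestronglyMeasurable.mul hg.1)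
    (Filter.Eventually.of_forall fun y => Filter.Eventually.of_forall fun θ => ?_) hg.abs ?_
  · rw [Real.norm_eq_abs, abs_mul]
    exact mul_le_of_le_one_left (abs_nonneg _) (abs_chi_le _ _)
  · filter_upwards [compl_mem_ae_iff.2 (measure_singleton (μ := m) x)] with θ hθ
    exact (continuousAt_chi hθ).mul continuousAt_const

theorem integral_chi_left {θ : ℝ} (hθ : θ ∈ Icc s t) (h : ℝ → ℝ) :
    ∫ σ in Icc s t, chi σ θ * h σ = ∫ σ in θ..t, h σ := by
  have e : (fun σ => chi σ θ * h σ) = (Ici θ).indicator h := by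
    funext σ
    simp [chi, indicator_apply]
  rw [intervalIntegral.integral_of_le hθ.2, e, integral_indicator measurableSet_Ici,
    Measure.restrict_restrict measurableSet_Ici, ← integral_Icc_eq_integral_Ioc]
  congr 2
  ext σ
  simp only [mem_Icc, mem_inter_iff, mem_Ici]
  exact ⟨fun h => ⟨h.1, h.2.2⟩, fun h => ⟨h.1, hθ.1.trans h.1, h.2⟩⟩

/-- The integrand is the indicator of `[θ, x]`, whose length is `(x - θ)₊`. -/
theorem integral_chi_chi {x θ : ℝ} (hx : x ∈ Icc s t) (hθ : θ ∈ Icc s t) :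
    ∫ σ in Icc s t, chi σ θ * chi x σ = ramp x θ := by
  rw [integral_chi_left hθ]
  by_cases h : θ ≤ x
  · have := integral_left_eq_chi (s := θ) (t := t) (x := x) ⟨h, hx.2⟩ fun _ => 1
    rw [intervalIntegral.integral_of_le hθ.2, ← integral_Icc_eq_integral_Ioc]
    simp only [mul_one] at this
    rw [← this]
    simp [ramp, chi, h]
  · rw [intervalIntegral.integral_of_le hθ.2, setIntegral_congr_fun measurableSet_Ioc
      (g := fun _ => 0)]
    · simp [ramp, chi, h]
    · intro σ hσ
      have : ¬ σ ≤ x := fun h' => h (hσ.1.le.trans h')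
      simp [chi, this]

theorem prim_one {x : ℝ} (hx : x ∈ Icc s t) :
    prim (volume.restrict (Icc s t)) (fun _ => 1) x = x - s := by
  rw [prim, ← integral_left_eq_chi hx]
  simp

/-- Cauchy's formula for repeated integration, from Fubini and `integral_chi_chi`. -/
theorem integral_chi_prim {x : ℝ} (hx : x ∈ Icc s t) {g : ℝ → ℝ}
    (hg : MemLp g 2 (volume.restrict (Icc s t))) :
    prim (volume.restrict (Icc s t)) (prim (volume.restrict (Icc s t)) g) x
      = ∫ θ in Icc s t, ramp x θ * g θ := by
  have h := integral_kernel_swap (c := fun w => chi w.1 w.2) (memLp_chi_uncurry _)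
    ((memLp_chi x (volume.restrict (Icc s t))).mono_exponent le_top) hg
  refine h.trans (setIntegral_congr_fun measurableSet_Icc fun θ hθ => ?_)
  simp only [integral_chi_chi hx hθ]

end Prim

/-! ### Primitives on the rectangle -/

section Ops

variable (R : Rect)

theorem isBddOp_Ix : IsBddOp (fun f z => ∫ θ, chi z.1 θ * f (θ, z.2) ∂(R.μx)) R.μ R.μ := by
  rw [R.μ_eq]
  exact isBddOp_fibre (c := fun w => chi w.1 w.2) (memLp_chi_uncurry _)

theorem isBddOp_swap {α β : Type*} [MeasurableSpace α] [MeasurableSpace β] (μ : Measure α)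
    (ν : Measure β) [SFinite μ] [SFinite ν] :
    IsBddOp (fun f (z : β × α) => f z.swap) (μ.prod ν) (ν.prod μ) := by
  refine IsBddOp.pullback measurable_swap (c := 1) ?_
  rw [Measure.measurePreserving_swap.map_eq, one_smul]

theorem isBddOp_Iy : IsBddOp (fun f z => ∫ ν, chi z.2 ν * f (z.1, ν) ∂(R.μy)) R.μ R.μ := by
  rw [R.μ_eq]
  exact (isBddOp_swap R.μy R.μx).comp ((isBddOp_fibre (m := R.μy) (ν := R.μx)
    (c := fun w => chi w.1 w.2) (memLp_chi_uncurry _)).comp (isBddOp_swap R.μx R.μy))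

theorem isBddOp_ex : IsBddOp (fun p (z : ℝ × ℝ) => p z.1) R.μx R.μ := by
  refine IsBddOp.pullback measurable_fst (c := (R.μy univ).toNNReal) ?_
  rw [R.μ_eq, Measure.map_fst_prod, ENNReal.smul_def, ENNReal.coe_toNNReal (measure_ne_top _ _)]

theorem isBddOp_ey : IsBddOp (fun p (z : ℝ × ℝ) => p z.2) R.μy R.μ := by
  refine IsBddOp.pullback measurable_snd (c := (R.μx univ).toNNReal) ?_
  rw [R.μ_eq, Measure.map_snd_prod, ENNReal.smul_def, ENNReal.coe_toNNReal (measure_ne_top _ _)]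

/-- The operator `f ↦ ∫ₐˣ f(θ, y) dθ`. -/
def Ix : L2 R →L[ℝ] L2 R := (isBddOp_Ix R).clm

/-- The operator `f ↦ ∫_cʸ f(x, ν) dν`. -/
def Iy : L2 R →L[ℝ] L2 R := (isBddOp_Iy R).clm

/-- A function of `x` as a function on the rectangle. -/
def ex : Lp ℝ 2 R.μx →L[ℝ] L2 R := (isBddOp_ex R).clm

/-- A function of `y` as a function on the rectangle. -/
def ey : Lp ℝ 2 R.μy →L[ℝ] L2 R := (isBddOp_ey R).clm

/-- The constant function `1`. -/
def one : L2 R := (memLp_const 1 : MemLp (fun _ => (1 : ℝ)) 2 R.μ).toLp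

variable {R}

theorem coeFn_Ix {f : L2 R} {g : ℝ × ℝ → ℝ} (h : f =ᵐ[R.μ] g) :
    Ix R f =ᵐ[R.μ] fun z => prim R.μx (fun θ => g (θ, z.2)) z.1 :=
  (isBddOp_Ix R).coeFn_clm' h

theorem coeFn_Iy {f : L2 R} {g : ℝ × ℝ → ℝ} (h : f =ᵐ[R.μ] g) :
    Iy R f =ᵐ[R.μ] fun z => prim R.μy (fun ν => g (z.1, ν)) z.2 :=
  (isBddOp_Iy R).coeFn_clm' h

theorem coeFn_ex (p : Lp ℝ 2 R.μx) : ex R p =ᵐ[R.μ] fun z => p z.1 := (isBddOp_ex R).coeFn_clm p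

theorem coeFn_ey (p : Lp ℝ 2 R.μy) : ey R p =ᵐ[R.μ] fun z => p z.2 := (isBddOp_ey R).coeFn_clm p

theorem coeFn_one : one R =ᵐ[R.μ] fun _ => 1 := MemLp.coeFn_toLp _

/-- The double primitive `∫ₐˣ ∫_cʸ f`. -/
def dprim (R : Rect) (f : ℝ × ℝ → ℝ) (z : ℝ × ℝ) : ℝ :=
  ∫ w, chi z.1 w.1 * chi z.2 w.2 * f w ∂(R.μ)

theorem integrable_weight_mul {g h : ℝ → ℝ} (hg : MemLp g ⊤ R.μx) (hh : MemLp h ⊤ R.μy)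
    {f : ℝ × ℝ → ℝ} (hf : MemLp f 2 R.μ) :
    MemLp (fun w => g w.1 * h w.2 * f w) 2 R.μ := by
  rw [R.μ_eq] at *
  have h1 : MemLp (fun w : ℝ × ℝ => g w.1 * h w.2) ⊤ (R.μx.prod R.μy) :=
    (MemLp.comp_snd_top hh).mul' (MemLp.comp_fst_top hg)
  exact hf.mul' h1

theorem coeFn_Ix_Iy (f : L2 R) : Ix R (Iy R f) =ᵐ[R.μ] dprim R f := by
  refine (coeFn_Ix (coeFn_Iy (Filter.EventuallyEq.refl _ _))).trans
    (Filter.Eventually.of_forall fun z => ?_)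
  have hi := (integrable_weight_mul (memLp_chi z.1 _) (memLp_chi z.2 _) (Lp.memLp f)).integrable
    (by norm_num)
  have e : ∫ w, chi z.1 w.1 * chi z.2 w.2 * f w ∂(R.μx.prod R.μy) = dprim R f z := by
    rw [← R.μ_eq]
    rfl
  have hi' : Integrable (fun w => chi z.1 w.1 * chi z.2 w.2 * f w) (R.μx.prod R.μy) := by
    convert hi
    exact R.μ_eq.symm
  rw [← e, integral_prod _ hi']
  simp only [prim, ← integral_const_mul, mul_assoc]

theorem coeFn_Iy_Ix (f : L2 R) : Iy R (Ix R f) =ᵐ[R.μ] dprim R f := by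
  refine (coeFn_Iy (coeFn_Ix (Filter.EventuallyEq.refl _ _))).trans
    (Filter.Eventually.of_forall fun z => ?_)
  have hi := (integrable_weight_mul (memLp_chi z.1 _) (memLp_chi z.2 _) (Lp.memLp f)).integrable
    (by norm_num)
  have e : ∫ w, chi z.1 w.1 * chi z.2 w.2 * f w ∂(R.μx.prod R.μy) = dprim R f z := by
    rw [← R.μ_eq]
    rfl
  have hi' : Integrable (fun w => chi z.1 w.1 * chi z.2 w.2 * f w) (R.μx.prod R.μy) := by
    convert hi
    exact R.μ_eq.symm
  rw [← e, integral_prod_symm _ hi']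
  simp only [prim, ← integral_const_mul]
  exact integral_congr_ae (Filter.Eventually.of_forall fun y =>
    integral_congr_ae (Filter.Eventually.of_forall fun x => by ring))

/-- Both orders equal the double primitive `dprim` by Fubini. This commutation makes it possible to
read off x-derivatives and y-derivatives of the same expression. -/
theorem Iy_Ix (f : L2 R) : Iy R (Ix R f) = Ix R (Iy R f) :=
  Lp.ext ((coeFn_Iy_Ix f).trans (coeFn_Ix_Iy f).symm)

theorem ae_fst_ne (x : ℝ) : ∀ᵐ w ∂(R.μ), w.1 ≠ x := by
  rw [R.μ_eq]
  exact Measure.quasiMeasurePreserving_fst.ae (compl_mem_ae_iff.2 (measure_singleton x))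

theorem ae_snd_ne (y : ℝ) : ∀ᵐ w ∂(R.μ), w.2 ≠ y := by
  rw [R.μ_eq]
  exact Measure.quasiMeasurePreserving_snd.ae (compl_mem_ae_iff.2 (measure_singleton y))

theorem continuous_dprim (f : L2 R) : Continuous (dprim R f) := by
  have hf : Integrable f R.μ := (Lp.memLp f).integrable (by norm_num)
  have hm : ∀ z : ℝ × ℝ, Measurable fun w : ℝ × ℝ => chi z.1 w.1 * chi z.2 w.2 := fun z =>
    ((measurable_chi _).comp measurable_fst).mul ((measurable_chi _).comp measurable_snd)
  refine continuous_iff_continuousAt.2 fun z => ?_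
  refine continuousAt_of_dominated (bound := fun w => |f w|)
    (Filter.Eventually.of_forall fun y => (hm y).aestronglyMeasurable.mul hf.1)
    (Filter.Eventually.of_forall fun y => Filter.Eventually.of_forall fun w => ?_) hf.abs ?_
  · rw [Real.norm_eq_abs, abs_mul, abs_mul]
    exact mul_le_of_le_one_left (abs_nonneg _)
      (mul_le_one₀ (abs_chi_le _ _) (abs_nonneg _) (abs_chi_le _ _))
  · filter_upwards [ae_fst_ne z.1, ae_snd_ne z.2] with w h1 h2
    have c1 : ContinuousAt (fun z : ℝ × ℝ => chi z.1 w.1) z :=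
      ContinuousAt.comp (f := Prod.fst) (continuousAt_chi h1) continuousAt_fst
    have c2 : ContinuousAt (fun z : ℝ × ℝ => chi z.2 w.2) z :=
      ContinuousAt.comp (f := Prod.snd) (continuousAt_chi h2) continuousAt_snd
    exact (c1.mul c2).mul continuousAt_const

theorem ae_mem_rect : ∀ᵐ w ∂(R.μ), w ∈ Icc R.a R.b ×ˢ Icc R.c R.d :=
  ae_restrict_mem (measurableSet_Icc.prod measurableSet_Icc)

theorem integral_mul_Ix {h : ℝ × ℝ → ℝ} (hh : MemLp h 2 R.μ) (f : L2 R) :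
    ∫ w, h w * Ix R f w ∂(R.μ)
      = ∫ w, (∫ σ, chi σ w.1 * h (σ, w.2) ∂(R.μx)) * f w ∂(R.μ) := by
  have e : ∫ w, h w * Ix R f w ∂(R.μ)
      = ∫ w, h w * ∫ θ, chi w.1 θ * f (θ, w.2) ∂(R.μx) ∂(R.μ) := by
    refine integral_congr_ae ?_
    filter_upwards [coeFn_Ix (Filter.EventuallyEq.refl _ f)] with w hw
    rw [hw]
    rfl
  rw [e]
  have hf := Lp.memLp f
  -- The type of `f` mentions the measure; the factorisation of the measure can be substituted only
  -- after `f` is reduced to a bare function.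
  generalize (f : ℝ × ℝ → ℝ) = f at *
  rw [R.μ_eq] at *
  exact integral_fibre_swap (c := fun w => chi w.1 w.2) (memLp_chi_uncurry _) hh hf

theorem integral_mul_Iy {h : ℝ × ℝ → ℝ} (hh : MemLp h 2 R.μ) (f : L2 R) :
    ∫ w, h w * Iy R f w ∂(R.μ)
      = ∫ w, (∫ σ, chi σ w.2 * h (w.1, σ) ∂(R.μy)) * f w ∂(R.μ) := by
  have e : ∫ w, h w * Iy R f w ∂(R.μ)
      = ∫ w, h w * ∫ θ, chi w.2 θ * f (w.1, θ) ∂(R.μy) ∂(R.μ) := by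
    refine integral_congr_ae ?_
    filter_upwards [coeFn_Iy (Filter.EventuallyEq.refl _ f)] with w hw
    rw [hw]
    rfl
  rw [e]
  have hf := Lp.memLp f
  generalize (f : ℝ × ℝ → ℝ) = f at *
  rw [R.μ_eq] at *
  have := integral_fibre_swap (c := fun w => chi w.1 w.2) (memLp_chi_uncurry _)
    (hh.comp_measurePreserving (Measure.measurePreserving_swap (μ := R.μy)))
    (hf.comp_measurePreserving (Measure.measurePreserving_swap (μ := R.μy)))
  rw [← integral_prod_swap (μ := R.μx) (ν := R.μy), ← integral_prod_swap (μ := R.μx) (ν := R.μy)]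
  exact this

/-- Moving `Ix` to the weight by the adjoint formula replaces `chi` by its primitive in the second
slot, which is `ramp`. -/
theorem dprim_Ix (f : L2 R) {z : ℝ × ℝ} (hz : z ∈ Icc R.a R.b ×ˢ Icc R.c R.d) :
    dprim R (Ix R f) z = ∫ w, ramp z.1 w.1 * chi z.2 w.2 * f w ∂(R.μ) := by
  have hh : MemLp (fun w : ℝ × ℝ => chi z.1 w.1 * chi z.2 w.2 * 1) 2 R.μ :=
    integrable_weight_mul (memLp_chi z.1 _) (memLp_chi z.2 _) (memLp_const 1)
  simp only [mul_one] at hh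
  refine (integral_mul_Ix hh f).trans (integral_congr_ae ?_)
  filter_upwards [ae_mem_rect] with w hw
  simp only [← mul_assoc]
  rw [integral_mul_const, integral_chi_chi hz.1 hw.1]

/-- The weight in `x` is left general because it is `chi` for one primitive in `x` and `ramp` for
two. -/
theorem integral_ramp_Iy (g : ℝ → ℝ) (hg : MemLp g ⊤ R.μx) (f : L2 R) {y : ℝ}
    (hy : y ∈ Icc R.c R.d) :
    ∫ w, g w.1 * chi y w.2 * Iy R f w ∂(R.μ) = ∫ w, g w.1 * ramp y w.2 * f w ∂(R.μ) := by
  have hh : MemLp (fun w : ℝ × ℝ => g w.1 * chi y w.2 * 1) 2 R.μ :=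
    integrable_weight_mul hg (memLp_chi y _) (memLp_const 1)
  simp only [mul_one] at hh
  refine (integral_mul_Iy hh f).trans (integral_congr_ae ?_)
  filter_upwards [ae_mem_rect] with w hw
  simp only [mul_left_comm _ (g w.1)]
  rw [integral_const_mul, integral_chi_chi hy hw.2]

theorem memLp_ramp (x s t : ℝ) : MemLp (ramp x) ⊤ (volume.restrict (Icc s t)) :=
  (memLp_chi x _).mul' (memLp_top_of_continuous_Icc (continuous_const.sub continuous_id))

theorem dprim_Iy (f : L2 R) {z : ℝ × ℝ} (hz : z ∈ Icc R.a R.b ×ˢ Icc R.c R.d) :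
    dprim R (Iy R f) z = ∫ w, chi z.1 w.1 * ramp z.2 w.2 * f w ∂(R.μ) :=
  integral_ramp_Iy _ (memLp_chi _ _) f hz.2

theorem dprim_Ix_Iy (f : L2 R) {z : ℝ × ℝ} (hz : z ∈ Icc R.a R.b ×ˢ Icc R.c R.d) :
    dprim R (Ix R (Iy R f)) z = ∫ w, ramp z.1 w.1 * ramp z.2 w.2 * f w ∂(R.μ) :=
  (dprim_Ix _ hz).trans (integral_ramp_Iy _ (memLp_ramp _ _ _) f hz.2)

end Ops

end PIE2D

end

noncomputable section

namespace PIE2D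

/-! ### Weak derivatives of primitives -/

section Weak

variable {R : Rect}

theorem IsTest.pdx {φ : ℝ × ℝ → ℝ} (h : IsTest R φ) : IsTest R (pdx φ) where
  smooth := smooth_pdx h.smooth
  compact := (h.compact.fderiv (𝕜 := ℝ)).comp_left (g := fun L : ℝ × ℝ →L[ℝ] ℝ => L (1, 0)) rfl
  supp := ((closure_mono (Function.support_comp_subset
    (g := fun L : ℝ × ℝ →L[ℝ] ℝ => L (1, 0)) rfl _)).trans (tsupport_fderiv_subset ℝ)).trans h.supp

theorem IsTest.pdy {φ : ℝ × ℝ → ℝ} (h : IsTest R φ) : IsTest R (pdy φ) where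
  smooth := smooth_pdy h.smooth
  compact := (h.compact.fderiv (𝕜 := ℝ)).comp_left (g := fun L : ℝ × ℝ →L[ℝ] ℝ => L (0, 1)) rfl
  supp := ((closure_mono (Function.support_comp_subset
    (g := fun L : ℝ × ℝ →L[ℝ] ℝ => L (0, 1)) rfl _)).trans (tsupport_fderiv_subset ℝ)).trans h.supp

theorem IsTest.pdy_iterate {φ : ℝ × ℝ → ℝ} (h : IsTest R φ) (j : ℕ) :
    IsTest R (PIE2D.pdy^[j] φ) := by
  induction j with
  | zero => exact h
  | succ n ih => rw [Function.iterate_succ_apply']; exact ih.pdy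

theorem IsTest.pdx_iterate {φ : ℝ × ℝ → ℝ} (h : IsTest R φ) (j : ℕ) :
    IsTest R (PIE2D.pdx^[j] φ) := by
  induction j with
  | zero => exact h
  | succ n ih => rw [Function.iterate_succ_apply']; exact ih.pdx

theorem IsTest.eq_zero {φ : ℝ × ℝ → ℝ} (h : IsTest R φ) {z : ℝ × ℝ}
    (hz : z ∉ Ioo R.a R.b ×ˢ Ioo R.c R.d) : φ z = 0 :=
  image_eq_zero_of_notMem_tsupport fun h' => hz (h.supp h')

theorem IsTest.integral_pdx {φ : ℝ × ℝ → ℝ} (h : IsTest R φ) (x y : ℝ) :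
    ∫ σ in x..R.b, PIE2D.pdx φ (σ, y) = - φ (x, y) := by
  have hd : ∀ σ, HasDerivAt (fun σ => φ (σ, y)) (PIE2D.pdx φ (σ, y)) σ := fun σ =>
    ((h.smooth.differentiable (by simp)) (σ, y)).hasFDerivAt.comp_hasDerivAt σ
      ((hasDerivAt_id σ).prodMk (hasDerivAt_const σ y))
  have hc : Continuous fun σ => PIE2D.pdx φ (σ, y) :=
    h.pdx.smooth.continuous.comp (continuous_id.prodMk continuous_const)
  rw [intervalIntegral.integral_eq_sub_of_hasDerivAt (fun σ _ => hd σ)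
    (hc.intervalIntegrable _ _), h.eq_zero (z := (R.b, y)) (by simp), zero_sub]

theorem IsTest.integral_pdy {φ : ℝ × ℝ → ℝ} (h : IsTest R φ) (x y : ℝ) :
    ∫ σ in y..R.d, PIE2D.pdy φ (x, σ) = - φ (x, y) := by
  have hd : ∀ σ, HasDerivAt (fun σ => φ (x, σ)) (PIE2D.pdy φ (x, σ)) σ := fun σ =>
    ((h.smooth.differentiable (by simp)) (x, σ)).hasFDerivAt.comp_hasDerivAt σ
      ((hasDerivAt_const σ x).prodMk (hasDerivAt_id σ))
  have hc : Continuous fun σ => PIE2D.pdy φ (x, σ) :=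
    h.pdy.smooth.continuous.comp (continuous_const.prodMk continuous_id)
  rw [intervalIntegral.integral_eq_sub_of_hasDerivAt (fun σ _ => hd σ)
    (hc.intervalIntegrable _ _), h.eq_zero (z := (x, R.d)) (by simp), zero_sub]

theorem IsTest.memLp {φ : ℝ × ℝ → ℝ} (h : IsTest R φ) : MemLp φ 2 R.μ :=
  (memLp_top_of_continuous R h.smooth.continuous).mono_exponent le_top

/-- `g` is the weak derivative of `f` in `x`. -/
def WDx (f g : L2 R) : Prop :=
  ∀ φ, IsTest R φ → ∫ z, f z * pdx φ z ∂(R.μ) = - ∫ z, g z * φ z ∂(R.μ)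

/-- `g` is the weak derivative of `f` in `y`. -/
def WDy (f g : L2 R) : Prop :=
  ∀ φ, IsTest R φ → ∫ z, f z * pdy φ z ∂(R.μ) = - ∫ z, g z * φ z ∂(R.μ)

theorem wdx_iff (f g : L2 R) : WDx f g ↔ IsWeakDeriv R 1 0 f g := by
  simp [WDx, IsWeakDeriv]

theorem wdy_iff (f g : L2 R) : WDy f g ↔ IsWeakDeriv R 0 1 f g := by
  simp [WDy, IsWeakDeriv]

theorem WDx.add {f g f' g' : L2 R} (h : WDx f g) (h' : WDx f' g') : WDx (f + f') (g + g') := by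
  rw [wdx_iff] at *
  exact h.add h'

theorem WDy.add {f g f' g' : L2 R} (h : WDy f g) (h' : WDy f' g') : WDy (f + f') (g + g') := by
  rw [wdy_iff] at *
  exact h.add h'

/-- The adjoint of `Ix` integrates from the point to the right edge, and sends `∂ₓφ` to `-φ` since
`φ` vanishes there. -/
theorem wdx_Ix (f : L2 R) : WDx (Ix R f) f := fun φ hφ => by
  simp only [mul_comm _ (pdx φ _)]
  rw [integral_mul_Ix hφ.pdx.memLp, ← integral_neg]
  refine integral_congr_ae ?_
  filter_upwards [ae_mem_rect] with w hw
  rw [integral_chi_left hw.1 fun σ => pdx φ (σ, w.2), hφ.integral_pdx]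
  ring

theorem wdy_Iy (f : L2 R) : WDy (Iy R f) f := fun φ hφ => by
  simp only [mul_comm _ (pdy φ _)]
  rw [integral_mul_Iy hφ.pdy.memLp, ← integral_neg]
  refine integral_congr_ae ?_
  filter_upwards [ae_mem_rect] with w hw
  rw [integral_chi_left hw.2 fun σ => pdy φ (w.1, σ), hφ.integral_pdy]
  ring

/-- `f` depends on `y` only. -/
def OnlyY (f : L2 R) : Prop := ∃ q : ℝ → ℝ, f =ᵐ[R.μ] fun z => q z.2

/-- `f` depends on `x` only. -/
def OnlyX (f : L2 R) : Prop := ∃ q : ℝ → ℝ, f =ᵐ[R.μ] fun z => q z.1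

theorem OnlyY.add {f g : L2 R} (hf : OnlyY f) (hg : OnlyY g) : OnlyY (f + g) := by
  obtain ⟨p, hp⟩ := hf
  obtain ⟨q, hq⟩ := hg
  exact ⟨p + q, (Lp.coeFn_add f g).trans (hp.add hq)⟩

theorem OnlyX.add {f g : L2 R} (hf : OnlyX f) (hg : OnlyX g) : OnlyX (f + g) := by
  obtain ⟨p, hp⟩ := hf
  obtain ⟨q, hq⟩ := hg
  exact ⟨p + q, (Lp.coeFn_add f g).trans (hp.add hq)⟩

theorem OnlyY.smul {f : L2 R} (r : ℝ) (hf : OnlyY f) : OnlyY (r • f) := by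
  obtain ⟨p, hp⟩ := hf
  exact ⟨r • p, (Lp.coeFn_smul r f).trans (hp.const_smul r)⟩

theorem OnlyX.smul {f : L2 R} (r : ℝ) (hf : OnlyX f) : OnlyX (r • f) := by
  obtain ⟨p, hp⟩ := hf
  exact ⟨r • p, (Lp.coeFn_smul r f).trans (hp.const_smul r)⟩

theorem OnlyY.Iy {f : L2 R} (hf : OnlyY f) : OnlyY (Iy R f) := by
  obtain ⟨p, hp⟩ := hf
  exact ⟨prim R.μy p, coeFn_Iy hp⟩

theorem OnlyX.Ix {f : L2 R} (hf : OnlyX f) : OnlyX (Ix R f) := by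
  obtain ⟨p, hp⟩ := hf
  exact ⟨prim R.μx p, coeFn_Ix hp⟩

theorem onlyY_one : OnlyY (one R) := ⟨fun _ => 1, coeFn_one⟩

theorem onlyX_one : OnlyX (one R) := ⟨fun _ => 1, coeFn_one⟩

theorem onlyY_ey (p : Lp ℝ 2 R.μy) : OnlyY (ey R p) := ⟨_, coeFn_ey p⟩

theorem onlyX_ex (p : Lp ℝ 2 R.μx) : OnlyX (ex R p) := ⟨_, coeFn_ex p⟩

/-- Along every horizontal line the integral of `∂ₓφ` is zero, and a factor depending on `y` alone
leaves the inner integral. -/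
theorem OnlyY.wdx {f : L2 R} (hf : OnlyY f) : WDx f 0 := fun φ hφ => by
  obtain ⟨q, hq⟩ := hf
  have h0 : ∫ z, (0 : L2 R) z * φ z ∂(R.μ) = 0 := by
    rw [← integral_zero (ℝ × ℝ) ℝ (μ := R.μ)]
    refine integral_congr_ae ?_
    filter_upwards [Lp.coeFn_zero ℝ 2 R.μ] with z hz
    simp only [hz, Pi.zero_apply, zero_mul]
  have e : (fun z => f z * pdx φ z) =ᵐ[R.μ] fun z => q z.2 * pdx φ z := by
    filter_upwards [hq] with z hz
    rw [hz]
  have hi := (integrable_mul_cont R f hφ.pdx.smooth.continuous).congr e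
  rw [h0, integral_congr_ae e]
  rw [R.μ_eq] at hi ⊢
  rw [integral_prod_symm _ hi]
  simp only [integral_const_mul]
  have : ∀ y, ∫ x, pdx φ (x, y) ∂(R.μx) = 0 := fun y => by
    rw [integral_Icc_eq_integral_Ioc, ← intervalIntegral.integral_of_le R.hab.le,
      hφ.integral_pdx, hφ.eq_zero (by simp), neg_zero]
  simp [this]

theorem OnlyX.wdy {f : L2 R} (hf : OnlyX f) : WDy f 0 := fun φ hφ => by
  obtain ⟨q, hq⟩ := hf
  have h0 : ∫ z, (0 : L2 R) z * φ z ∂(R.μ) = 0 := by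
    rw [← integral_zero (ℝ × ℝ) ℝ (μ := R.μ)]
    refine integral_congr_ae ?_
    filter_upwards [Lp.coeFn_zero ℝ 2 R.μ] with z hz
    simp only [hz, Pi.zero_apply, zero_mul]
  have e : (fun z => f z * pdy φ z) =ᵐ[R.μ] fun z => q z.1 * pdy φ z := by
    filter_upwards [hq] with z hz
    rw [hz]
  have hi := (integrable_mul_cont R f hφ.pdy.smooth.continuous).congr e
  rw [h0, integral_congr_ae e]
  rw [R.μ_eq] at hi ⊢
  rw [integral_prod _ hi]
  simp only [integral_const_mul]
  have : ∀ x, ∫ y, pdy φ (x, y) ∂(R.μy) = 0 := fun x => by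
    rw [integral_Icc_eq_integral_Ioc, ← intervalIntegral.integral_of_le R.hcd.le,
      hφ.integral_pdy, hφ.eq_zero (by simp), neg_zero]
  simp [this]

theorem OnlyY.wdx_add_Ix {h : L2 R} (hh : OnlyY h) (f : L2 R) : WDx (h + Ix R f) f := by
  simpa using hh.wdx.add (wdx_Ix f)

theorem OnlyX.wdy_add_Iy {h : L2 R} (hh : OnlyX h) (f : L2 R) : WDy (h + Iy R f) f := by
  simpa using hh.wdy.add (wdy_Iy f)

theorem isWeakDeriv_refl (f : L2 R) : IsWeakDeriv R 0 0 f f := fun φ _ => by simp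

/-- In `IsWeakDeriv` the x-derivatives of the test function are outermost, so a step in `x` can be
put in front of any chain. A step in `y` can be put in front only of chains without x-derivatives,
as in `WDy.isWeakDeriv`; this avoids commuting partial derivatives. -/
theorem WDx.isWeakDeriv {f g h : L2 R} {i j : ℕ} (hfg : WDx f g) (hgh : IsWeakDeriv R i j g h) :
    IsWeakDeriv R (i + 1) j f h := fun φ hφ => by
  rw [Function.iterate_succ_apply', hfg _ ((hφ.pdy_iterate j).pdx_iterate i), hgh φ hφ]
  ring

theorem WDy.isWeakDeriv {f g h : L2 R} {j : ℕ} (hfg : WDy f g) (hgh : IsWeakDeriv R 0 j g h) :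
    IsWeakDeriv R 0 (j + 1) f h := fun φ hφ => by
  have := hgh φ hφ
  simp only [Function.iterate_zero, id] at this ⊢
  rw [Function.iterate_succ_apply', hfg _ (hφ.pdy_iterate j), this]
  ring

theorem ae_mem_open_rect : ∀ᵐ w ∂(R.μ), w ∈ Ioo R.a R.b ×ˢ Ioo R.c R.d := by
  have h : ∀ {s t : ℝ}, ∀ᵐ x ∂(volume.restrict (Icc s t)), x ∈ Ioo s t := fun {s t} => by
    rw [← restrict_Ioo_eq_restrict_Icc]
    exact ae_restrict_mem measurableSet_Ioo
  rw [R.μ_eq]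
  filter_upwards [Measure.quasiMeasurePreserving_fst.ae (h (s := R.a) (t := R.b)),
    Measure.quasiMeasurePreserving_snd.ae (h (s := R.c) (t := R.d))] with w h1 h2
  exact ⟨h1, h2⟩

/-- The fundamental lemma of the calculus of variations on the open rectangle, whose boundary is a
null set. -/
theorem IsWeakDeriv.unique {i j : ℕ} {f g g' : L2 R} (h : IsWeakDeriv R i j f g)
    (h' : IsWeakDeriv R i j f g') : g = g' := by
  rw [← sub_eq_zero]
  have hi : Integrable (g - g' : L2 R) R.μ := (Lp.memLp _).integrable (by norm_num)
  have key := (isOpen_Ioo.prod isOpen_Ioo).ae_eq_zero_of_integral_contDiff_smul_eq_zero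
    (U := Ioo R.a R.b ×ˢ Ioo R.c R.d) (μ := R.μ) (f := (g - g' : L2 R))
    (hi.locallyIntegrable.locallyIntegrableOn _) fun φ h1 h2 h3 => by
      have hφ : IsTest R φ := ⟨h1, h2, h3⟩
      have e := (h φ hφ).symm.trans (h' φ hφ)
      have e' := mul_left_cancel₀ (pow_ne_zero _ (by norm_num)) e
      have a : ∫ z, φ z • (g - g' : L2 R) z ∂(R.μ) = ∫ z, (g z * φ z - g' z * φ z) ∂(R.μ) := by
        refine integral_congr_ae ?_
        filter_upwards [Lp.coeFn_sub g g'] with z hz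
        simp only [hz, Pi.sub_apply, smul_eq_mul]
        ring
      rw [a, integral_sub (integrable_mul_cont R g h1.continuous)
        (integrable_mul_cont R g' h1.continuous), e', sub_self]
  refine Lp.ext ?_
  filter_upwards [key, ae_mem_open_rect, Lp.coeFn_zero ℝ 2 R.μ] with z h1 h2 h3
  rw [h1 h2, h3]
  rfl

end Weak

/-! ### Continuous representatives and traces -/

section Traces

variable {R : Rect}

/-- `F` is a representative of `f` that is continuous on the closed rectangle. -/
def ContRep (f : L2 R) (F : ℝ × ℝ → ℝ) : Prop :=
  F =ᵐ[R.μ] f ∧ ContinuousOn F (Icc R.a R.b ×ˢ Icc R.c R.d)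

theorem ContRep.hasValue {f : L2 R} {F : ℝ × ℝ → ℝ} (h : ContRep f F) (z : ℝ × ℝ) :
    HasValue R f z (F z) := ⟨F, h.1, h.2, rfl⟩

theorem ContRep.add {f g : L2 R} {F G : ℝ × ℝ → ℝ} (hf : ContRep f F) (hg : ContRep g G) :
    ContRep (f + g) (fun z => F z + G z) :=
  ⟨(hf.1.add hg.1).trans (Lp.coeFn_add f g).symm, hf.2.add hg.2⟩

theorem ContRep.smul {f : L2 R} {F : ℝ × ℝ → ℝ} (r : ℝ) (hf : ContRep f F) :
    ContRep (r • f) (fun z => r * F z) :=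
  ⟨(hf.1.const_smul r).trans (Lp.coeFn_smul r f).symm, continuousOn_const.mul hf.2⟩

theorem ContRep.congr {f : L2 R} {F G : ℝ × ℝ → ℝ} (hf : ContRep f F)
    (h : ∀ z ∈ Icc R.a R.b ×ˢ Icc R.c R.d, G z = F z) : ContRep f G :=
  ⟨Filter.EventuallyEq.trans (by filter_upwards [ae_mem_rect] with z hz using h z hz) hf.1,
    hf.2.congr h⟩

theorem contRep_Ix_Iy (f : L2 R) : ContRep (Ix R (Iy R f)) (dprim R f) :=
  ⟨(coeFn_Ix_Iy f).symm, (continuous_dprim f).continuousOn⟩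

/-- `f` is the product of a function of `x` and a function of `y`. -/
def Tens (f : L2 R) (p q : ℝ → ℝ) : Prop := f =ᵐ[R.μ] fun z => p z.1 * q z.2

theorem Tens.Ix {f : L2 R} {p q : ℝ → ℝ} (h : Tens f p q) : Tens (Ix R f) (prim R.μx p) q := by
  refine (coeFn_Ix h).trans (Filter.Eventually.of_forall fun z => ?_)
  simp only [prim, ← mul_assoc, integral_mul_const]

theorem Tens.Iy {f : L2 R} {p q : ℝ → ℝ} (h : Tens f p q) : Tens (Iy R f) p (prim R.μy q) := by
  refine (coeFn_Iy h).trans (Filter.Eventually.of_forall fun z => ?_)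
  simp only [prim, mul_left_comm _ (p z.1), integral_const_mul]

theorem tens_one : Tens (one R) (fun _ => 1) (fun _ => 1) := by
  simpa [Tens] using coeFn_one

theorem tens_ex (p : Lp ℝ 2 R.μx) : Tens (ex R p) p (fun _ => 1) := by
  simpa [Tens] using coeFn_ex p

theorem tens_ey (p : Lp ℝ 2 R.μy) : Tens (ey R p) (fun _ => 1) p := by
  simpa [Tens] using coeFn_ey p

theorem Tens.contRep {f : L2 R} {p q : ℝ → ℝ} (h : Tens f p q)
    (hp : ContinuousOn p (Icc R.a R.b)) (hq : ContinuousOn q (Icc R.c R.d)) :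
    ContRep f (fun z => p z.1 * q z.2) :=
  ⟨h.symm, (hp.comp continuousOn_fst fun _ h => h.1).mul (hq.comp continuousOn_snd fun _ h => h.2)⟩

theorem continuousOn_prim {s t : ℝ} {g : ℝ → ℝ} (hg : MemLp g 2 (volume.restrict (Icc s t))) :
    ContinuousOn (prim (volume.restrict (Icc s t)) g) (Icc s t) :=
  (continuous_prim (hg.integrable (by norm_num))).continuousOn

theorem memLp_prim {s t : ℝ} {g : ℝ → ℝ} (hg : MemLp g 2 (volume.restrict (Icc s t))) :
    MemLp (prim (volume.restrict (Icc s t)) g) 2 (volume.restrict (Icc s t)) :=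
  (memLp_top_of_continuous_Icc (continuous_prim (hg.integrable (by norm_num)))).mono_exponent le_top

theorem HasTraceY.add {f g : L2 R} {s : ℝ} {u w : ℝ → ℝ} (hf : HasTraceY R f s u)
    (hg : HasTraceY R g s w) : HasTraceY R (f + g) s (fun x => u x + w x) := by
  obtain ⟨F, h1, h2⟩ := hf
  obtain ⟨G, h3, h4⟩ := hg
  refine ⟨F + G, (h1.add h3).trans (Lp.coeFn_add f g).symm, ?_⟩
  filter_upwards [h2, h4] with x hx hx'
  exact ⟨hx.1.add hx'.1, by simp [hx.2, hx'.2]⟩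

theorem HasTraceX.add {f g : L2 R} {s : ℝ} {u w : ℝ → ℝ} (hf : HasTraceX R f s u)
    (hg : HasTraceX R g s w) : HasTraceX R (f + g) s (fun x => u x + w x) := by
  obtain ⟨F, h1, h2⟩ := hf
  obtain ⟨G, h3, h4⟩ := hg
  refine ⟨F + G, (h1.add h3).trans (Lp.coeFn_add f g).symm, ?_⟩
  filter_upwards [h2, h4] with x hx hx'
  exact ⟨hx.1.add hx'.1, by simp [hx.2, hx'.2]⟩

theorem HasTraceY.congr {f : L2 R} {s : ℝ} {u w : ℝ → ℝ} (hf : HasTraceY R f s u)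
    (h : ∀ᵐ x ∂(R.μx), w x = u x) : HasTraceY R f s w := by
  obtain ⟨F, h1, h2⟩ := hf
  refine ⟨F, h1, ?_⟩
  filter_upwards [h2, h] with x hx hx'
  exact ⟨hx.1, hx.2.trans hx'.symm⟩

theorem HasTraceX.congr {f : L2 R} {s : ℝ} {u w : ℝ → ℝ} (hf : HasTraceX R f s u)
    (h : ∀ᵐ x ∂(R.μy), w x = u x) : HasTraceX R f s w := by
  obtain ⟨F, h1, h2⟩ := hf
  refine ⟨F, h1, ?_⟩
  filter_upwards [h2, h] with x hx hx'
  exact ⟨hx.1, hx.2.trans hx'.symm⟩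

theorem Tens.hasTraceY {f : L2 R} {p q : ℝ → ℝ} (h : Tens f p q)
    (hq : ContinuousOn q (Icc R.c R.d)) (s : ℝ) : HasTraceY R f s (fun x => p x * q s) :=
  ⟨_, h.symm, Filter.Eventually.of_forall fun x =>
    ⟨(continuousOn_const (c := p x)).mul hq, rfl⟩⟩

theorem Tens.hasTraceX {f : L2 R} {p q : ℝ → ℝ} (h : Tens f p q)
    (hp : ContinuousOn p (Icc R.a R.b)) (s : ℝ) : HasTraceX R f s (fun y => p s * q y) :=
  ⟨_, h.symm, Filter.Eventually.of_forall fun y =>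
    ⟨hp.mul (continuousOn_const (c := q y)), rfl⟩⟩

/-- Almost every vertical slice of `f` is square integrable, so its primitive is continuous in `y`.
-/
theorem hasTraceY_Iy (f : L2 R) (s : ℝ) :
    HasTraceY R (Iy R f) s (fun x => prim R.μy (fun ν => f (x, ν)) s) := by
  refine ⟨_, (coeFn_Iy (Filter.EventuallyEq.refl _ f)).symm, ?_⟩
  filter_upwards [MemLp.slice_fst (Lp.memLp f)] with x hx
  exact ⟨continuousOn_prim hx, rfl⟩

theorem hasTraceX_Ix (f : L2 R) (s : ℝ) :
    HasTraceX R (Ix R f) s (fun y => prim R.μx (fun θ => f (θ, y)) s) := by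
  refine ⟨_, (coeFn_Ix (Filter.EventuallyEq.refl _ f)).symm, ?_⟩
  filter_upwards [MemLp.slice_snd (Lp.memLp f)] with x hx
  exact ⟨continuousOn_prim hx, rfl⟩

theorem ae_ae_fst {P : ℝ × ℝ → Prop} (h : ∀ᵐ z ∂(R.μ), P z) :
    ∀ᵐ x ∂(R.μx), ∀ᵐ y ∂(R.μy), P (x, y) := by
  rw [R.μ_eq] at h
  exact Measure.ae_ae_of_ae_prod h

theorem ae_ae_snd {P : ℝ × ℝ → Prop} (h : ∀ᵐ z ∂(R.μ), P z) :
    ∀ᵐ y ∂(R.μy), ∀ᵐ x ∂(R.μx), P (x, y) := by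
  rw [R.μ_eq] at h
  exact Measure.ae_ae_of_ae_prod (Measure.measurePreserving_swap.quasiMeasurePreserving.ae h)

theorem hasTraceY_Iy_Iy (f : L2 R) {s : ℝ} (hs : s ∈ Icc R.c R.d) :
    HasTraceY R (Iy R (Iy R f)) s (fun x => ∫ ν, ramp s ν * f (x, ν) ∂(R.μy)) := by
  refine (hasTraceY_Iy _ s).congr ?_
  filter_upwards [ae_ae_fst (coeFn_Iy (Filter.EventuallyEq.refl _ f)),
    MemLp.slice_fst (Lp.memLp f)] with x hx hx'
  rw [← integral_chi_prim hs hx']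
  exact integral_congr_ae (by filter_upwards [hx] with ν hν; rw [hν])

theorem hasTraceX_Ix_Ix (f : L2 R) {s : ℝ} (hs : s ∈ Icc R.a R.b) :
    HasTraceX R (Ix R (Ix R f)) s (fun y => ∫ θ, ramp s θ * f (θ, y) ∂(R.μx)) := by
  refine (hasTraceX_Ix _ s).congr ?_
  filter_upwards [ae_ae_snd (coeFn_Ix (Filter.EventuallyEq.refl _ f)),
    MemLp.slice_snd (Lp.memLp f)] with x hx hx'
  rw [← integral_chi_prim hs hx']
  exact integral_congr_ae (by filter_upwards [hx] with ν hν; rw [hν])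

end Traces

end PIE2D

end

noncomputable section

namespace PIE2D

/-! ### Functions with prescribed core boundary data and highest derivative -/

section Data

variable {R : Rect}

/-- The second primitive on an interval. -/
def prim2 (m : Measure ℝ) (g : ℝ → ℝ) (x : ℝ) : ℝ := ∫ θ, ramp x θ * g θ ∂m

/-- The integral of `f` with the product weight `g(x) h(y)`. -/
def wint (R : Rect) (g h : ℝ → ℝ) (f : ℝ × ℝ → ℝ) : ℝ := ∫ w, g w.1 * h w.2 * f w ∂(R.μ)

/-- The element of `H₁` with value `α` at `(a,c)`, derivatives `p` on `y = c` and `q` on `x = a`,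
and mixed derivative `v`. -/
def sobOne (α : ℝ) (p : Lp ℝ 2 R.μx) (q : Lp ℝ 2 R.μy) (v : L2 R) : L2 R :=
  α • one R + Ix R (ex R p) + Iy R (ey R q) + Ix R (Iy R v)

/-- The function of `x` with value `α` and derivative `β` at `a`, and second derivative `p`. -/
def edgeX (α : ℝ) (p : Lp ℝ 2 R.μx) : L2 R := α • one R + Ix R (ex R p)

/-- The function of `y` with value `α` at `c`, and derivative `q`. -/
def edgeY (α : ℝ) (q : Lp ℝ 2 R.μy) : L2 R := α • one R + Iy R (ey R q)

theorem onlyX_edgeX (α : ℝ) (p : Lp ℝ 2 R.μx) : OnlyX (edgeX α p) :=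
  (onlyX_one.smul α).add (onlyX_ex p).Ix

theorem onlyY_edgeY (α : ℝ) (q : Lp ℝ 2 R.μy) : OnlyY (edgeY α q) :=
  (onlyY_one.smul α).add (onlyY_ey q).Iy

variable (α₀ α₁ α₂ α₃ : ℝ) (p p₁ p₂ : Lp ℝ 2 R.μx) (q q₁ q₂ : Lp ℝ 2 R.μy) (v : L2 R)

/-- The part free of `x` is separated from an x-primitive, so the weak x-derivative is the argument
of `Ix`. The companion identities do the same for `y` and for the derivatives of `sobTwo`. -/
theorem sobOne_eq_x : sobOne α₀ p q v = edgeY α₀ q + Ix R (ex R p + Iy R v) := by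
  simp only [sobOne, edgeY, map_add]
  abel

theorem sobOne_eq_y : sobOne α₀ p q v = edgeX α₀ p + Iy R (ey R q + Ix R v) := by
  simp only [sobOne, edgeX, map_add, Iy_Ix]
  abel

/-- The derivatives in `x` of an element of `H₂` with mixed derivative `u` of order `(1,1)`. -/
def sobTwoX (u : L2 R) : L2 R := edgeX α₁ p₁ + Iy R u

/-- The derivatives in `y` of an element of `H₂` with mixed derivative `u` of order `(1,1)`. -/
def sobTwoY (u : L2 R) : L2 R := edgeY α₂ q₁ + Ix R u

/-- The element of `H₂` with core boundary data `αᵢ, pᵢ, qᵢ` and highest derivative `v`. -/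
def sobTwo : L2 R :=
  α₀ • one R + Iy R (edgeY α₂ q₁) + Ix R (sobTwoX α₁ p₁ (sobOne α₃ p₂ q₂ v))

theorem sobTwo_eq_y : sobTwo α₀ α₁ α₂ α₃ p₁ p₂ q₁ q₂ v
    = α₀ • one R + Ix R (edgeX α₁ p₁) + Iy R (sobTwoY α₂ q₁ (sobOne α₃ p₂ q₂ v)) := by
  simp only [sobTwo, sobTwoX, sobTwoY, map_add, Iy_Ix]
  abel

theorem sobTwoX_eq : sobTwoX α₁ p₁ (sobOne α₃ p₂ q₂ v)
    = α₁ • one R + Iy R (edgeY α₃ q₂) + Ix R (ex R p₁ + Iy R (ex R p₂ + Iy R v)) := by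
  simp only [sobTwoX, edgeX, sobOne_eq_x, map_add, Iy_Ix]
  abel

theorem sobTwoY_eq : sobTwoY α₂ q₁ (sobOne α₃ p₂ q₂ v)
    = α₂ • one R + Ix R (edgeX α₃ p₂) + Iy R (ey R q₁ + Ix R (ey R q₂ + Ix R v)) := by
  simp only [sobTwoY, edgeY, sobOne_eq_y, map_add, Iy_Ix]
  abel

theorem isWeakDeriv_sobOne :
    IsWeakDeriv R 1 0 (sobOne α₀ p q v) (ex R p + Iy R v) ∧
    IsWeakDeriv R 0 1 (sobOne α₀ p q v) (ey R q + Ix R v) ∧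
    IsWeakDeriv R 1 1 (sobOne α₀ p q v) v := by
  have hx : WDx (sobOne α₀ p q v) (ex R p + Iy R v) := by
    rw [sobOne_eq_x]
    exact (onlyY_edgeY _ _).wdx_add_Ix _
  have hy : WDy (sobOne α₀ p q v) (ey R q + Ix R v) := by
    rw [sobOne_eq_y]
    exact (onlyX_edgeX _ _).wdy_add_Iy _
  have hxy : WDy (ex R p + Iy R v) v := (onlyX_ex p).wdy_add_Iy v
  exact ⟨hx.isWeakDeriv (isWeakDeriv_refl _), hy.isWeakDeriv (isWeakDeriv_refl _),
    hx.isWeakDeriv (hxy.isWeakDeriv (isWeakDeriv_refl _))⟩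

/-- The weak derivatives of `sobTwo`. -/
def derivTwo : Fin 3 → Fin 3 → L2 R :=
  ![![sobTwo α₀ α₁ α₂ α₃ p₁ p₂ q₁ q₂ v, sobTwoY α₂ q₁ (sobOne α₃ p₂ q₂ v),
      ey R q₁ + Ix R (ey R q₂ + Ix R v)],
    ![sobTwoX α₁ p₁ (sobOne α₃ p₂ q₂ v), sobOne α₃ p₂ q₂ v, ey R q₂ + Ix R v],
    ![ex R p₁ + Iy R (ex R p₂ + Iy R v), ex R p₂ + Iy R v, v]]

/-- The weak derivatives of `sobOne`. -/
def derivOne : Fin 2 → Fin 2 → L2 R :=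
  ![![sobOne α₀ p q v, ey R q + Ix R v], ![ex R p + Iy R v, v]]

theorem isWeakDeriv_derivOne (i j : Fin 2) :
    IsWeakDeriv R i j (derivOne α₀ p q v 0 0) (derivOne α₀ p q v i j) := by
  obtain ⟨h1, h2, h3⟩ := isWeakDeriv_sobOne α₀ p q v
  fin_cases i <;> fin_cases j
  exacts [isWeakDeriv_refl _, h2, h1, h3]

/-- Every first-order step in the table is an instance of `wdx_add_Ix` or `wdy_add_Iy` after
suitable regrouping. Higher derivatives are reached by chains that take all x-steps first. -/
theorem isWeakDeriv_derivTwo (i j : Fin 3) :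
    IsWeakDeriv R i j (derivTwo α₀ α₁ α₂ α₃ p₁ p₂ q₁ q₂ v 0 0)
      (derivTwo α₀ α₁ α₂ α₃ p₁ p₂ q₁ q₂ v i j) := by
  have x0 : WDx (sobTwo α₀ α₁ α₂ α₃ p₁ p₂ q₁ q₂ v) (sobTwoX α₁ p₁ (sobOne α₃ p₂ q₂ v)) :=
    ((onlyY_one.smul α₀).add (onlyY_edgeY α₂ q₁).Iy).wdx_add_Ix _
  have x1 : WDx (sobTwoX α₁ p₁ (sobOne α₃ p₂ q₂ v)) (ex R p₁ + Iy R (ex R p₂ + Iy R v)) := by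
    rw [sobTwoX_eq]
    exact ((onlyY_one.smul α₁).add (onlyY_edgeY α₃ q₂).Iy).wdx_add_Ix _
  have y00 : WDy (sobTwo α₀ α₁ α₂ α₃ p₁ p₂ q₁ q₂ v) (sobTwoY α₂ q₁ (sobOne α₃ p₂ q₂ v)) := by
    rw [sobTwo_eq_y]
    exact ((onlyX_one.smul α₀).add (onlyX_edgeX α₁ p₁).Ix).wdy_add_Iy _
  have y01 : WDy (sobTwoY α₂ q₁ (sobOne α₃ p₂ q₂ v)) (ey R q₁ + Ix R (ey R q₂ + Ix R v)) := by
    rw [sobTwoY_eq]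
    exact ((onlyX_one.smul α₂).add (onlyX_edgeX α₃ p₂).Ix).wdy_add_Iy _
  have y10 : WDy (sobTwoX α₁ p₁ (sobOne α₃ p₂ q₂ v)) (sobOne α₃ p₂ q₂ v) :=
    (onlyX_edgeX α₁ p₁).wdy_add_Iy _
  have y11 : WDy (sobOne α₃ p₂ q₂ v) (ey R q₂ + Ix R v) := by
    rw [sobOne_eq_y]
    exact (onlyX_edgeX _ _).wdy_add_Iy _
  have y20 : WDy (ex R p₁ + Iy R (ex R p₂ + Iy R v)) (ex R p₂ + Iy R v) :=
    (onlyX_ex p₁).wdy_add_Iy _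
  have y21 : WDy (ex R p₂ + Iy R v) v := (onlyX_ex p₂).wdy_add_Iy _
  have r := fun f : L2 R => isWeakDeriv_refl f
  fin_cases i <;> fin_cases j
  exacts [r _, y00.isWeakDeriv (r _), y00.isWeakDeriv (y01.isWeakDeriv (r _)),
    x0.isWeakDeriv (r _), x0.isWeakDeriv (y10.isWeakDeriv (r _)),
    x0.isWeakDeriv (y10.isWeakDeriv (y11.isWeakDeriv (r _))),
    x0.isWeakDeriv (x1.isWeakDeriv (r _)), x0.isWeakDeriv (x1.isWeakDeriv (y20.isWeakDeriv (r _))),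
    x0.isWeakDeriv (x1.isWeakDeriv (y20.isWeakDeriv (y21.isWeakDeriv (r _))))]

/-! Values. -/

theorem contRep_one : ContRep (one R) fun _ => 1 :=
  (tens_one.contRep continuousOn_const continuousOn_const).congr fun _ _ => by simp

theorem contRep_Ix_one : ContRep (Ix R (one R)) fun z => z.1 - R.a := by
  refine (tens_one.Ix.contRep (continuousOn_prim (memLp_const 1)) continuousOn_const).congr ?_
  intro z hz
  rw [prim_one hz.1, mul_one]

theorem contRep_Iy_one : ContRep (Iy R (one R)) fun z => z.2 - R.c := by
  refine (tens_one.Iy.contRep continuousOn_const (continuousOn_prim (memLp_const 1))).congr ?_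
  intro z hz
  rw [prim_one hz.2, one_mul]

theorem contRep_Ix_ex : ContRep (Ix R (ex R p)) fun z => prim R.μx p z.1 :=
  ((tens_ex p).Ix.contRep (continuousOn_prim (Lp.memLp p)) continuousOn_const).congr
    fun _ _ => by simp

theorem contRep_Iy_ey : ContRep (Iy R (ey R q)) fun z => prim R.μy q z.2 :=
  ((tens_ey q).Iy.contRep continuousOn_const (continuousOn_prim (Lp.memLp q))).congr
    fun _ _ => by simp

theorem contRep_sobOne : ContRep (sobOne α₀ p q v) fun z =>
    α₀ + prim R.μx p z.1 + prim R.μy q z.2 + wint R (chi z.1) (chi z.2) v :=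
  ((((contRep_one.smul α₀).add (contRep_Ix_ex p)).add (contRep_Iy_ey q)).add
    (contRep_Ix_Iy v)).congr fun z _ => by simp [dprim, wint]

theorem contRep_Ix_Ix_ex : ContRep (Ix R (Ix R (ex R p))) fun z => prim2 R.μx p z.1 := by
  refine ((tens_ex p).Ix.Ix.contRep (continuousOn_prim (memLp_prim (Lp.memLp p)))
    continuousOn_const).congr ?_
  intro z hz
  rw [mul_one, integral_chi_prim hz.1 (Lp.memLp p), prim2]

theorem contRep_Iy_Iy_ey : ContRep (Iy R (Iy R (ey R q))) fun z => prim2 R.μy q z.2 := by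
  refine ((tens_ey q).Iy.Iy.contRep continuousOn_const
    (continuousOn_prim (memLp_prim (Lp.memLp q)))).congr ?_
  intro z hz
  rw [one_mul, integral_chi_prim hz.2 (Lp.memLp q), prim2]

theorem contRep_Iy_sobOne : ContRep (Iy R (sobOne α₃ p₂ q₂ v)) fun z =>
    α₃ * (z.2 - R.c) + prim R.μx p₂ z.1 * (z.2 - R.c) + prim2 R.μy q₂ z.2
      + wint R (chi z.1) (ramp z.2) v := by
  have h1 := (tens_ex p₂).Ix.Iy.contRep (continuousOn_prim (Lp.memLp p₂))
    (continuousOn_prim (memLp_const 1))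
  simp only [sobOne, map_add, map_smul, Iy_Ix (Iy R v)]
  refine ((((contRep_Iy_one.smul α₃).add h1).add (contRep_Iy_Iy_ey q₂)).add
    (contRep_Ix_Iy (Iy R v))).congr fun z hz => ?_
  rw [prim_one hz.2, dprim_Iy v hz, wint]

theorem contRep_Ix_sobOne : ContRep (Ix R (sobOne α₃ p₂ q₂ v)) fun z =>
    α₃ * (z.1 - R.a) + prim2 R.μx p₂ z.1 + (z.1 - R.a) * prim R.μy q₂ z.2
      + wint R (ramp z.1) (chi z.2) v := by
  have h1 := (tens_ey q₂).Iy.Ix.contRep (continuousOn_prim (memLp_const 1))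
    (continuousOn_prim (Lp.memLp q₂))
  have h2 := contRep_Ix_Iy (Ix R v)
  rw [Iy_Ix] at h2
  simp only [sobOne, map_add, map_smul]
  refine ((((contRep_Ix_one.smul α₃).add (contRep_Ix_Ix_ex p₂)).add h1).add h2).congr
    fun z hz => ?_
  rw [prim_one hz.1, dprim_Ix v hz, wint]

theorem contRep_sobTwoX : ContRep (sobTwoX α₁ p₁ (sobOne α₃ p₂ q₂ v)) fun z =>
    α₁ + α₃ * (z.2 - R.c) + prim R.μx p₁ z.1 + prim R.μx p₂ z.1 * (z.2 - R.c)
      + prim2 R.μy q₂ z.2 + wint R (chi z.1) (ramp z.2) v :=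
  ((((contRep_one.smul α₁).add (contRep_Ix_ex p₁))).add
    (contRep_Iy_sobOne α₃ p₂ q₂ v)).congr fun z _ => by ring

theorem contRep_sobTwoY : ContRep (sobTwoY α₂ q₁ (sobOne α₃ p₂ q₂ v)) fun z =>
    α₂ + α₃ * (z.1 - R.a) + prim R.μy q₁ z.2 + (z.1 - R.a) * prim R.μy q₂ z.2
      + prim2 R.μx p₂ z.1 + wint R (ramp z.1) (chi z.2) v :=
  ((((contRep_one.smul α₂).add (contRep_Iy_ey q₁))).add
    (contRep_Ix_sobOne α₃ p₂ q₂ v)).congr fun z _ => by ring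

theorem contRep_sobTwo : ContRep (sobTwo α₀ α₁ α₂ α₃ p₁ p₂ q₁ q₂ v) fun z =>
    α₀ + α₁ * (z.1 - R.a) + α₂ * (z.2 - R.c) + α₃ * ((z.2 - R.c) * (z.1 - R.a))
      + prim2 R.μx p₁ z.1 + prim2 R.μx p₂ z.1 * (z.2 - R.c)
      + prim2 R.μy q₁ z.2 + (z.1 - R.a) * prim2 R.μy q₂ z.2
      + wint R (ramp z.1) (ramp z.2) v := by
  -- Reordering the primitives makes every boundary term a tensor product of one-variable primitives
  -- and leaves an outer `Ix ∘ Iy` on the `v` term, all of which have known continuous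
  -- representatives.
  have h1 : Ix R (Iy R (sobOne α₃ p₂ q₂ v)) = α₃ • Ix R (Iy R (one R))
      + Iy R (Ix R (Ix R (ex R p₂))) + Ix R (Iy R (Iy R (ey R q₂)))
      + Ix R (Iy R (Ix R (Iy R v))) := by
    simp only [sobOne, map_add, map_smul, Iy_Ix]
  have t1 := tens_one.Iy.Ix.contRep (R := R) (continuousOn_prim (memLp_const 1))
    (continuousOn_prim (memLp_const 1))
  have t2 := (tens_ex p₂).Ix.Ix.Iy.contRep (continuousOn_prim (memLp_prim (Lp.memLp p₂)))
    (continuousOn_prim (memLp_const 1))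
  have t3 := (tens_ey q₂).Iy.Iy.Ix.contRep (continuousOn_prim (memLp_const 1))
    (continuousOn_prim (memLp_prim (Lp.memLp q₂)))
  have t4 := contRep_Ix_Iy (Ix R (Iy R v))
  simp only [sobTwo, sobTwoX, edgeX, edgeY, map_add, map_smul]
  rw [h1]
  refine ((((contRep_one.smul α₀).add
    ((contRep_Iy_one.smul α₂).add (contRep_Iy_Iy_ey q₁))).add
    (((contRep_Ix_one.smul α₁).add (contRep_Ix_Ix_ex p₁)).add
      ((((t1.smul α₃).add t2).add t3).add t4)))).congr fun z hz => ?_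
  rw [prim_one hz.1, prim_one hz.2, dprim_Ix_Iy v hz, integral_chi_prim hz.1 (Lp.memLp p₂),
    integral_chi_prim hz.2 (Lp.memLp q₂), wint, prim2, prim2, prim2, prim2]
  ring

/-! Traces. -/

theorem hasTraceY_ex_add_Iy (s : ℝ) : HasTraceY R (ex R p + Iy R v) s
    fun x => p x + prim R.μy (fun ν => v (x, ν)) s :=
  (((tens_ex p).hasTraceY continuousOn_const s).add (hasTraceY_Iy v s)).congr
    (Filter.Eventually.of_forall fun x => by simp)

theorem hasTraceX_ey_add_Ix (s : ℝ) : HasTraceX R (ey R q + Ix R v) s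
    fun y => q y + prim R.μx (fun θ => v (θ, y)) s :=
  (((tens_ey q).hasTraceX continuousOn_const s).add (hasTraceX_Ix v s)).congr
    (Filter.Eventually.of_forall fun x => by simp)

theorem hasTraceY_two {s : ℝ} (hs : s ∈ Icc R.c R.d) :
    HasTraceY R (ex R p₁ + Iy R (ex R p₂ + Iy R v)) s
      fun x => p₁ x + p₂ x * (s - R.c) + prim2 R.μy (fun ν => v (x, ν)) s := by
  rw [map_add, ← add_assoc]
  refine ((((tens_ex p₁).hasTraceY continuousOn_const s).add
    ((tens_ex p₂).Iy.hasTraceY (continuousOn_prim (memLp_const 1)) s)).add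
    (hasTraceY_Iy_Iy v hs)).congr (Filter.Eventually.of_forall fun x => ?_)
  simp [prim_one hs, prim2]

theorem hasTraceX_two {s : ℝ} (hs : s ∈ Icc R.a R.b) :
    HasTraceX R (ey R q₁ + Ix R (ey R q₂ + Ix R v)) s
      fun y => q₁ y + q₂ y * (s - R.a) + prim2 R.μx (fun θ => v (θ, y)) s := by
  rw [map_add, ← add_assoc]
  refine ((((tens_ey q₁).hasTraceX continuousOn_const s).add
    ((tens_ey q₂).Ix.hasTraceX (continuousOn_prim (memLp_const 1)) s)).add
    (hasTraceX_Ix_Ix v hs)).congr (Filter.Eventually.of_forall fun x => ?_)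
  simp [prim_one hs, prim2, mul_comm]

end Data

/-! ### Bounded families of elements of Sobolev spaces -/

section Build

variable {R : Rect} {V : Type*} [NormedAddCommGroup V] [NormedSpace ℝ V]

/-- The operator into `H_k` given by the operators `D i j` for the weak derivatives. -/
def sobOf {k : ℕ} (D : Fin (k + 1) → Fin (k + 1) → V →L[ℝ] L2 R)
    (h : ∀ (x : V) (i j : Fin (k + 1)), IsWeakDeriv R i j (D 0 0 x) (D i j x)) : V →L[ℝ] Sob R k :=
  ContinuousLinearMap.codRestrict
    ((PiLp.continuousLinearEquiv 1 ℝ fun _ : Fin (k + 1) × Fin (k + 1) => L2 R).symm.toContinuousLinearMap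
      ∘L ContinuousLinearMap.pi fun α => D α.1 α.2) (Sob R k) fun x α => h x α.1 α.2

/-- The weak derivative as a bounded operator. -/
def DvL {k : ℕ} (i j : Fin (k + 1)) : Sob R k →L[ℝ] L2 R :=
  ContinuousLinearMap.proj (i, j)
    ∘L (PiLp.continuousLinearEquiv 1 ℝ fun _ : Fin (k + 1) × Fin (k + 1) => L2 R).toContinuousLinearMap
    ∘L (Sob R k).subtypeL

/-- The stored family of weak derivatives is determined by its member of index `(0, 0)`. -/
theorem Sob.ext_of_Dv {k : ℕ} {u u' : Sob R k} (h : Dv u 0 0 = Dv u' 0 0) : u = u' := by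
  refine Subtype.ext (PiLp.ext fun α => ?_)
  have h1 := u.2 α
  have h2 := u'.2 α
  change u.1 (0, 0) = u'.1 (0, 0) at h
  rw [← h] at h2
  exact h1.unique h2

variable (α₀ α₁ α₂ α₃ : V →L[ℝ] ℝ) (p p₁ p₂ : V →L[ℝ] Lp ℝ 2 R.μx) (q q₁ q₂ : V →L[ℝ] Lp ℝ 2 R.μy)
  (v : V →L[ℝ] L2 R)

/-- `sobOne` as an operator. -/
def sobOneL : V →L[ℝ] L2 R :=
  α₀.smulRight (one R) + Ix R ∘L ex R ∘L p + Iy R ∘L ey R ∘L q + Ix R ∘L Iy R ∘L v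

/-- `derivOne` as a family of operators. -/
def derivOneL : Fin 2 → Fin 2 → V →L[ℝ] L2 R :=
  ![![sobOneL α₀ p q v, ey R ∘L q + Ix R ∘L v], ![ex R ∘L p + Iy R ∘L v, v]]

theorem derivOneL_apply (x : V) (i j : Fin 2) :
    derivOneL α₀ p q v i j x = derivOne (α₀ x) (p x) (q x) (v x) i j := by
  fin_cases i <;> fin_cases j <;> rfl

/-- `derivTwo` as a family of operators. -/
def derivTwoL : Fin 3 → Fin 3 → V →L[ℝ] L2 R :=
  let u := sobOneL α₃ p₂ q₂ v
  let eX := α₁.smulRight (one R) + Ix R ∘L ex R ∘L p₁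
  let eY := α₂.smulRight (one R) + Iy R ∘L ey R ∘L q₁
  ![![α₀.smulRight (one R) + Iy R ∘L eY + Ix R ∘L (eX + Iy R ∘L u), eY + Ix R ∘L u,
      ey R ∘L q₁ + Ix R ∘L (ey R ∘L q₂ + Ix R ∘L v)],
    ![eX + Iy R ∘L u, u, ey R ∘L q₂ + Ix R ∘L v],
    ![ex R ∘L p₁ + Iy R ∘L (ex R ∘L p₂ + Iy R ∘L v), ex R ∘L p₂ + Iy R ∘L v, v]]

theorem derivTwoL_apply (x : V) (i j : Fin 3) :
    derivTwoL α₀ α₁ α₂ α₃ p₁ p₂ q₁ q₂ v i j x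
      = derivTwo (α₀ x) (α₁ x) (α₂ x) (α₃ x) (p₁ x) (p₂ x) (q₁ x) (q₂ x) (v x) i j := by
  fin_cases i <;> fin_cases j <;> rfl

/-- The operator into `H₁` with given core boundary data and highest derivative. -/
def toSobOne : V →L[ℝ] Sob R 1 :=
  sobOf (derivOneL α₀ p q v) fun x i j => by
    simp only [derivOneL_apply]
    exact isWeakDeriv_derivOne _ _ _ _ i j

/-- The operator into `H₂` with given core boundary data and highest derivative. -/
def toSobTwo : V →L[ℝ] Sob R 2 :=
  sobOf (derivTwoL α₀ α₁ α₂ α₃ p₁ p₂ q₁ q₂ v) fun x i j => by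
    simp only [derivTwoL_apply]
    exact isWeakDeriv_derivTwo _ _ _ _ _ _ _ _ _ i j

end Build

end PIE2D

end

noncomputable section

namespace PIE2D

open Matrix

/-! ### Block matrices acting on vectors -/

section Blocks

variable {k l m n : ℕ}

theorem bcol_mulVec (v : Fin k → ℝ) (f : Fin n → ℝ) (i : Fin k) (j : Fin n) :
    (bcol n v *ᵥ f) (i, j) = v i * f j := by
  simp [bcol, Matrix.mulVec, dotProduct, Matrix.one_apply]

theorem brow_mulVec (v : Fin k → ℝ) (f : Fin k × Fin n → ℝ) (j : Fin n) :
    (brow n v *ᵥ f) j = ∑ i, v i * f (i, j) := by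
  simp [brow, Matrix.mulVec, dotProduct, Matrix.one_apply, Fintype.sum_prod_type]

theorem bgrid_mulVec (M : Fin k → Matrix (Fin l) (Fin m) ℝ) (f : Fin m × Fin n → ℝ) (e : Fin k)
    (i : Fin l) (j : Fin n) : (bgrid n M *ᵥ f) (e, i, j) = ∑ r, M e i r * f (r, j) := by
  simp [bgrid, Matrix.mulVec, dotProduct, Matrix.one_apply, Fintype.sum_prod_type]

theorem bgcol_mulVec (v : Fin k → Fin l → ℝ) (f : Fin n → ℝ) (e : Fin k) (i : Fin l) (j : Fin n) :
    (bgcol n v *ᵥ f) (e, i, j) = v e i * f j := by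
  simp [bgcol, Matrix.mulVec, dotProduct, Matrix.one_apply]

end Blocks

/-! ### The map from the fundamental state to the state -/

section StateMap

variable {R : Rect} {n₀ n₁ n₂ : ℕ}

/-- The operator `𝓚₂ - 𝓚₁ P[G]` with values in `L₂ × H₁ × H₂`. -/
def stateMap {G : N021 (BC0 n₁ n₂) (BC1 n₁ n₂) (St n₀ n₁ n₂)} (hG : G.Mem R) :
    L2St R n₀ n₁ n₂ →L[ℝ] SobSt R n₀ n₁ n₂ :=
  ContinuousLinearMap.pi fun q => match q with
    | .inl k => sobOf (k := 0) (fun _ _ => ContinuousLinearMap.proj (Sum.inl k)) fun x i j => by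
        fin_cases i
        fin_cases j
        exact isWeakDeriv_refl _
    | .inr (.inl k) => toSobOne (-N021.clm0 hG (.inl k)) (-N021.clm1 hG (.inl k))
        (-N021.clm2 hG (.inl k)) (ContinuousLinearMap.proj (Sum.inr (Sum.inl k)))
    | .inr (.inr k) => toSobTwo (-N021.clm0 hG (.inr (0, k))) (-N021.clm0 hG (.inr (1, k)))
        (-N021.clm0 hG (.inr (2, k))) (-N021.clm0 hG (.inr (3, k)))
        (-N021.clm1 hG (.inr (0, k))) (-N021.clm1 hG (.inr (1, k)))
        (-N021.clm2 hG (.inr (0, k))) (-N021.clm2 hG (.inr (1, k)))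
        (ContinuousLinearMap.proj (Sum.inr (Sum.inr k)))

/-- The map `u ↦ (u₀, ∂ₓ∂ᵧu₁, ∂ₓ²∂ᵧ²u₂)`. -/
def topDeriv : SobSt R n₀ n₁ n₂ →L[ℝ] L2St R n₀ n₁ n₂ :=
  ContinuousLinearMap.pi fun q => DvL (Fin.last (reg q)) (Fin.last (reg q)) ∘L
    ContinuousLinearMap.proj q

variable {G : N021 (BC0 n₁ n₂) (BC1 n₁ n₂) (St n₀ n₁ n₂)} (hG : G.Mem R) (v : L2St R n₀ n₁ n₂)

/-- Holds by definition: the highest derivative stored by the construction is `v` itself. It yields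
injectivity of `𝓣` and a bounded left inverse. -/
theorem topDeriv_stateMap : topDeriv (stateMap hG v) = v := by
  funext q
  rcases q with k | k | k <;> rfl

theorem prim_neg_congr {m : Measure ℝ} {f g : ℝ → ℝ} (h : f =ᵐ[m] fun x => - g x) (x : ℝ) :
    prim m f x = - prim m g x := by
  rw [prim, prim, ← integral_neg]
  exact integral_congr_ae (by filter_upwards [h] with θ hθ; rw [hθ]; ring)

theorem prim2_neg_congr {m : Measure ℝ} {f g : ℝ → ℝ} (h : f =ᵐ[m] fun x => - g x) (x : ℝ) :
    prim2 m f x = - prim2 m g x := by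
  rw [prim2, prim2, ← integral_neg]
  exact integral_congr_ae (by filter_upwards [h] with θ hθ; rw [hθ]; ring)

theorem coeFn_neg_clm1 (i : BC1 n₁ n₂) : (-N021.clm1 hG i) v =ᵐ[R.μx]
    fun x => - (G.op R fun z j => v j z).2.1 x i := by
  rw [_root_.neg_apply]
  exact (Lp.coeFn_neg _).trans (N021.coeFn_clm1 hG i v).neg

theorem coeFn_neg_clm2 (i : BC1 n₁ n₂) : (-N021.clm2 hG i) v =ᵐ[R.μy]
    fun x => - (G.op R fun z j => v j z).2.2 x i := by
  rw [_root_.neg_apply]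
  exact (Lp.coeFn_neg _).trans (N021.coeFn_clm2 hG i v).neg

theorem neg_clm0_apply (i : BC0 n₁ n₂) : (-N021.clm0 hG i) v
    = - (G.op R fun z j => v j z).1 i := by
  rw [_root_.neg_apply, N021.clm0_apply]

/-- The last row of `K31` or `K32` applied to two edge functions is a combination of second
primitives, with a coefficient constant in the integration variable. -/
theorem integral_ramp_comb {s t x r : ℝ} {f g : ℝ → ℝ} (hf : MemLp f 2 (volume.restrict (Icc s t)))
    (hg : MemLp g 2 (volume.restrict (Icc s t))) :
    ∫ θ in Icc s t, chi x θ * ((x - θ) * f θ + r * (x - θ) * g θ)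
      = prim2 (volume.restrict (Icc s t)) f x + r * prim2 (volume.restrict (Icc s t)) g x := by
  have h : ∀ {f : ℝ → ℝ}, MemLp f 2 (volume.restrict (Icc s t)) →
      Integrable (fun θ => ramp x θ * f θ) (volume.restrict (Icc s t)) := fun hf =>
    MemLp.integrable (q := 2) (by norm_num) (hf.mul' (memLp_ramp x s t))
  rw [prim2, prim2, ← integral_const_mul, ← integral_add (h hf) ((h hg).const_mul r)]
  refine integral_congr_ae (Filter.Eventually.of_forall fun θ => ?_)
  simp only [ramp]
  ring

theorem contRep_stateMap_one (k : Fin n₁) :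
    ContRep (Dv (SobSt.one (stateMap hG v) k) 0 0) fun z =>
      wint R (chi z.1) (chi z.2) (v (.inr (.inl k))) - ((G.op R fun z j => v j z).1 (.inl k)
        + prim R.μx (fun θ => (G.op R fun z j => v j z).2.1 θ (.inl k)) z.1
        + prim R.μy (fun ν => (G.op R fun z j => v j z).2.2 ν (.inl k)) z.2) := by
  refine (contRep_sobOne ((-N021.clm0 hG (.inl k)) v) ((-N021.clm1 hG (.inl k)) v)
    ((-N021.clm2 hG (.inl k)) v) (v (.inr (.inl k)))).congr fun z hz => ?_
  rw [neg_clm0_apply, prim_neg_congr (coeFn_neg_clm1 hG v _),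
    prim_neg_congr (coeFn_neg_clm2 hG v _)]
  ring

theorem contRep_stateMap_two (k : Fin n₂) :
    ContRep (Dv (SobSt.two (stateMap hG v) k) 0 0) fun z =>
      wint R (ramp z.1) (ramp z.2) (v (.inr (.inr k))) - ((G.op R fun z j => v j z).1 (.inr (0, k))
        + (z.1 - R.a) * (G.op R fun z j => v j z).1 (.inr (1, k)) + (z.2 - R.c) * (G.op R fun z j => v j z).1 (.inr (2, k))
        + (z.2 - R.c) * (z.1 - R.a) * (G.op R fun z j => v j z).1 (.inr (3, k))
        + (prim2 R.μx (fun θ => (G.op R fun z j => v j z).2.1 θ (.inr (0, k))) z.1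
          + (z.2 - R.c) * prim2 R.μx (fun θ => (G.op R fun z j => v j z).2.1 θ (.inr (1, k))) z.1)
        + (prim2 R.μy (fun θ => (G.op R fun z j => v j z).2.2 θ (.inr (0, k))) z.2
          + (z.1 - R.a) * prim2 R.μy (fun θ => (G.op R fun z j => v j z).2.2 θ (.inr (1, k))) z.2)) := by
  refine (contRep_sobTwo ((-N021.clm0 hG (.inr (0, k))) v) ((-N021.clm0 hG (.inr (1, k))) v)
    ((-N021.clm0 hG (.inr (2, k))) v) ((-N021.clm0 hG (.inr (3, k))) v)
    ((-N021.clm1 hG (.inr (0, k))) v) ((-N021.clm1 hG (.inr (1, k))) v)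
    ((-N021.clm2 hG (.inr (0, k))) v) ((-N021.clm2 hG (.inr (1, k))) v)
    (v (.inr (.inr k)))).congr fun z hz => ?_
  simp only [neg_clm0_apply, prim2_neg_congr (coeFn_neg_clm1 hG v _),
    prim2_neg_congr (coeFn_neg_clm2 hG v _)]
  ring

/-- By `Tmap_eq` it suffices to match `𝓚₂ v - 𝓚₁ (P[G] v)` with the continuous representatives of
`sobOne` and `sobTwo`, component by component; the `u₀` component is `v₀` itself. -/
theorem rep_stateMap {B : BParam n₁ n₂} {E : EParam n₁ n₂} (hB : B.Mem R) (hE : E.Mem R)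
    (v : L2St R n₀ n₁ n₂) :
    Rep (toL2 (stateMap (Gparam_mem n₀ hB hE) v)) (Tmap R n₀ B E v) := by
  have hG := Gparam_mem n₀ hB hE
  have hm := N021.op_mem hG (N021.vMem_coe v)
  rintro (k | k | k)
  · filter_upwards [ae_mem_rect] with z hz
    rw [Tmap_eq n₀ hB hE v hz]
    simp [toL2, stateMap, T00, K33, K30, K31, K32, fromBlocks_mulVec, fromRows_mulVec, vI,
      Matrix.smul_mulVec]
    rfl
  · filter_upwards [ae_mem_rect, (contRep_stateMap_one hG v k).1] with z hz hz'
    rw [Tmap_eq n₀ hB hE v hz]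
    refine hz'.symm.trans ?_
    simp [T00, K33, K30, K31, K32, fromBlocks_mulVec, fromRows_mulVec, vI, Matrix.smul_mulVec, prim,
      wint]
  · filter_upwards [ae_mem_rect, (contRep_stateMap_two hG v k).1] with z hz hz'
    rw [Tmap_eq n₀ hB hE v hz]
    refine hz'.symm.trans ?_
    simp [T00, K33, K30, K31, K32, fromBlocks_mulVec, fromRows_mulVec, vI, Matrix.smul_mulVec,
      brow_mulVec, Fin.sum_univ_two, Fin.sum_univ_four, wint]
    rw [integral_ramp_comb (hm.1 _) (hm.1 _), integral_ramp_comb (hm.2 _) (hm.2 _)]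
    exact congrArg₂ _ (integral_congr_ae (Filter.Eventually.of_forall fun w => by
      simp only [ramp]
      ring)) rfl

end StateMap

end PIE2D

end

noncomputable section

namespace PIE2D

open Matrix

/-! ### Boundary values in terms of weights -/

section Weights

variable {R : Rect} {n₀ n₁ n₂ : ℕ}

/-- Away from the endpoints, a null set, `chi` at an end of the interval is constantly 0 or 1. Hence
the entries of the `H` matrices are `chi` and `ramp` evaluated at corners or edges, and one formula
covers all corners. -/
theorem chi_left {s t x : ℝ} (hx : x ∈ Ioo s t) : chi s x = 0 := if_neg hx.1.not_ge

theorem chi_right {s t x : ℝ} (hx : x ∈ Ioo s t) : chi t x = 1 := if_pos hx.2.le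

theorem ae_mem_Ioo (s t : ℝ) : ∀ᵐ x ∂(volume.restrict (Icc s t)), x ∈ Ioo s t := by
  rw [← restrict_Ioo_eq_restrict_Icc]
  exact ae_restrict_mem measurableSet_Ioo

theorem H00_mulVec_inl (f : BC0 n₁ n₂ → ℝ) (κ : Fin 4) (k : Fin n₁) :
    (H00 R n₁ n₂ *ᵥ f) (.inl (κ, k)) = f (.inl k) := by
  fin_cases κ <;> simp [H00, fromBlocks_mulVec, bcol_mulVec]

theorem H00_mulVec_inr (f : BC0 n₁ n₂ → ℝ) (κ : Fin 4) (k : Fin n₂) :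
    (H00 R n₁ n₂ *ᵥ f) (.inr (0, κ, k)) = f (.inr (0, k))
      + ((corner R κ).1 - R.a) * f (.inr (1, k)) + ((corner R κ).2 - R.c) * f (.inr (2, k))
      + ((corner R κ).2 - R.c) * ((corner R κ).1 - R.a) * f (.inr (3, k)) ∧
    (H00 R n₁ n₂ *ᵥ f) (.inr (1, κ, k)) = f (.inr (1, k))
      + ((corner R κ).2 - R.c) * f (.inr (3, k)) ∧
    (H00 R n₁ n₂ *ᵥ f) (.inr (2, κ, k)) = f (.inr (2, k))
      + ((corner R κ).1 - R.a) * f (.inr (3, k)) ∧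
    (H00 R n₁ n₂ *ᵥ f) (.inr (3, κ, k)) = f (.inr (3, k)) := by
  fin_cases κ <;> simp [H00, fromBlocks_mulVec, bgrid_mulVec, Fin.sum_univ_four, corner]

theorem H01_mulVec_inl (f : BC1 n₁ n₂ → ℝ) (κ : Fin 4) (k : Fin n₁) {x : ℝ}
    (hx : x ∈ Ioo R.a R.b) :
    (H01 R n₁ n₂ x *ᵥ f) (.inl (κ, k)) = chi (corner R κ).1 x * f (.inl k) := by
  fin_cases κ <;> simp [H01, fromBlocks_mulVec, bcol_mulVec, corner, chi_left hx, chi_right hx]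

theorem H01_mulVec_inr (f : BC1 n₁ n₂ → ℝ) (κ : Fin 4) (k : Fin n₂) {x : ℝ}
    (hx : x ∈ Ioo R.a R.b) :
    (H01 R n₁ n₂ x *ᵥ f) (.inr (0, κ, k)) = ramp (corner R κ).1 x * f (.inr (0, k))
      + ((corner R κ).2 - R.c) * (ramp (corner R κ).1 x * f (.inr (1, k))) ∧
    (H01 R n₁ n₂ x *ᵥ f) (.inr (1, κ, k)) = chi (corner R κ).1 x * f (.inr (0, k))
      + ((corner R κ).2 - R.c) * (chi (corner R κ).1 x * f (.inr (1, k))) ∧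
    (H01 R n₁ n₂ x *ᵥ f) (.inr (2, κ, k)) = ramp (corner R κ).1 x * f (.inr (1, k)) ∧
    (H01 R n₁ n₂ x *ᵥ f) (.inr (3, κ, k)) = chi (corner R κ).1 x * f (.inr (1, k)) := by
  fin_cases κ <;> simp [H01, fromBlocks_mulVec, bgrid_mulVec, Fin.sum_univ_two, corner, ramp,
    chi_left hx, chi_right hx, mul_assoc]

theorem H02_mulVec_inl (f : BC1 n₁ n₂ → ℝ) (κ : Fin 4) (k : Fin n₁) {y : ℝ}
    (hy : y ∈ Ioo R.c R.d) :
    (H02 R n₁ n₂ y *ᵥ f) (.inl (κ, k)) = chi (corner R κ).2 y * f (.inl k) := by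
  fin_cases κ <;> simp [H02, fromBlocks_mulVec, bcol_mulVec, corner, chi_left hy, chi_right hy]

theorem H02_mulVec_inr (f : BC1 n₁ n₂ → ℝ) (κ : Fin 4) (k : Fin n₂) {y : ℝ}
    (hy : y ∈ Ioo R.c R.d) :
    (H02 R n₁ n₂ y *ᵥ f) (.inr (0, κ, k)) = ramp (corner R κ).2 y * f (.inr (0, k))
      + ((corner R κ).1 - R.a) * (ramp (corner R κ).2 y * f (.inr (1, k))) ∧
    (H02 R n₁ n₂ y *ᵥ f) (.inr (1, κ, k)) = ramp (corner R κ).2 y * f (.inr (1, k)) ∧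
    (H02 R n₁ n₂ y *ᵥ f) (.inr (2, κ, k)) = chi (corner R κ).2 y * f (.inr (0, k))
      + ((corner R κ).1 - R.a) * (chi (corner R κ).2 y * f (.inr (1, k))) ∧
    (H02 R n₁ n₂ y *ᵥ f) (.inr (3, κ, k)) = chi (corner R κ).2 y * f (.inr (1, k)) := by
  fin_cases κ <;> simp [H02, fromBlocks_mulVec, bgrid_mulVec, Fin.sum_univ_two, corner, ramp,
    chi_left hy, chi_right hy, mul_assoc]

theorem H03_mulVec_inl (f : St n₀ n₁ n₂ → ℝ) (κ : Fin 4) (k : Fin n₁) {x y : ℝ}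
    (hx : x ∈ Ioo R.a R.b) (hy : y ∈ Ioo R.c R.d) :
    (H03 R n₀ n₁ n₂ x y *ᵥ f) (.inl (κ, k))
      = chi (corner R κ).1 x * chi (corner R κ).2 y * f (.inr (.inl k)) := by
  fin_cases κ <;> simp [H03, fromCols_mulVec, fromBlocks_mulVec, bcol_mulVec, corner, chi_left hx,
    chi_right hx, chi_left hy, chi_right hy]

theorem H03_mulVec_inr (f : St n₀ n₁ n₂ → ℝ) (κ : Fin 4) (k : Fin n₂) {x y : ℝ}
    (hx : x ∈ Ioo R.a R.b) (hy : y ∈ Ioo R.c R.d) :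
    (H03 R n₀ n₁ n₂ x y *ᵥ f) (.inr (0, κ, k))
      = ramp (corner R κ).1 x * ramp (corner R κ).2 y * f (.inr (.inr k)) ∧
    (H03 R n₀ n₁ n₂ x y *ᵥ f) (.inr (1, κ, k))
      = chi (corner R κ).1 x * ramp (corner R κ).2 y * f (.inr (.inr k)) ∧
    (H03 R n₀ n₁ n₂ x y *ᵥ f) (.inr (2, κ, k))
      = ramp (corner R κ).1 x * chi (corner R κ).2 y * f (.inr (.inr k)) ∧
    (H03 R n₀ n₁ n₂ x y *ᵥ f) (.inr (3, κ, k))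
      = chi (corner R κ).1 x * chi (corner R κ).2 y * f (.inr (.inr k)) := by
  fin_cases κ <;> simp [H03, fromCols_mulVec, fromBlocks_mulVec, bgcol_mulVec, corner, ramp,
    chi_left hx, chi_right hx, chi_left hy, chi_right hy, mul_comm (R.d - y)]

theorem H11_mulVec_inl (f : BC1 n₁ n₂ → ℝ) (e : Fin 2) (k : Fin n₁) :
    (H11 R n₁ n₂ *ᵥ f) (.inl (e, k)) = f (.inl k) := by
  fin_cases e <;> simp [H11, fromBlocks_mulVec, bcol_mulVec]

theorem H11_mulVec_inr (f : BC1 n₁ n₂ → ℝ) (e : Fin 2) (k : Fin n₂) :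
    (H11 R n₁ n₂ *ᵥ f) (.inr (0, e, k)) = f (.inr (0, k))
      + f (.inr (1, k)) * ((![R.c, R.d] : Fin 2 → ℝ) e - R.c) ∧
    (H11 R n₁ n₂ *ᵥ f) (.inr (1, e, k)) = f (.inr (1, k)) := by
  fin_cases e <;> simp [H11, fromBlocks_mulVec, bgrid_mulVec, Fin.sum_univ_two, mul_comm]

theorem H22_mulVec_inl (f : BC1 n₁ n₂ → ℝ) (e : Fin 2) (k : Fin n₁) :
    (H22 R n₁ n₂ *ᵥ f) (.inl (e, k)) = f (.inl k) := by
  fin_cases e <;> simp [H22, fromBlocks_mulVec, bcol_mulVec]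

theorem H22_mulVec_inr (f : BC1 n₁ n₂ → ℝ) (e : Fin 2) (k : Fin n₂) :
    (H22 R n₁ n₂ *ᵥ f) (.inr (0, e, k)) = f (.inr (0, k))
      + f (.inr (1, k)) * ((![R.a, R.b] : Fin 2 → ℝ) e - R.a) ∧
    (H22 R n₁ n₂ *ᵥ f) (.inr (1, e, k)) = f (.inr (1, k)) := by
  fin_cases e <;> simp [H22, fromBlocks_mulVec, bgrid_mulVec, Fin.sum_univ_two, mul_comm]

theorem H13_mulVec_inl (f : St n₀ n₁ n₂ → ℝ) (e : Fin 2) (k : Fin n₁) {y : ℝ}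
    (hy : y ∈ Ioo R.c R.d) :
    (H13 R n₀ n₁ n₂ y *ᵥ f) (.inl (e, k))
      = chi ((![R.c, R.d] : Fin 2 → ℝ) e) y * f (.inr (.inl k)) := by
  fin_cases e <;> simp [H13, fromCols_mulVec, fromBlocks_mulVec, bcol_mulVec, chi_left hy,
    chi_right hy]

theorem H13_mulVec_inr (f : St n₀ n₁ n₂ → ℝ) (e : Fin 2) (k : Fin n₂) {y : ℝ}
    (hy : y ∈ Ioo R.c R.d) :
    (H13 R n₀ n₁ n₂ y *ᵥ f) (.inr (0, e, k))
      = ramp ((![R.c, R.d] : Fin 2 → ℝ) e) y * f (.inr (.inr k)) ∧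
    (H13 R n₀ n₁ n₂ y *ᵥ f) (.inr (1, e, k))
      = chi ((![R.c, R.d] : Fin 2 → ℝ) e) y * f (.inr (.inr k)) := by
  fin_cases e <;> simp [H13, fromCols_mulVec, fromBlocks_mulVec, bgcol_mulVec, ramp, chi_left hy,
    chi_right hy]

theorem H23_mulVec_inl (f : St n₀ n₁ n₂ → ℝ) (e : Fin 2) (k : Fin n₁) {x : ℝ}
    (hx : x ∈ Ioo R.a R.b) :
    (H23 R n₀ n₁ n₂ x *ᵥ f) (.inl (e, k))
      = chi ((![R.a, R.b] : Fin 2 → ℝ) e) x * f (.inr (.inl k)) := by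
  fin_cases e <;> simp [H23, fromCols_mulVec, fromBlocks_mulVec, bcol_mulVec, chi_left hx,
    chi_right hx]

theorem H23_mulVec_inr (f : St n₀ n₁ n₂ → ℝ) (e : Fin 2) (k : Fin n₂) {x : ℝ}
    (hx : x ∈ Ioo R.a R.b) :
    (H23 R n₀ n₁ n₂ x *ᵥ f) (.inr (0, e, k))
      = ramp ((![R.a, R.b] : Fin 2 → ℝ) e) x * f (.inr (.inr k)) ∧
    (H23 R n₀ n₁ n₂ x *ᵥ f) (.inr (1, e, k))
      = chi ((![R.a, R.b] : Fin 2 → ℝ) e) x * f (.inr (.inr k)) := by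
  fin_cases e <;> simp [H23, fromCols_mulVec, fromBlocks_mulVec, bgcol_mulVec, ramp, chi_left hx,
    chi_right hx]

/-! The operator `𝓗₂`. -/

variable (v : ℝ × ℝ → St n₀ n₁ n₂ → ℝ)

theorem H2_op_fst (i : BF0 n₁ n₂) :
    ((H2 R n₀ n₁ n₂).op R v).1 i = ∫ z, (H03 R n₀ n₁ n₂ z.1 z.2 *ᵥ v z) i ∂(R.μ) := rfl

theorem H2_op_snd (x : ℝ) (i : BF1 n₁ n₂) :
    ((H2 R n₀ n₁ n₂).op R v).2.1 x i = ∫ y, (H13 R n₀ n₁ n₂ y *ᵥ v (x, y)) i ∂(R.μy) := by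
  simp [N021.op, H2, vI]

theorem H2_op_trd (y : ℝ) (i : BF1 n₁ n₂) :
    ((H2 R n₀ n₁ n₂).op R v).2.2 y i = ∫ x, (H23 R n₀ n₁ n₂ x *ᵥ v (x, y)) i ∂(R.μx) := by
  simp [N021.op, H2, vI]

theorem H2_corner_one (κ : Fin 4) (k : Fin n₁) : ((H2 R n₀ n₁ n₂).op R v).1 (.inl (κ, k))
    = wint R (chi (corner R κ).1) (chi (corner R κ).2) fun z => v z (.inr (.inl k)) := by
  rw [H2_op_fst]
  refine integral_congr_ae ?_
  filter_upwards [ae_mem_open_rect] with z hz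
  exact H03_mulVec_inl _ κ k hz.1 hz.2

theorem H2_corner_two (κ : Fin 4) (k : Fin n₂) :
    ((H2 R n₀ n₁ n₂).op R v).1 (.inr (0, κ, k))
      = wint R (ramp (corner R κ).1) (ramp (corner R κ).2) (fun z => v z (.inr (.inr k))) ∧
    ((H2 R n₀ n₁ n₂).op R v).1 (.inr (1, κ, k))
      = wint R (chi (corner R κ).1) (ramp (corner R κ).2) (fun z => v z (.inr (.inr k))) ∧
    ((H2 R n₀ n₁ n₂).op R v).1 (.inr (2, κ, k))
      = wint R (ramp (corner R κ).1) (chi (corner R κ).2) (fun z => v z (.inr (.inr k))) ∧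
    ((H2 R n₀ n₁ n₂).op R v).1 (.inr (3, κ, k))
      = wint R (chi (corner R κ).1) (chi (corner R κ).2) (fun z => v z (.inr (.inr k))) := by
  simp only [H2_op_fst]
  refine ⟨?_, ?_, ?_, ?_⟩ <;> refine integral_congr_ae ?_ <;>
    filter_upwards [ae_mem_open_rect] with z hz
  exacts [(H03_mulVec_inr _ κ k hz.1 hz.2).1, (H03_mulVec_inr _ κ k hz.1 hz.2).2.1,
    (H03_mulVec_inr _ κ k hz.1 hz.2).2.2.1, (H03_mulVec_inr _ κ k hz.1 hz.2).2.2.2]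

theorem H2_x_one (e : Fin 2) (k : Fin n₁) (x : ℝ) :
    ((H2 R n₀ n₁ n₂).op R v).2.1 x (.inl (e, k))
      = prim R.μy (fun y => v (x, y) (.inr (.inl k))) ((![R.c, R.d] : Fin 2 → ℝ) e) := by
  rw [H2_op_snd]
  refine integral_congr_ae ?_
  filter_upwards [ae_mem_Ioo R.c R.d] with y hy
  exact H13_mulVec_inl _ e k hy

theorem H2_x_two (e : Fin 2) (k : Fin n₂) (x : ℝ) :
    ((H2 R n₀ n₁ n₂).op R v).2.1 x (.inr (0, e, k))
      = prim2 R.μy (fun y => v (x, y) (.inr (.inr k))) ((![R.c, R.d] : Fin 2 → ℝ) e) ∧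
    ((H2 R n₀ n₁ n₂).op R v).2.1 x (.inr (1, e, k))
      = prim R.μy (fun y => v (x, y) (.inr (.inr k))) ((![R.c, R.d] : Fin 2 → ℝ) e) := by
  simp only [H2_op_snd]
  constructor <;> refine integral_congr_ae ?_ <;>
    filter_upwards [ae_mem_Ioo R.c R.d] with y hy
  exacts [(H13_mulVec_inr _ e k hy).1, (H13_mulVec_inr _ e k hy).2]

theorem H2_y_one (e : Fin 2) (k : Fin n₁) (y : ℝ) :
    ((H2 R n₀ n₁ n₂).op R v).2.2 y (.inl (e, k))
      = prim R.μx (fun x => v (x, y) (.inr (.inl k))) ((![R.a, R.b] : Fin 2 → ℝ) e) := by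
  rw [H2_op_trd]
  refine integral_congr_ae ?_
  filter_upwards [ae_mem_Ioo R.a R.b] with x hx
  exact H23_mulVec_inl _ e k hx

theorem H2_y_two (e : Fin 2) (k : Fin n₂) (y : ℝ) :
    ((H2 R n₀ n₁ n₂).op R v).2.2 y (.inr (0, e, k))
      = prim2 R.μx (fun x => v (x, y) (.inr (.inr k))) ((![R.a, R.b] : Fin 2 → ℝ) e) ∧
    ((H2 R n₀ n₁ n₂).op R v).2.2 y (.inr (1, e, k))
      = prim R.μx (fun x => v (x, y) (.inr (.inr k))) ((![R.a, R.b] : Fin 2 → ℝ) e) := by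
  simp only [H2_op_trd]
  constructor <;> refine integral_congr_ae ?_ <;>
    filter_upwards [ae_mem_Ioo R.a R.b] with x hx
  exacts [(H23_mulVec_inr _ e k hx).1, (H23_mulVec_inr _ e k hx).2]

/-! The operator `𝓗₁`. -/

theorem H1_op_fst (g : RL (BC0 n₁ n₂) (BC1 n₁ n₂)) (i : BF0 n₁ n₂) :
    ((H1 R n₁ n₂).op R g).1 i = (H00 R n₁ n₂ *ᵥ g.1) i
      + ∫ x, (H01 R n₁ n₂ x *ᵥ g.2.1 x) i ∂(R.μx)
      + ∫ y, (H02 R n₁ n₂ y *ᵥ g.2.2 y) i ∂(R.μy) := by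
  simp [N011.op, H1, vint_eq_vI R.hab.le, vint_eq_vI R.hcd.le, vI]

theorem H1_op_snd (g : RL (BC0 n₁ n₂) (BC1 n₁ n₂)) (x : ℝ) :
    ((H1 R n₁ n₂).op R g).2.1 x = H11 R n₁ n₂ *ᵥ g.2.1 x := by
  funext i
  simp [N011.op, H1, N1D.op, vint]

theorem H1_op_trd (g : RL (BC0 n₁ n₂) (BC1 n₁ n₂)) (y : ℝ) :
    ((H1 R n₁ n₂).op R g).2.2 y = H22 R n₁ n₂ *ᵥ g.2.2 y := by
  funext i
  simp [N011.op, H1, N1D.op, vint]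

theorem integrable_chi_mul {s t : ℝ} {f : ℝ → ℝ} (hf : MemLp f 2 (volume.restrict (Icc s t)))
    (x : ℝ) : Integrable (fun θ => chi x θ * f θ) (volume.restrict (Icc s t)) :=
  MemLp.integrable (q := 2) (by norm_num) (hf.mul' (memLp_chi x _))

theorem integrable_ramp_mul {s t : ℝ} {f : ℝ → ℝ} (hf : MemLp f 2 (volume.restrict (Icc s t)))
    (x : ℝ) : Integrable (fun θ => ramp x θ * f θ) (volume.restrict (Icc s t)) :=
  MemLp.integrable (q := 2) (by norm_num) (hf.mul' (memLp_ramp x s t))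

theorem H1_corner_one (g : RL (BC0 n₁ n₂) (BC1 n₁ n₂)) (κ : Fin 4) (k : Fin n₁) :
    ((H1 R n₁ n₂).op R g).1 (.inl (κ, k)) = g.1 (.inl k)
      + prim R.μx (fun x => g.2.1 x (.inl k)) (corner R κ).1
      + prim R.μy (fun y => g.2.2 y (.inl k)) (corner R κ).2 := by
  rw [H1_op_fst, H00_mulVec_inl]
  congr 1
  · congr 1
    refine integral_congr_ae ?_
    filter_upwards [ae_mem_Ioo R.a R.b] with x hx
    exact H01_mulVec_inl _ κ k hx
  · refine integral_congr_ae ?_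
    filter_upwards [ae_mem_Ioo R.c R.d] with y hy
    exact H02_mulVec_inl _ κ k hy

/-- Written in terms of the corner coordinates, the rows of `𝓗₁` have the same shape as the
representatives of `sobTwo`, `sobTwoX`, `sobTwoY` and `sobOne`, so the two can be compared term by
term. -/
theorem H1_corner_two {g : RL (BC0 n₁ n₂) (BC1 n₁ n₂)} (hg : g.Mem R) (κ : Fin 4) (k : Fin n₂) :
    ((H1 R n₁ n₂).op R g).1 (.inr (0, κ, k)) = g.1 (.inr (0, k))
      + ((corner R κ).1 - R.a) * g.1 (.inr (1, k)) + ((corner R κ).2 - R.c) * g.1 (.inr (2, k))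
      + ((corner R κ).2 - R.c) * ((corner R κ).1 - R.a) * g.1 (.inr (3, k))
      + (prim2 R.μx (fun θ => g.2.1 θ (.inr (0, k))) (corner R κ).1
        + ((corner R κ).2 - R.c) * prim2 R.μx (fun θ => g.2.1 θ (.inr (1, k))) (corner R κ).1)
      + (prim2 R.μy (fun θ => g.2.2 θ (.inr (0, k))) (corner R κ).2
        + ((corner R κ).1 - R.a) * prim2 R.μy (fun θ => g.2.2 θ (.inr (1, k))) (corner R κ).2) ∧
    ((H1 R n₁ n₂).op R g).1 (.inr (1, κ, k)) = g.1 (.inr (1, k))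
      + ((corner R κ).2 - R.c) * g.1 (.inr (3, k))
      + (prim R.μx (fun θ => g.2.1 θ (.inr (0, k))) (corner R κ).1
        + ((corner R κ).2 - R.c) * prim R.μx (fun θ => g.2.1 θ (.inr (1, k))) (corner R κ).1)
      + prim2 R.μy (fun θ => g.2.2 θ (.inr (1, k))) (corner R κ).2 ∧
    ((H1 R n₁ n₂).op R g).1 (.inr (2, κ, k)) = g.1 (.inr (2, k))
      + ((corner R κ).1 - R.a) * g.1 (.inr (3, k))
      + prim2 R.μx (fun θ => g.2.1 θ (.inr (1, k))) (corner R κ).1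
      + (prim R.μy (fun θ => g.2.2 θ (.inr (0, k))) (corner R κ).2
        + ((corner R κ).1 - R.a) * prim R.μy (fun θ => g.2.2 θ (.inr (1, k))) (corner R κ).2) ∧
    ((H1 R n₁ n₂).op R g).1 (.inr (3, κ, k)) = g.1 (.inr (3, k))
      + prim R.μx (fun θ => g.2.1 θ (.inr (1, k))) (corner R κ).1
      + prim R.μy (fun θ => g.2.2 θ (.inr (1, k))) (corner R κ).2 := by
  obtain ⟨a0, a1, a2, a3⟩ := H00_mulVec_inr (R := R) g.1 κ k
  have hx := fun r : Fin 2 => integrable_chi_mul (hg.1 (.inr (r, k))) (corner R κ).1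
  have hx' := fun r : Fin 2 => integrable_ramp_mul (hg.1 (.inr (r, k))) (corner R κ).1
  have hy := fun r : Fin 2 => integrable_chi_mul (hg.2 (.inr (r, k))) (corner R κ).2
  have hy' := fun r : Fin 2 => integrable_ramp_mul (hg.2 (.inr (r, k))) (corner R κ).2
  simp only [H1_op_fst, a0, a1, a2, a3]
  refine ⟨congrArg₂ _ (congrArg₂ _ rfl ?_) ?_, congrArg₂ _ (congrArg₂ _ rfl ?_) ?_,
    congrArg₂ _ (congrArg₂ _ rfl ?_) ?_, congrArg₂ _ (congrArg₂ _ rfl ?_) ?_⟩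
  · rw [prim2, prim2, ← integral_const_mul, ← integral_add (hx' 0) ((hx' 1).const_mul _)]
    refine integral_congr_ae ?_
    filter_upwards [ae_mem_Ioo R.a R.b] with x hx using (H01_mulVec_inr _ κ k hx).1
  · rw [prim2, prim2, ← integral_const_mul, ← integral_add (hy' 0) ((hy' 1).const_mul _)]
    refine integral_congr_ae ?_
    filter_upwards [ae_mem_Ioo R.c R.d] with y hy using (H02_mulVec_inr _ κ k hy).1
  · rw [prim, prim, ← integral_const_mul, ← integral_add (hx 0) ((hx 1).const_mul _)]
    refine integral_congr_ae ?_
    filter_upwards [ae_mem_Ioo R.a R.b] with x hx using (H01_mulVec_inr _ κ k hx).2.1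
  · refine integral_congr_ae ?_
    filter_upwards [ae_mem_Ioo R.c R.d] with y hy using (H02_mulVec_inr _ κ k hy).2.1
  · refine integral_congr_ae ?_
    filter_upwards [ae_mem_Ioo R.a R.b] with x hx using (H01_mulVec_inr _ κ k hx).2.2.1
  · rw [prim, prim, ← integral_const_mul, ← integral_add (hy 0) ((hy 1).const_mul _)]
    refine integral_congr_ae ?_
    filter_upwards [ae_mem_Ioo R.c R.d] with y hy using (H02_mulVec_inr _ κ k hy).2.2.1
  · refine integral_congr_ae ?_
    filter_upwards [ae_mem_Ioo R.a R.b] with x hx using (H01_mulVec_inr _ κ k hx).2.2.2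
  · refine integral_congr_ae ?_
    filter_upwards [ae_mem_Ioo R.c R.d] with y hy using (H02_mulVec_inr _ κ k hy).2.2.2

end Weights

end PIE2D

end

/-! ### Boundary values of the state and the boundary conditions -/

noncomputable section

namespace PIE2D

open Matrix

section Boundary

variable {R : Rect} {n₀ n₁ n₂ : ℕ} {G : N021 (BC0 n₁ n₂) (BC1 n₁ n₂) (St n₀ n₁ n₂)} (hG : G.Mem R)
  (v : L2St R n₀ n₁ n₂)

/-- The relation `Λ_bf (𝓚₂ v - 𝓚₁ P[G] v) = 𝓗₂ v - 𝓗₁ P[G] v`: corner values come from continuous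
representatives, edge values from representatives continuous across the edge. -/
theorem isBoundary_stateMap : IsBoundary (stateMap hG v)
    ((H2 R n₀ n₁ n₂).op R (fun z j => v j z)
      - (H1 R n₁ n₂).op R (G.op R fun z j => v j z)) := by
  have hg := N021.op_mem hG (N021.vMem_coe v)
  have c1 := coeFn_neg_clm1 hG v
  have c2 := coeFn_neg_clm2 hG v
  refine ⟨fun κ k => ?_, fun κ k => ⟨?_, ?_, ?_, ?_⟩, fun e k => ?_, fun e k => ⟨?_, ?_⟩,
    fun e k => ?_, fun e k => ⟨?_, ?_⟩⟩
  · convert (contRep_stateMap_one hG v k).hasValue (corner R κ) using 1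
    rw [Prod.fst_sub, Pi.sub_apply, H2_corner_one, H1_corner_one]
  · convert (contRep_stateMap_two hG v k).hasValue (corner R κ) using 1
    rw [Prod.fst_sub, Pi.sub_apply, (H2_corner_two _ κ k).1, (H1_corner_two hg κ k).1]
  -- The stored derivative of index `(1, 0)` is `sobTwoX` by definition, so its explicit
  -- representative can be evaluated at the corner. The data carry a minus sign because they are
  -- `-P[G] v`.
  · convert (contRep_sobTwoX ((-N021.clm0 hG (.inr (1, k))) v) ((-N021.clm0 hG (.inr (3, k))) v)
      ((-N021.clm1 hG (.inr (0, k))) v) ((-N021.clm1 hG (.inr (1, k))) v)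
      ((-N021.clm2 hG (.inr (1, k))) v) (v (.inr (.inr k)))).hasValue (corner R κ) using 1
    · rfl
    rw [Prod.fst_sub, Pi.sub_apply, (H2_corner_two _ κ k).2.1, (H1_corner_two hg κ k).2.1,
      neg_clm0_apply, neg_clm0_apply, prim_neg_congr (c1 _), prim_neg_congr (c1 _),
      prim2_neg_congr (c2 _)]
    ring
  · convert (contRep_sobTwoY ((-N021.clm0 hG (.inr (2, k))) v) ((-N021.clm0 hG (.inr (3, k))) v)
      ((-N021.clm1 hG (.inr (1, k))) v) ((-N021.clm2 hG (.inr (0, k))) v)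
      ((-N021.clm2 hG (.inr (1, k))) v) (v (.inr (.inr k)))).hasValue (corner R κ) using 1
    · rfl
    rw [Prod.fst_sub, Pi.sub_apply, (H2_corner_two _ κ k).2.2.1, (H1_corner_two hg κ k).2.2.1,
      neg_clm0_apply, neg_clm0_apply, prim2_neg_congr (c1 _), prim_neg_congr (c2 _),
      prim_neg_congr (c2 _)]
    ring
  · convert (contRep_sobOne ((-N021.clm0 hG (.inr (3, k))) v)
      ((-N021.clm1 hG (.inr (1, k))) v) ((-N021.clm2 hG (.inr (1, k))) v)
      (v (.inr (.inr k)))).hasValue (corner R κ) using 1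
    · rfl
    rw [Prod.fst_sub, Pi.sub_apply, (H2_corner_two _ κ k).2.2.2, (H1_corner_two hg κ k).2.2.2,
      neg_clm0_apply, prim_neg_congr (c1 _), prim_neg_congr (c2 _)]
    ring
  · refine (hasTraceY_ex_add_Iy ((-N021.clm1 hG (.inl k)) v) (v (.inr (.inl k))) _).congr ?_
    filter_upwards [c1 (.inl k)] with x hx
    simp only [Prod.snd_sub, Prod.fst_sub, Pi.sub_apply, H2_x_one, H1_op_snd, H11_mulVec_inl, hx]
    ring
  · refine (hasTraceY_two ((-N021.clm1 hG (.inr (0, k))) v) ((-N021.clm1 hG (.inr (1, k))) v)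
      (v (.inr (.inr k))) ?_).congr ?_
    · fin_cases e <;> simp [R.hcd.le]
    filter_upwards [c1 (.inr (0, k)), c1 (.inr (1, k))] with x hx hx'
    simp only [Prod.snd_sub, Prod.fst_sub, Pi.sub_apply, (H2_x_two _ e k x).1, H1_op_snd,
      (H11_mulVec_inr _ e k).1, hx, hx']
    ring
  · refine (hasTraceY_ex_add_Iy ((-N021.clm1 hG (.inr (1, k))) v) (v (.inr (.inr k))) _).congr ?_
    filter_upwards [c1 (.inr (1, k))] with x hx
    simp only [Prod.snd_sub, Prod.fst_sub, Pi.sub_apply, (H2_x_two _ e k x).2, H1_op_snd,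
      (H11_mulVec_inr _ e k).2, hx]
    ring
  · refine (hasTraceX_ey_add_Ix ((-N021.clm2 hG (.inl k)) v) (v (.inr (.inl k))) _).congr ?_
    filter_upwards [c2 (.inl k)] with y hy
    simp only [Prod.snd_sub, Pi.sub_apply, H2_y_one, H1_op_trd, H22_mulVec_inl, hy]
    ring
  · refine (hasTraceX_two ((-N021.clm2 hG (.inr (0, k))) v) ((-N021.clm2 hG (.inr (1, k))) v)
      (v (.inr (.inr k))) ?_).congr ?_
    · fin_cases e <;> simp [R.hab.le]
    filter_upwards [c2 (.inr (0, k)), c2 (.inr (1, k))] with y hy hy'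
    simp only [Prod.snd_sub, Pi.sub_apply, (H2_y_two _ e k y).1, H1_op_trd,
      (H22_mulVec_inr _ e k).1, hy, hy']
    ring
  · refine (hasTraceX_ey_add_Ix ((-N021.clm2 hG (.inr (1, k))) v) (v (.inr (.inr k))) _).congr ?_
    filter_upwards [c2 (.inr (1, k))] with y hy
    simp only [Prod.snd_sub, Pi.sub_apply, (H2_y_two _ e k y).2, H1_op_trd,
      (H22_mulVec_inr _ e k).2, hy]
    ring

end Boundary

/-! ### Linearity of 011-PI operators -/

section Linear

variable {p₀ q₀ p₁ q₁ : Type} [Fintype q₀] [Fintype q₁] {R : Rect}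

theorem RL.Eqv.symm {w w' : RL p₀ p₁} (h : RL.Eqv R w w') : RL.Eqv R w' w :=
  ⟨h.1.symm, h.2.1.mono fun _ => Eq.symm, h.2.2.mono fun _ => Eq.symm⟩

theorem RL.Eqv.trans {w w' w'' : RL p₀ p₁} (h : RL.Eqv R w w') (h' : RL.Eqv R w' w'') :
    RL.Eqv R w w'' :=
  ⟨h.1.trans h'.1, h.2.1.mp (h'.2.1.mono fun _ e' e => e.trans e'),
    h.2.2.mp (h'.2.2.mono fun _ e' e => e.trans e')⟩

theorem RL.Eqv.sub_eq_zero {w w' : RL p₀ p₁} (h : RL.Eqv R w w') : RL.Eqv R (w - w') 0 :=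
  ⟨_root_.sub_eq_zero.2 h.1, h.2.1.mono fun _ e => _root_.sub_eq_zero.2 e,
    h.2.2.mono fun _ e => _root_.sub_eq_zero.2 e⟩

/-- The endpoints are free in `[s, t]` because the 1D-PI blocks integrate up to the output point. -/
theorem vint_congr {p : Type} {s t r r' : ℝ} (hr : r ∈ Icc s t) (hr' : r' ∈ Icc s t)
    {f g : ℝ → p → ℝ} (h : ∀ᵐ x ∂(volume.restrict (Icc s t)), f x = g x) :
    vint r r' f = vint r r' g := by
  funext i
  refine intervalIntegral.integral_congr_ae ?_
  filter_upwards [(ae_restrict_iff' measurableSet_Icc).1 h] with x hx hx'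
  rw [hx (uIcc_subset_Icc hr hr' (uIoc_subset_uIcc hx'))]

theorem vint_sub {p : Type} {s t r r' : ℝ} (hr : r ∈ Icc s t) (hr' : r' ∈ Icc s t)
    {f g : ℝ → p → ℝ} (hf : VMem f 1 (volume.restrict (Icc s t)))
    (hg : VMem g 1 (volume.restrict (Icc s t))) :
    vint r r' (fun x => f x - g x) = vint r r' f - vint r r' g := by
  have h : ∀ {f : ℝ → p → ℝ}, VMem f 1 (volume.restrict (Icc s t)) → ∀ i,
      IntervalIntegrable (fun x => f x i) volume r r' := fun hf i =>
    ((show IntegrableOn _ _ _ from memLp_one_iff_integrable.1 (hf i)).mono_set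
      (uIcc_subset_Icc hr hr')).intervalIntegrable
  funext i
  exact intervalIntegral.integral_sub (h hf i) (h hg i)

theorem N011.op_congr (B : N011 p₀ q₀ p₁ q₁) {w w' : RL q₀ q₁} (h : RL.Eqv R w w') :
    RL.Eqv R (B.op R w) (B.op R w') := by
  have ex : ∀ {p : Type} (M : ℝ → Matrix p q₁ ℝ), ∀ r ∈ Icc R.a R.b, ∀ r' ∈ Icc R.a R.b,
      vint r r' (fun x => M x *ᵥ w.2.1 x) = vint r r' (fun x => M x *ᵥ w'.2.1 x) :=
    fun M r hr r' hr' => vint_congr hr hr' (h.2.1.mono fun x hx => by rw [hx])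
  have ey : ∀ {p : Type} (M : ℝ → Matrix p q₁ ℝ), ∀ r ∈ Icc R.c R.d, ∀ r' ∈ Icc R.c R.d,
      vint r r' (fun x => M x *ᵥ w.2.2 x) = vint r r' (fun x => M x *ᵥ w'.2.2 x) :=
    fun M r hr r' hr' => vint_congr hr hr' (h.2.2.mono fun x hx => by rw [hx])
  have a := left_mem_Icc.2 R.hab.le
  have b := right_mem_Icc.2 R.hab.le
  have c := left_mem_Icc.2 R.hcd.le
  have d := right_mem_Icc.2 R.hcd.le
  refine ⟨?_, ?_, ?_⟩
  · simp only [N011.op, h.1, ex _ _ a _ b, ey _ _ c _ d]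
  · filter_upwards [h.2.1, ae_restrict_mem measurableSet_Icc] with x hx hx'
    simp only [N011.op, N1D.op, h.1, hx, ex _ _ a _ hx', ex _ _ hx' _ b, ey _ _ c _ d]
  · filter_upwards [h.2.2, ae_restrict_mem measurableSet_Icc] with x hx hx'
    simp only [N011.op, N1D.op, h.1, hx, ey _ _ c _ hx', ey _ _ hx' _ d, ex _ _ a _ b]

/-- Linearity holds only almost everywhere, since splitting the integrals needs square-integrable
rows of the kernels. -/
theorem N011.op_sub [Finite p₁] {B : N011 p₀ q₀ p₁ q₁} (hB : B.Mem R) {w w' : RL q₀ q₁} (hw : w.Mem R)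
    (hw' : w'.Mem R) : RL.Eqv R (B.op R (w - w')) (B.op R w - B.op R w') := by
  have ex : ∀ {p : Type} {M : ℝ → Matrix p q₁ ℝ}, MMem M 2 R.μx →
      ∀ r ∈ Icc R.a R.b, ∀ r' ∈ Icc R.a R.b, vint r r' (fun x => M x *ᵥ (w.2.1 x - w'.2.1 x))
        = vint r r' (fun x => M x *ᵥ w.2.1 x) - vint r r' (fun x => M x *ᵥ w'.2.1 x) := by
    intro p M hM r hr r' hr'
    simp only [Matrix.mulVec_sub]
    exact vint_sub hr hr' (hM.mulVec hw.1) (hM.mulVec hw'.1)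
  have ey : ∀ {p : Type} {M : ℝ → Matrix p q₁ ℝ}, MMem M 2 R.μy →
      ∀ r ∈ Icc R.c R.d, ∀ r' ∈ Icc R.c R.d, vint r r' (fun x => M x *ᵥ (w.2.2 x - w'.2.2 x))
        = vint r r' (fun x => M x *ᵥ w.2.2 x) - vint r r' (fun x => M x *ᵥ w'.2.2 x) := by
    intro p M hM r hr r' hr'
    simp only [Matrix.mulVec_sub]
    exact vint_sub hr hr' (hM.mulVec hw.2) (hM.mulVec hw'.2)
  have a := left_mem_Icc.2 R.hab.le
  have b := right_mem_Icc.2 R.hab.le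
  have c := left_mem_Icc.2 R.hcd.le
  have d := right_mem_Icc.2 R.hcd.le
  have h12 := hB.b12
  have h21 := hB.b21
  rw [R.μ_eq] at h12 h21
  refine ⟨?_, ?_, ?_⟩
  · simp only [N011.op, Prod.fst_sub, Prod.snd_sub, Pi.sub_apply, Matrix.mulVec_sub _ w.1,
      ex hB.b01 _ a _ b, ey hB.b02 _ c _ d]
    abel
  · filter_upwards [ae_restrict_mem measurableSet_Icc, MMem.slice_two hB.b11.n1,
      MMem.slice_two hB.b11.n2, MMem.slice_two h12] with x hx s1 s2 s3
    simp only [N011.op, N1D.op, Prod.fst_sub, Prod.snd_sub, Pi.sub_apply, Matrix.mulVec_sub _ w.1,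
      Matrix.mulVec_sub _ (w.2.1 x), ex s1 _ a _ hx, ex s2 _ hx _ b, ey s3 _ c _ d]
    abel
  · filter_upwards [ae_restrict_mem measurableSet_Icc, MMem.slice_two hB.b22.n1,
      MMem.slice_two hB.b22.n2,
      MMem.slice_two (MMem.swap (M := fun z : ℝ × ℝ => B.b21 z.1 z.2) h21)] with x hx s1 s2 s3
    simp only [Prod.swap_prod_mk] at s3
    simp only [N011.op, N1D.op, Prod.fst_sub, Prod.snd_sub, Pi.sub_apply, Matrix.mulVec_sub _ w.1,
      Matrix.mulVec_sub _ (w.2.2 x), ey s1 _ c _ hx, ey s2 _ hx _ d, ex s3 _ a _ b]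
    abel

end Linear

/-! ### The map `𝓣` takes values in `X(𝓑)` -/

section Range

variable {R : Rect} {n₀ n₁ n₂ : ℕ} {B : BParam n₁ n₂} {E : EParam n₁ n₂}

theorem H1_op_mem {g : RL (BC0 n₁ n₂) (BC1 n₁ n₂)} (hg : g.Mem R) :
    ((H1 R n₁ n₂).op R g).Mem R := by
  constructor <;> intro i
  · simp only [H1_op_snd, Matrix.mulVec, dotProduct]
    exact memLp_finsetSum _ fun j _ => (hg.1 j).const_mul _
  · simp only [H1_op_trd, Matrix.mulVec, dotProduct]
    exact memLp_finsetSum _ fun j _ => (hg.2 j).const_mul _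

/-- By the boundary values just computed, the claim is `𝓑 𝓗₂ v = 𝓑 𝓗₁ P[G] v`; as `P[G] v` is `P[E]`
applied to `𝓑 𝓗₂ v`, this is the right-inverse property of `E`. -/
theorem stateMap_mem_X (hB : B.Mem R) (hBsep : B.Separable) (hE : IsInverse R B E)
    (v : L2St R n₀ n₁ n₂) : stateMap (Gparam_mem n₀ hB hE.mem) v ∈ X R n₀ B := by
  have hv := N021.vMem_coe v
  have hF := Fparam_mem n₀ hB
  have hG := Gparam_mem n₀ hB hE.mem
  refine ⟨_, isBoundary_stateMap hG v, (N011.op_sub hB (N021.op_mem (H2_mem R n₀ n₁ n₂) hv)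
    (H1_op_mem (N021.op_mem hG hv))).trans (RL.Eqv.sub_eq_zero ?_)⟩
  -- Replaces `𝓑 (𝓗₂ v)` by the single operator with parameters `Fparam`, so that `P[E]` can be
  -- composed with it.
  refine (N021.op_comp hB hBsep (H2_mem R n₀ n₁ n₂) hv).trans (RL.Eqv.symm ?_)
  have hEF := N021.op_comp hE.mem hE.separable hF hv
  exact (N011.op_congr B (N011.op_congr _ hEF.symm)).trans
    (hE.right_inv _ (N021.op_mem hF hv))

end Range

end PIE2D

end

noncomputable section

namespace PIE2D

/-! ### Solutions -/

section Solutions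

theorem hasDerivWithinAt_clm_comp {F G : Type*} [NormedAddCommGroup F] [NormedSpace ℝ F]
    [NormedAddCommGroup G] [NormedSpace ℝ G] {f : ℝ → F} {f' : F} {s : Set ℝ} {t : ℝ}
    (L : F →L[ℝ] G) (h : HasDerivWithinAt f f' s t) :
    HasDerivWithinAt (fun t => L (f t)) (L f') s t :=
  L.hasFDerivAt.comp_hasDerivWithinAt t h

/-- The half-line has unique derivatives at every point, including the one-sided derivative at 0. -/
theorem hasDerivWithinAt_Ici_unique {F : Type*} [NormedAddCommGroup F] [NormedSpace ℝ F]
    {f g : ℝ → F} {f' g' : F} {t : ℝ} (ht : 0 ≤ t) (hf : HasDerivWithinAt f f' (Ici 0) t)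
    (hg : HasDerivWithinAt g g' (Ici 0) t) (h : ∀ s ∈ Ici (0 : ℝ), f s = g s) : f' = g' :=
  (uniqueDiffOn_Ici (0 : ℝ) t ht).eq_deriv _ hf (hg.congr h (h t ht))

variable {R : Rect} {n₀ n₁ n₂ : ℕ}

set_option synthInstance.maxHeartbeats 200000 in
theorem hasDerivWithinAt_of_sobSt (L : SobSt R n₀ n₁ n₂ →L[ℝ] L2St R n₀ n₁ n₂)
    {f : ℝ → SobSt R n₀ n₁ n₂} {f' : SobSt R n₀ n₁ n₂} {s : Set ℝ} {t : ℝ}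
    (h : HasDerivWithinAt f f' s t) : HasDerivWithinAt (fun t => L (f t)) (L f') s t :=
  hasDerivWithinAt_clm_comp (F := SobSt R n₀ n₁ n₂) (G := L2St R n₀ n₁ n₂) L h

set_option synthInstance.maxHeartbeats 200000 in
theorem hasDerivWithinAt_sobSt (L : L2St R n₀ n₁ n₂ →L[ℝ] SobSt R n₀ n₁ n₂)
    {f : ℝ → L2St R n₀ n₁ n₂} {f' : L2St R n₀ n₁ n₂} {s : Set ℝ} {t : ℝ}
    (h : HasDerivWithinAt f f' s t) : HasDerivWithinAt (fun t => L (f t)) (L f') s t :=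
  hasDerivWithinAt_clm_comp (F := L2St R n₀ n₁ n₂) (G := SobSt R n₀ n₁ n₂) L h

set_option synthInstance.maxHeartbeats 200000 in
theorem hasDerivWithinAt_Ici_unique_sobSt {f g : ℝ → SobSt R n₀ n₁ n₂}
    {f' g' : SobSt R n₀ n₁ n₂} {t : ℝ} (ht : 0 ≤ t) (hf : HasDerivWithinAt f f' (Ici 0) t)
    (hg : HasDerivWithinAt g g' (Ici 0) t) (h : ∀ s ∈ Ici (0 : ℝ), f s = g s) : f' = g' :=
  hasDerivWithinAt_Ici_unique (F := SobSt R n₀ n₁ n₂) ht hf hg h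

theorem toL2_injective : Function.Injective (toL2 : SobSt R n₀ n₁ n₂ → L2St R n₀ n₁ n₂) :=
  fun _ _ h => funext fun q => Sob.ext_of_Dv (congrFun h q)

theorem Rep.unique {v v' : L2St R n₀ n₁ n₂} {f : ℝ × ℝ → St n₀ n₁ n₂ → ℝ} (h : Rep v f)
    (h' : Rep v' f) : v = v' :=
  funext fun q => Lp.ext ((h q).trans (h' q).symm)

variable {B : BParam n₁ n₂} {E : EParam n₁ n₂} (hB : B.Mem R) (hE : E.Mem R)
  (A : Coeff n₀ n₁ n₂)

/-- The operator `𝓣` with values in `L₂ × H₁ × H₂`. -/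
def Tstate : L2St R n₀ n₁ n₂ →L[ℝ] SobSt R n₀ n₁ n₂ := stateMap (Gparam_mem n₀ hB hE)

/-- Turns statements about representatives of `𝓣 v` into equations for the bounded operator
`Tstate`, which is how both notions of solution are compared. -/
theorem rep_Tstate_iff {v : L2St R n₀ n₁ n₂} {w : L2St R n₀ n₁ n₂} :
    Rep w (Tmap R n₀ B E v) ↔ w = toL2 (Tstate hB hE v) :=
  ⟨fun h => h.unique (rep_stateMap hB hE v), fun h => h ▸ rep_stateMap hB hE v⟩

theorem isAmap_iff {v r : L2St R n₀ n₁ n₂} :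
    IsAmap A B E v r ↔ r = diffOp A (Tstate hB hE v) := by
  simp only [IsAmap, rep_Tstate_iff hB hE, toL2_injective.eq_iff, exists_eq_left]

variable {vI : L2St R n₀ n₁ n₂} {v : ℝ → L2St R n₀ n₁ n₂}

theorem solvesPIE_iff : SolvesPIE A B E vI v ↔ v 0 = vI ∧ ∀ t, 0 ≤ t → ∃ v',
    HasDerivWithinAt v v' (Ici 0) t ∧
      diffOp A (Tstate hB hE (v t)) = toL2 (Tstate hB hE v') := by
  simp only [SolvesPIE, isAmap_iff hB hE, rep_Tstate_iff hB hE]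
  refine and_congr_right fun _ => forall₂_congr fun t _ => exists_congr fun v' => ?_
  exact ⟨fun ⟨r, h1, h2, h3⟩ => ⟨h1, h2 ▸ h3⟩, fun ⟨h1, h2⟩ => ⟨_, h1, rfl, h2⟩⟩

theorem solvesPIE_iff_solvesPDE (hB : B.Mem R) (hBsep : B.Separable)
    (hE : IsInverse R B E) : SolvesPIE A B E vI v ↔ SolvesPDE (R := R) A B (Tmap R n₀ B E vI)
      (fun t => Tmap R n₀ B E (v t)) := by
  have hinj : Function.Injective (Tstate (n₀ := n₀) hB hE.mem) :=
    Function.LeftInverse.injective (g := topDeriv) fun v => topDeriv_stateMap _ v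
  rw [solvesPIE_iff hB hE.mem]
  simp only [SolvesPDE, rep_Tstate_iff hB hE.mem, toL2_injective.eq_iff]
  constructor
  · rintro ⟨rfl, h⟩
    refine ⟨fun t => Tstate hB hE.mem (v t), fun _ _ => rfl, rfl, fun t ht =>
      ⟨stateMap_mem_X hB hBsep hE _, ?_⟩⟩
    obtain ⟨v', h1, h2⟩ := h t ht
    exact ⟨Tstate hB hE.mem v',
      hasDerivWithinAt_sobSt _ h1, h2.symm⟩
  · rintro ⟨U, hU, h0, h⟩
    refine ⟨hinj ((hU 0 le_rfl).symm.trans h0), fun t ht => ?_⟩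
    obtain ⟨-, U', h1, h2⟩ := h t ht
    -- The left inverse recovers `v` from the Sobolev-valued state, and being bounded it transfers
    -- differentiability in time.
    have hv : ∀ t, 0 ≤ t → v t = topDeriv (U t) := fun t ht => by
      rw [hU t ht]
      exact (topDeriv_stateMap _ _).symm
    have d : HasDerivWithinAt v (topDeriv U') (Ici 0) t :=
      (hasDerivWithinAt_of_sobSt topDeriv h1).congr hv (hv t ht)
    refine ⟨topDeriv U', d, ?_⟩
    rw [← hU t ht, ← h2]
    -- `U` and `𝓣 v` agree on the half-line, so `U'` equals `𝓣` applied to the derivative of `v`.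
    exact congrArg toL2 (hasDerivWithinAt_Ici_unique_sobSt ht h1
      (hasDerivWithinAt_sobSt (Tstate hB hE.mem) d) hU)

/-- For nonnegative times the L₂ path `V` is forced to be `𝓣 v`, and `U` is forced to be its Sobolev
lift, so both notions assert the same L₂ derivative. The boundary conditions are automatic and the
initial values match by injectivity of `𝓣`. -/
theorem solvesPIEinL2_iff_solvesPDEinL2 (hB : B.Mem R) (hBsep : B.Separable)
    (hE : IsInverse R B E) : SolvesPIEinL2 A B E vI v ↔ SolvesPDEinL2 (R := R) A B (Tmap R n₀ B E vI)
      (fun t => Tmap R n₀ B E (v t)) := by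
  have hinj : Function.Injective (Tstate (n₀ := n₀) hB hE.mem) :=
    Function.LeftInverse.injective (g := topDeriv) fun v => topDeriv_stateMap _ v
  simp only [SolvesPIEinL2, SolvesPDEinL2, isAmap_iff hB hE.mem, rep_Tstate_iff hB hE.mem,
    toL2_injective.eq_iff, exists_eq_left]
  constructor
  · rintro ⟨rfl, V, hV, h⟩
    exact ⟨fun t => Tstate hB hE.mem (v t), fun _ _ => rfl, rfl, fun t ht =>
      ⟨stateMap_mem_X hB hBsep hE _,
        (h t ht).congr (fun s hs => (hV s hs).symm) (hV t ht).symm⟩⟩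
  · rintro ⟨U, hU, h0, h⟩
    exact ⟨hinj ((hU 0 le_rfl).symm.trans h0), fun t => toL2 (U t),
      fun t ht => congrArg _ (hU t ht), fun t ht => hU t ht ▸ (h t ht).2⟩

end Solutions

end PIE2D

end

theorem mainTheorem2 (R : PIE2D.Rect) (n₀ n₁ n₂ : ℕ)
    (A : PIE2D.Coeff n₀ n₁ n₂)
    (B : PIE2D.BParam n₁ n₂) (hB : B.Mem R) (hBsep : B.Separable)
    (E : PIE2D.EParam n₁ n₂) (hE : PIE2D.IsInverse R B E) :
    (∀ v : PIE2D.L2St R n₀ n₁ n₂,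
      ∃ w ∈ PIE2D.X R n₀ B, PIE2D.Rep (PIE2D.toL2 w) (PIE2D.Tmap R n₀ B E v)) ∧
    ∀ (vI : PIE2D.L2St R n₀ n₁ n₂) (v : ℝ → PIE2D.L2St R n₀ n₁ n₂),
      (PIE2D.SolvesPIE A B E vI v ↔
        PIE2D.SolvesPDE (R := R) A B (PIE2D.Tmap R n₀ B E vI)
          (fun t => PIE2D.Tmap R n₀ B E (v t))) ∧
      (PIE2D.SolvesPIEinL2 A B E vI v ↔
        PIE2D.SolvesPDEinL2 (R := R) A B (PIE2D.Tmap R n₀ B E vI)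
          (fun t => PIE2D.Tmap R n₀ B E (v t))) :=
  ⟨fun v => ⟨_, PIE2D.stateMap_mem_X hB hBsep hE v, PIE2D.rep_stateMap hB hE.mem v⟩,
    fun _ _ => ⟨PIE2D.solvesPIE_iff_solvesPDE A hB hBsep hE,
      PIE2D.solvesPIEinL2_iff_solvesPDEinL2 A hB hBsep hE⟩⟩
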